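/- Conventions. $M(A)$ is the multiplier algebra of a C$^*$-algebra $A$, $\otimes$ is the minimal tensor product of C$^*$-algebras, $[\,\cdot\,]$ denotes closed linear span, $B_0(\mathcal H)$ denotes the compact operators on $\mathcal H$, and $*$-homomorphisms such as $\Delta\otimes\mathrm{id}$ and slice maps such as $\omega\otimes\mathrm{id}$ ($\omega\in A^*$) are extended to multiplier algebras by strict continuity. Let $I$ be a set. A *C$^*$-algebraic $I$-partial compact quantum semigroup* $\mathscr G=(A,\Delta,\{\mathbf 1(k,l)\})$ consists of a (not necessarily unital) C$^*$-algebra $A$, mutually orthogonal self-adjoint projections $\mathbf 1(k,l)\in A$ ($k,l\in I$) and a $*$-homomorphism $\Delta:A\to M(A\otimes A)$ such that $\sum_{k,l}\mathbf 1(k,l)=1$ strictly in $M(A)$; $\Delta(\mathbf 1(k,l))=\sum_m \mathbf 1(k,m)\otimes\mathbf 1(m,l)$ strictly for all $k,l$; and $(\Delta\otimes\mathrm{id})\Delta=(\mathrm{id}\otimes\Delta)\Delta$. Put $\lambda_k=\sum_m\mathbf 1(k,m)$, $\rho_m=\sum_k\mathbf 1(k,m)$, $P=\sum_k\mathbf 1(k,k)$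 in $M(A)$, $A_P=PAP$, and $\Delta(1)=\sum_{k,l,m}\mathbf 1(k,m)\otimes\mathbf 1(m,l)\in M(A\otimes A)$. $\mathscr G$ is a *C$^*$-algebraic $I$-partial compact quantum group* if (U3) $\mathbf 1(k,k)\neq 0$ for all $k\in I$; (D1) $(A\otimes A)\Delta(1)=[(A\otimes 1)\Delta(A)]=[(1\otimes A)\Delta(A)]$; (D2) $A=[(\omega\otimes\mathrm{id})\Delta(A_P)\mid\omega\in A^*]=[(\mathrm{id}\otimes\omega)\Delta(A_P)\mid\omega\in A^*]$. Let $\mathcal H=\bigoplus_{k,l\in I}\mathcal H(k,l)$ be an $I$-bigraded Hilbert space, with projections $p_{kl}$ onto its components, $\lambda^{\mathcal H}_k=\sum_l p_{kl}$ and $\rho^{\mathcal H}_l=\sum_k p_{kl}$. A *representation* of $\mathscr G$ on $\mathcal H$ is an element $X\in M(A\otimes B_0(\mathcal H))$ with $(\Delta\otimes\mathrm{id})(X)=X_{13}X_{23}$ and $(\mathbf 1(k,m)\otimes 1)X(\mathbf 1(l,n)\otimes 1)=(1\otimes p_{kl})X(1\otimes p_{mn})$ for all $k,l,m,n$; this element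 is denoted $X^{kl}_{mn}$. It is *rcfd* if all $\lambda_k^{\mathcal H}$ and $\rho_m^{\mathcal H}$ have finite rank, and *unitary* if $X^*X=\sum_n\rho_n\otimes\rho_n^{\mathcal H}$ and $XX^*=\sum_k\lambda_k\otimes\lambda_k^{\mathcal H}$ strictly. $(\mathscr G,X)$ is a *C$^*$-algebraic $I$-partial compact matrix pseudogroup* if $X$ is a unitary rcfd representation of $\mathscr G$, (U3) holds, the algebra $\mathscr A\subseteq A$ generated by the $\mathbf 1(k,l)$ and the matrix coefficients of all $X^{kl}_{mn}$ is dense in $A$, and there is a linear anti-multiplicative map $S:\mathscr A\to\mathscr A$ with $S(\mathbf 1(k,l))=\mathbf 1(l,k)$ and $(S\otimes\mathrm{id})X^{kl}_{mn}=(X^{mn}_{kl})^*$ for all $k,l,m,n$. **Theorem.** If $(\mathscr G,X)$ is a C$^*$-algebraic $I$-partial compact matrix pseudogroup, then $\mathscr G$ is a C$^*$-algebraic $I$-partial compact quantum group, that is, it satisfies (U3), (D1) and (D2). -/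

import Mathlib

open Filter Topology TensorProduct

noncomputable section

namespace PartialCQG

/-! ### Hilbert space tensor products and operators on them -/

section Hilbert

variable {E F G E' F' : Type*}
  [NormedAddCommGroup E] [InnerProductSpace ℂ E] [NormedAddCommGroup F] [InnerProductSpace ℂ F]
  [NormedAddCommGroup G] [InnerProductSpace ℂ G]
  [NormedAddCommGroup E'] [InnerProductSpace ℂ E'] [NormedAddCommGroup F'] [InnerProductSpace ℂ F']

variable (E F) in
/-- The Hilbert space tensor product: the completion of the algebraic tensor product with its
inner product. -/
def HilbertTensor : Type _ := UniformSpace.Completion (E ⊗[ℂ] F)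

instance : NormedAddCommGroup (HilbertTensor E F) :=
  inferInstanceAs (NormedAddCommGroup (UniformSpace.Completion (E ⊗[ℂ] F)))

instance : InnerProductSpace ℂ (HilbertTensor E F) :=
  inferInstanceAs (InnerProductSpace ℂ (UniformSpace.Completion (E ⊗[ℂ] F)))

instance : CompleteSpace (HilbertTensor E F) :=
  inferInstanceAs (CompleteSpace (UniformSpace.Completion (E ⊗[ℂ] F)))

variable (E F) in
/-- The inclusion of the algebraic tensor product in the Hilbert space tensor product. -/
def incl : E ⊗[ℂ] F →ₗᵢ[ℂ] HilbertTensor E F :=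
  (UniformSpace.Completion.toComplₗᵢ : E ⊗[ℂ] F →ₗᵢ[ℂ] UniformSpace.Completion (E ⊗[ℂ] F))

lemma denseRange_incl : DenseRange (incl E F) :=
  UniformSpace.Completion.denseRange_coe (α := E ⊗[ℂ] F)

/-- The operator `S ⊗ T` on the Hilbert space tensor product. -/
def opTensor (S : E →L[ℂ] E') (T : F →L[ℂ] F') : HilbertTensor E F →L[ℂ] HilbertTensor E' F' :=
  (TensorProduct.mapL S T).completion

lemma opTensor_incl (S : E →L[ℂ] E') (T : F →L[ℂ] F') (x : E ⊗[ℂ] F) :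
    opTensor S T (incl E F x) = incl E' F' (TensorProduct.mapL S T x) :=
  UniformSpace.Completion.map_coe (TensorProduct.mapL S T).uniformContinuous x

lemma opTensor_ext {S T : HilbertTensor E F →L[ℂ] G}
    (h : ∀ x : E ⊗[ℂ] F, S (incl E F x) = T (incl E F x)) : S = T := by
  ext x
  exact denseRange_incl.induction_on x (isClosed_eq S.continuous T.continuous) h

/-- The map `x ↦ x ⊗ ξ`. -/
def creation (ξ : F) : E →L[ℂ] HilbertTensor E F :=
  (incl E F).toContinuousLinearMap ∘L ((TensorProduct.mkL ℂ E F).flip ξ)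

variable (E F) in
/-- The flip `x ⊗ y ↦ y ⊗ x`. -/
def flip : HilbertTensor E F →L[ℂ] HilbertTensor F E :=
  ((TensorProduct.commIsometry ℂ E F).toLinearIsometry.toContinuousLinearMap).completion

variable (E F G) in
/-- The inclusion of the threefold algebraic tensor product in `(E ⊗ F) ⊗ G`. -/
def inclLeft : (E ⊗[ℂ] F) ⊗[ℂ] G →ₗᵢ[ℂ] HilbertTensor (HilbertTensor E F) G :=
  (incl (HilbertTensor E F) G).comp ((incl E F).rTensor G)

variable (E F G) in
/-- The inclusion of the threefold algebraic tensor product in `E ⊗ (F ⊗ G)`. -/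
def inclRight : E ⊗[ℂ] (F ⊗[ℂ] G) →ₗᵢ[ℂ] HilbertTensor E (HilbertTensor F G) :=
  (incl E (HilbertTensor F G)).comp ((incl F G).lTensor E)

lemma denseRange_rTensor (f : E →ₗᵢ[ℂ] F) (hf : DenseRange f) : DenseRange (f.rTensor G) := by
  have key : ∀ z : F ⊗[ℂ] G, z ∈ closure (Set.range (f.rTensor G)) := by
    intro z
    change z ∈ (LinearMap.range (f.rTensor G).toLinearMap).topologicalClosure
    induction z with
    | zero => exact zero_mem _
    | add x y hx hy => exact add_mem hx hy
    | tmul x y =>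
      refine hf.induction_on (p := fun x => x ⊗ₜ[ℂ] y ∈
        (LinearMap.range (f.rTensor G).toLinearMap).topologicalClosure) x ?_ ?_
      · exact (Submodule.isClosed_topologicalClosure _).preimage
          (((TensorProduct.mkL ℂ F G).flip y).continuous)
      · intro a
        exact Submodule.le_topologicalClosure _ ⟨a ⊗ₜ y, by simp⟩
  exact key

lemma denseRange_lTensor (f : E →ₗᵢ[ℂ] F) (hf : DenseRange f) : DenseRange (f.lTensor G) := by
  have key : ∀ z : G ⊗[ℂ] F, z ∈ closure (Set.range (f.lTensor G)) := by
    intro z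
    change z ∈ (LinearMap.range (f.lTensor G).toLinearMap).topologicalClosure
    induction z with
    | zero => exact zero_mem _
    | add x y hx hy => exact add_mem hx hy
    | tmul y x =>
      refine hf.induction_on (p := fun x => y ⊗ₜ[ℂ] x ∈
        (LinearMap.range (f.lTensor G).toLinearMap).topologicalClosure) x ?_ ?_
      · exact (Submodule.isClosed_topologicalClosure _).preimage
          ((TensorProduct.mkL ℂ G F y).continuous)
      · intro a
        exact Submodule.le_topologicalClosure _ ⟨y ⊗ₜ a, by simp⟩
  exact key

lemma denseRange_inclLeft : DenseRange (inclLeft E F G) :=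
  denseRange_incl.comp (denseRange_rTensor _ denseRange_incl) (incl _ _).continuous

lemma denseRange_inclRight : DenseRange (inclRight E F G) :=
  denseRange_incl.comp (denseRange_lTensor _ denseRange_incl) (incl _ _).continuous

variable (E F G) in
/-- The associativity unitary `(E ⊗ F) ⊗ G → E ⊗ (F ⊗ G)`. -/
def assoc : HilbertTensor (HilbertTensor E F) G ≃ₗᵢ[ℂ] HilbertTensor E (HilbertTensor F G) :=
  (TensorProduct.assoc ℂ E F G).extendOfIsometry
    (inclLeft E F G).toLinearMap (inclRight E F G).toLinearMap
    denseRange_inclLeft denseRange_inclRight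
    (fun x => by
      change ‖inclRight E F G _‖ = ‖inclLeft E F G x‖
      rw [LinearIsometry.norm_map, LinearIsometry.norm_map, TensorProduct.norm_assoc])

/-- Leg numbering: `X₂₃ = 1 ⊗ X` on `(E ⊗ F) ⊗ G`. -/
def leg23 (X : HilbertTensor F G →L[ℂ] HilbertTensor F G) :
    HilbertTensor (HilbertTensor E F) G →L[ℂ] HilbertTensor (HilbertTensor E F) G :=
  (assoc E F G).symm.toLinearIsometry.toContinuousLinearMap ∘L
    opTensor (ContinuousLinearMap.id ℂ E) X ∘L
    (assoc E F G).toLinearIsometry.toContinuousLinearMap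

/-- Leg numbering: `X₁₃` on `(E ⊗ F) ⊗ G`, obtained from `X₂₃` by flipping the first two legs. -/
def leg13 (X : HilbertTensor E G →L[ℂ] HilbertTensor E G) :
    HilbertTensor (HilbertTensor E F) G →L[ℂ] HilbertTensor (HilbertTensor E F) G :=
  opTensor (flip F E) (ContinuousLinearMap.id ℂ G) ∘L leg23 X ∘L
    opTensor (flip E F) (ContinuousLinearMap.id ℂ G)

/-- The sum `∑ i, q i` (in the strong operator topology) of a family of mutually orthogonal
projections: the projection onto the closed span of their ranges. -/
def projSum [CompleteSpace E] {ι : Type*} (q : ι → (E →L[ℂ] E)) : E →L[ℂ] E :=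
  (⨆ i, LinearMap.range (q i).toLinearMap).topologicalClosure.starProjection

end Hilbert

/-! ### Spatial tensor products, multipliers and strict topology -/

section Multiplier

variable {E F : Type*}
  [NormedAddCommGroup E] [InnerProductSpace ℂ E] [NormedAddCommGroup F] [InnerProductSpace ℂ F]

/-- For linear maps `α : V → B(E)` and `β : W → B(F)`, the map `α ⊗ β` from the algebraic tensor
product `V ⊗ W` to `B(E ⊗ F)`. -/
def algTensor {V W : Type*} [AddCommGroup V] [Module ℂ V] [AddCommGroup W] [Module ℂ W]
    (α : V →ₗ[ℂ] (E →L[ℂ] E)) (β : W →ₗ[ℂ] (F →L[ℂ] F)) :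
    V ⊗[ℂ] W →ₗ[ℂ] (HilbertTensor E F →L[ℂ] HilbertTensor E F) :=
  TensorProduct.lift <| LinearMap.mk₂ ℂ (fun v w => opTensor (α v) (β w))
    (fun v v' w => opTensor_ext fun x => by
      simp [opTensor_incl, TensorProduct.mapL_add_left])
    (fun c v w => opTensor_ext fun x => by
      simp [opTensor_incl, TensorProduct.mapL_smul_left])
    (fun v w w' => opTensor_ext fun x => by
      simp [opTensor_incl, TensorProduct.mapL_add_right])
    (fun c v w => opTensor_ext fun x => by
      simp [opTensor_incl, TensorProduct.mapL_smul_right])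

/-- The minimal (spatial) tensor product of the C*-algebras `α(V) ⊆ B(E)` and `β(W) ⊆ B(F)`: the
norm closure of their algebraic tensor product in `B(E ⊗ F)`. -/
def minTensor {V W : Type*} [AddCommGroup V] [Module ℂ V] [AddCommGroup W] [Module ℂ W]
    (α : V →ₗ[ℂ] (E →L[ℂ] E)) (β : W →ₗ[ℂ] (F →L[ℂ] F)) :
    Submodule ℂ (HilbertTensor E F →L[ℂ] HilbertTensor E F) :=
  (LinearMap.range (algTensor α β)).topologicalClosure

/-- The multiplier algebra `M(C)` of a C*-algebra `C` acting nondegenerately on `E`, realised as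
the idealizer of `C` in `B(E)`. -/
def multipliers (C : Submodule ℂ (E →L[ℂ] E)) : Set (E →L[ℂ] E) :=
  {T | ∀ c ∈ C, T * c ∈ C ∧ c * T ∈ C}

/-- The neighbourhoods of `T` in the strict topology defined by `C`: the coarsest topology making
`S ↦ S * c` and `S ↦ c * S` norm continuous for all `c ∈ C`. -/
def strictNhds (C : Submodule ℂ (E →L[ℂ] E)) (T : E →L[ℂ] E) : Filter (E →L[ℂ] E) :=
  ⨅ c ∈ C, (comap (fun S => S * c) (𝓝 (T * c)) ⊓ comap (fun S => c * S) (𝓝 (c * T)))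

/-- `∑ i, x i = s` (unordered sum) in the strict topology of `M(C)`. -/
def HasStrictSum (C : Submodule ℂ (E →L[ℂ] E)) {ι : Type*} (x : ι → (E →L[ℂ] E))
    (s : E →L[ℂ] E) : Prop :=
  Tendsto (fun J : Finset ι => ∑ i ∈ J, x i) atTop (strictNhds C s)

/-- `Z ∈ M(D)` is the value at `T ∈ M(C)` of the strictly continuous extension `M(C) → M(D)` of
the map `f : V → M(D)`, where `V` is embedded by `ι` as a strictly dense subspace of `M(C)`. -/
def IsStrictExtensionAt {V : Type*} (ι : V → (E →L[ℂ] E)) (C : Submodule ℂ (E →L[ℂ] E))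
    (f : V → (F →L[ℂ] F)) (D : Submodule ℂ (F →L[ℂ] F))
    (T : E →L[ℂ] E) (Z : F →L[ℂ] F) : Prop :=
  Z ∈ multipliers D ∧ Tendsto f (comap ι (strictNhds C T)) (strictNhds D Z)

end Multiplier

/-! ### Partial compact quantum semigroups -/

/-- A faithful nondegenerate representation of a C*-algebra `A` on a Hilbert space `K`. It serves to
realise the minimal tensor products of `A` and the multiplier algebras concretely, which do not
depend on its choice; every C*-algebra has such a representation. -/
structure FaithfulRep (A K : Type*) [NonUnitalCStarAlgebra A] [NormedAddCommGroup K]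
    [InnerProductSpace ℂ K] [CompleteSpace K] where
  toHom : A →⋆ₙₐ[ℂ] (K →L[ℂ] K)
  injective : Function.Injective toHom
  nondegenerate :
    (Submodule.span ℂ {y : K | ∃ (a : A) (x : K), toHom a x = y}).topologicalClosure = ⊤

section Semigroup

variable {A K : Type*} [NonUnitalCStarAlgebra A] [NormedAddCommGroup K] [InnerProductSpace ℂ K]
  [CompleteSpace K]

/-- The representation as a linear map. -/
def FaithfulRep.lin (π : FaithfulRep A K) : A →ₗ[ℂ] (K →L[ℂ] K) where
  toFun a := π.toHom a
  map_add' a b := map_add π.toHom a b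
  map_smul' c a := map_smul π.toHom c a

/-- `A`, as a subspace of `B(K)`. -/
def FaithfulRep.image (π : FaithfulRep A K) : Submodule ℂ (K →L[ℂ] K) := LinearMap.range π.lin

/-- `A ⊗ A ⊆ B(K ⊗ K)`. -/
def FaithfulRep.tensor2 (π : FaithfulRep A K) :
    Submodule ℂ (HilbertTensor K K →L[ℂ] HilbertTensor K K) := minTensor π.lin π.lin

/-- A C*-algebraic `I`-partial compact quantum semigroup `(A, Δ, {1(k,l)})`. -/
structure PartialCompactQuantumSemigroup (I : Type*) (π : FaithfulRep A K) where
  /-- the projections `1(k,l)` -/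
  unit : I → I → A
  /-- the comultiplication -/
  comul : A →⋆ₙₐ[ℂ] (HilbertTensor K K →L[ℂ] HilbertTensor K K)
  isStarProjection_unit : ∀ k l, IsStarProjection (unit k l)
  orthogonal_unit : ∀ k l m n, (k, l) ≠ (m, n) → unit k l * unit m n = 0
  comul_mem : ∀ a, comul a ∈ multipliers π.tensor2
  /-- (U1) -/
  sum_unit : HasStrictSum π.image (fun kl : I × I => π.toHom (unit kl.1 kl.2)) 1
  /-- (U2) -/
  comul_unit : ∀ k l, HasStrictSum π.tensor2
    (fun m => opTensor (π.toHom (unit k m)) (π.toHom (unit m l))) (comul (unit k l))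
  /-- (C): `(Δ ⊗ id)(Δ(a)) = (id ⊗ Δ)(Δ(a))`, where `Δ ⊗ id` and `id ⊗ Δ` are extended to
  `M(A ⊗ A)` by strict continuity. -/
  coassoc : ∀ a, ∃ Z Z',
    IsStrictExtensionAt (algTensor π.lin π.lin) π.tensor2
      (algTensor (comul : A →ₗ[ℂ] (HilbertTensor K K →L[ℂ] HilbertTensor K K)) π.lin)
      (minTensor π.tensor2.subtype π.lin) (comul a) Z ∧
    IsStrictExtensionAt (algTensor π.lin π.lin) π.tensor2
      (algTensor π.lin (comul : A →ₗ[ℂ] (HilbertTensor K K →L[ℂ] HilbertTensor K K)))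
      (minTensor π.lin π.tensor2.subtype) (comul a) Z' ∧
    ∀ x, assoc K K K (Z x) = Z' (assoc K K K x)

namespace PartialCompactQuantumSemigroup

variable {I : Type*} {π : FaithfulRep A K} (G : PartialCompactQuantumSemigroup I π)

/-- `Δ` as a linear map. -/
def comulLin : A →ₗ[ℂ] (HilbertTensor K K →L[ℂ] HilbertTensor K K) := G.comul

/-- The projection `1(k,l)` as an operator. -/
def unitOp (k l : I) : K →L[ℂ] K := π.toHom (G.unit k l)

/-- The source projection `λ_k = ∑ m, 1(k,m)`. -/
def source (k : I) : K →L[ℂ] K := projSum fun m => G.unitOp k m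

/-- The target projection `ρ_m = ∑ k, 1(k,m)`. -/
def target (m : I) : K →L[ℂ] K := projSum fun k => G.unitOp k m

/-- `Δ(1) = ∑ k l m, 1(k,m) ⊗ 1(m,l)`. -/
def comulOne : HilbertTensor K K →L[ℂ] HilbertTensor K K :=
  projSum fun i : I × I × I => opTensor (G.unitOp i.1 i.2.2) (G.unitOp i.2.2 i.2.1)

/-- `P = ∑ k, 1(k,k)`. -/
def diag : K →L[ℂ] K := projSum fun k => G.unitOp k k

/-- `A_P = P A P`. -/
def corner : Set A := {a | ∃ b : A, π.toHom a = G.diag * π.toHom b * G.diag}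

/-- `y = (ω ⊗ id)(T)` for `T ∈ M(A ⊗ A)`. -/
def IsLeftSlice (_G : PartialCompactQuantumSemigroup I π) (ω : A →L[ℂ] ℂ)
    (T : HilbertTensor K K →L[ℂ] HilbertTensor K K) (y : K →L[ℂ] K) : Prop :=
  IsStrictExtensionAt (algTensor π.lin π.lin) π.tensor2
    (fun t => π.toHom (TensorProduct.lid ℂ A ((ω : A →ₗ[ℂ] ℂ).rTensor A t))) π.image T y

/-- `y = (id ⊗ ω)(T)` for `T ∈ M(A ⊗ A)`. -/
def IsRightSlice (_G : PartialCompactQuantumSemigroup I π) (ω : A →L[ℂ] ℂ)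
    (T : HilbertTensor K K →L[ℂ] HilbertTensor K K) (y : K →L[ℂ] K) : Prop :=
  IsStrictExtensionAt (algTensor π.lin π.lin) π.tensor2
    (fun t => π.toHom (TensorProduct.rid ℂ A ((ω : A →ₗ[ℂ] ℂ).lTensor A t))) π.image T y

/-- (U3) -/
def UnitsNonzero : Prop := ∀ k, G.unit k k ≠ 0

/-- (D1): `(A ⊗ A)Δ(1) = [(A ⊗ 1)Δ(A)] = [(1 ⊗ A)Δ(A)]`. -/
def DensityOne : Prop :=
  {t * G.comulOne | t ∈ π.tensor2} =
      closure (Submodule.span ℂ {opTensor (π.toHom a) 1 * G.comul b | (a : A) (b : A)} :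
        Set (HilbertTensor K K →L[ℂ] HilbertTensor K K)) ∧
  {t * G.comulOne | t ∈ π.tensor2} =
      closure (Submodule.span ℂ {opTensor 1 (π.toHom a) * G.comul b | (a : A) (b : A)} :
        Set (HilbertTensor K K →L[ℂ] HilbertTensor K K))

/-- (D2): `A = [(ω ⊗ id)Δ(A_P) ∣ ω ∈ A*] = [(id ⊗ ω)Δ(A_P) ∣ ω ∈ A*]`. -/
def DensityTwo : Prop :=
  (π.image : Set (K →L[ℂ] K)) =
      closure (Submodule.span ℂ {y | ∃ ω : A →L[ℂ] ℂ, ∃ a ∈ G.corner,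
        G.IsLeftSlice ω (G.comul a) y} : Set (K →L[ℂ] K)) ∧
  (π.image : Set (K →L[ℂ] K)) =
      closure (Submodule.span ℂ {y | ∃ ω : A →L[ℂ] ℂ, ∃ a ∈ G.corner,
        G.IsRightSlice ω (G.comul a) y} : Set (K →L[ℂ] K))

/-- A C*-algebraic `I`-partial compact quantum group. -/
structure IsPartialCompactQuantumGroup : Prop where
  units_ne_zero : G.UnitsNonzero
  density_one : G.DensityOne
  density_two : G.DensityTwo

end PartialCompactQuantumSemigroup

end Semigroup

/-! ### Representations and matrix pseudogroups -/

section Representation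

/-- An `I`-bigrading `H = ⨁ k l, H(k,l)` (Hilbert space direct sum) of a Hilbert space, given by the
projections onto the components. -/
structure Bigrading (I H : Type*) [NormedAddCommGroup H] [InnerProductSpace ℂ H]
    [CompleteSpace H] where
  proj : I → I → (H →L[ℂ] H)
  isStarProjection_proj : ∀ k l, IsStarProjection (proj k l)
  orthogonal_proj : ∀ k l m n, (k, l) ≠ (m, n) → proj k l * proj m n = 0
  sum_proj : ∀ x : H, HasSum (fun kl : I × I => proj kl.1 kl.2 x) x

variable {I A K H : Type*} [NonUnitalCStarAlgebra A]
  [NormedAddCommGroup K] [InnerProductSpace ℂ K] [CompleteSpace K]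
  [NormedAddCommGroup H] [InnerProductSpace ℂ H] [CompleteSpace H]

/-- `λ_k^H = ∑ l, p(k,l)`. -/
def Bigrading.row (p : Bigrading I H) (k : I) : H →L[ℂ] H := projSum fun l => p.proj k l

/-- `ρ_l^H = ∑ k, p(k,l)`. -/
def Bigrading.col (p : Bigrading I H) (l : I) : H →L[ℂ] H := projSum fun k => p.proj k l

variable (H) in
/-- The inclusion of the compact operators `B₀(H)` in `B(H)`. -/
def compactIncl : compactOperator (RingHom.id ℂ) H H →ₗ[ℂ] (H →L[ℂ] H) :=
  (compactOperator (RingHom.id ℂ) H H).subtype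

/-- A representation of a partial compact quantum semigroup on a bigraded Hilbert space. -/
structure Representation {π : FaithfulRep A K} (G : PartialCompactQuantumSemigroup I π)
    (p : Bigrading I H) where
  /-- the element `X ∈ M(A ⊗ B₀(H))` -/
  op : HilbertTensor K H →L[ℂ] HilbertTensor K H
  mem : op ∈ multipliers (minTensor π.lin (compactIncl H))
  /-- (Co1): `(Δ ⊗ id)(X) = X₁₃ X₂₃` -/
  co1 : IsStrictExtensionAt (algTensor π.lin (compactIncl H)) (minTensor π.lin (compactIncl H))
    (algTensor G.comulLin (compactIncl H)) (minTensor π.tensor2.subtype (compactIncl H))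
    op (leg13 op * leg23 op)
  /-- (Co2) -/
  co2 : ∀ k l m n,
    opTensor (G.unitOp k m) 1 * op * opTensor (G.unitOp l n) 1 =
      opTensor 1 (p.proj k l) * op * opTensor 1 (p.proj m n)

namespace Representation

variable {π : FaithfulRep A K} {G : PartialCompactQuantumSemigroup I π} {p : Bigrading I H}
  (X : Representation G p)

/-- Row- and column finite dimensional. -/
def IsRcfd (_X : Representation G p) : Prop :=
  (∀ k, FiniteDimensional ℂ (LinearMap.range (p.row k).toLinearMap)) ∧
  (∀ m, FiniteDimensional ℂ (LinearMap.range (p.col m).toLinearMap))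

/-- `X*X = ∑ n, ρ_n ⊗ ρ_n^H` and `XX* = ∑ k, λ_k ⊗ λ_k^H`, strictly in `M(A ⊗ B₀(H))`. -/
def IsUnitary : Prop :=
  HasStrictSum (minTensor π.lin (compactIncl H))
    (fun n => opTensor (G.target n) (p.col n)) (star X.op * X.op) ∧
  HasStrictSum (minTensor π.lin (compactIncl H))
    (fun k => opTensor (G.source k) (p.row k)) (X.op * star X.op)

/-- The block `X(k,l;m,n) = (1(k,m) ⊗ 1) X (1(l,n) ⊗ 1)`. -/
def block (k l m n : I) : HilbertTensor K H →L[ℂ] HilbertTensor K H :=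
  opTensor (G.unitOp k m) 1 * X.op * opTensor (G.unitOp l n) 1

/-- The slice `(id ⊗ ω_{ξ,η})(T)`, where `ω_{ξ,η}(b) = ⟪ξ, b η⟫`. -/
def coeff (T : HilbertTensor K H →L[ℂ] HilbertTensor K H) (ξ η : H) : K →L[ℂ] K :=
  (creation ξ : K →L[ℂ] HilbertTensor K H).adjoint ∘L T ∘L creation η

/-- The matrix coefficients, in `A`, of all blocks `X(k,l;m,n)`. -/
def matrixCoefficients : Set A :=
  {a | ∃ (k l m n : I) (ξ η : H), p.proj k l ξ = ξ ∧ p.proj m n η = η ∧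
    π.toHom a = coeff (X.block k l m n) ξ η}

/-- The algebra generated by the `1(k,l)` and the matrix coefficients of `X`. -/
def coefficientAlgebra : NonUnitalSubalgebra ℂ A :=
  NonUnitalAlgebra.adjoin ℂ ({a | ∃ k l, a = G.unit k l} ∪ X.matrixCoefficients)

/-- `S` is an antipode: linear, anti-multiplicative, `S(1(k,l)) = 1(l,k)` and
`(S ⊗ id)(X(k,l;m,n)) = X(m,n;k,l)*`, the latter on matrix coefficients. -/
def IsAntipode (S : X.coefficientAlgebra →ₗ[ℂ] X.coefficientAlgebra) : Prop :=
  (∀ a b, S (a * b) = S b * S a) ∧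
  (∀ k l (a : X.coefficientAlgebra), (a : A) = G.unit k l → (S a : A) = G.unit l k) ∧
  (∀ k l m n (ξ η : H) (a : X.coefficientAlgebra), p.proj k l ξ = ξ → p.proj m n η = η →
    π.toHom (a : A) = coeff (X.block k l m n) ξ η →
    π.toHom (S a : A) = coeff (star (X.block m n k l)) ξ η)

/-- `(G, X)` is a C*-algebraic `I`-partial compact matrix pseudogroup. -/
structure IsPartialCompactMatrixPseudogroup : Prop where
  rcfd : X.IsRcfd
  unitary : X.IsUnitary
  /-- (U3) -/
  units_ne_zero : G.UnitsNonzero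
  /-- (D) -/
  dense : Dense (X.coefficientAlgebra : Set A)
  /-- (A) -/
  antipode : ∃ S, X.IsAntipode S

end Representation

end Representation

end PartialCQG

end

/-!
Write `x(b,c)` for the entries of the unitary representation `X` with respect to an orthonormal
basis of homogeneous vectors of `H`; the basis vector `b` has bidegree `(s b, t b)`, and because
`X` is rcfd every row `{b | s b = r}` and every column `{b | t b = n}` is finite. In terms of these
entries the hypotheses become algebraic: `x(b,c)` lies in `1(s b, s c) A 1(t b, t c)`,

* `(1(s b, r) ⊗ 1) Δ(x(b,c)) = ∑ x(b,d) ⊗ x(d,c)`, summed over the row `r`,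
* `∑ x(d,b)* x(d,c) = δ(b,c) 1(n, t b)`, summed over the column `n`,
* `S(x(b,c)) = x(c,b)*`.

A matrix with these properties is a `MatrixCorep`. The units `1(k,l)` form one, and so do the
products of the entries of two of them, indexed by composable pairs of labels. Hence the algebra
`𝒜` is the linear span of the entries of all matrix corepresentations
(`Representation.mem_span_coefs`), and on entries `S(S(a)*) = a*`, so that `S` is injective and
every entry is a value of `S`. It remains to treat one matrix corepresentation at a time
(`MatrixCorep.density`).

(D1) Unitarity gives `∑ (x(d,b)* ⊗ 1) Δ(x(d,c)) = 1(n, t b) ⊗ x(b,c)`. Applying `S⁻¹` to the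
unitarity relation yields `y(d) = S⁻¹(x(d,c))` with
`∑ (1 ⊗ y(d)) Δ(x(b,d)) = x(b,c) ⊗ 1(t c, n)`. After multiplication by `Δ(1)` these elements
generate `(A ⊗ A)Δ(1)`. Conversely `(A ⊗ 1)Δ(A)` lies in `A ⊗ A`, since already
`(1(k,r) ⊗ 1) Δ(1(k,l)) = 1(k,r) ⊗ 1(r,l)` does, and the `1(k,l)` sum to `1`.

(D2) The entry `x(c,c)` lies in the corner `A_P`, and slicing `Δ(x(c,c))` by vector functionals `ω`
supported in `1(s c, k)` on the left gives the elements `∑ ω(x(c,b)) x(b,c)`, with `b` in the row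
`k`. If `v` annihilates all the vectors `(ω(x(c,b)))_b`, then `∑ v_b x(c,b) = 0`, and by the
injectivity of `S` also `∑ v̄_b x(b,c) = 0`: the linear map `w ↦ ∑ w_b x(b,c)` vanishes on the
orthogonal complement of those vectors, so each `x(b,c)` is a combination of slices
(`mem_of_forall_orthogonal`, `MatrixCorep.coef_mem_leftSlices`). The second leg is similar, with
`Δ(x(b,b))`.

The analytic part consists of the passage between strictly continuous extensions and these
identities. The finite sums of the `1(k,l)` are an approximate unit of projections, which makes the
algebraic tensor products strictly dense in the multiplier algebras, with bounds
(`IsApproxUnit.frequently_comap`). Approximating `X` in this way turns `(Δ ⊗ id)(X) = X₁₃X₂₃` into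
the formula for `Δ(x(b,c))` (`Representation.comul_coeff`). Finally, every `ω ∈ A*` is a norm limit
of functionals `ω(e ·)` with `e` such a finite sum, and since `(e ⊗ 1)Δ(a) ∈ A ⊗ A` this shows that
the slices of `Δ(a)` lie in `A` itself (`IsLeftSlice.mem_image`).
-/

noncomputable section

universe u

namespace PartialCQG

/-! ### Elementary tensors and tensor products of operators -/

section TensorCalculus

variable {E F G E' F' E'' F'' : Type*}
  [NormedAddCommGroup E] [InnerProductSpace ℂ E] [NormedAddCommGroup F] [InnerProductSpace ℂ F]
  [NormedAddCommGroup G] [InnerProductSpace ℂ G]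
  [NormedAddCommGroup E'] [InnerProductSpace ℂ E'] [NormedAddCommGroup F'] [InnerProductSpace ℂ F']
  [NormedAddCommGroup E''] [InnerProductSpace ℂ E'']
  [NormedAddCommGroup F''] [InnerProductSpace ℂ F'']

/-- The elementary tensor `x ⊗ y` in the Hilbert space tensor product. -/
def tm (x : E) (y : F) : HilbertTensor E F := incl E F (x ⊗ₜ y)

lemma inner_tm (x x' : E) (y y' : F) :
    inner ℂ (tm x y) (tm x' y') = inner ℂ x x' * inner ℂ y y' := by
  simp [tm, LinearIsometry.inner_map_map]

lemma norm_tm (x : E) (y : F) : ‖tm x y‖ = ‖x‖ * ‖y‖ := by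
  simp [tm]

lemma tm_add_left (x x' : E) (y : F) : tm (x + x') y = tm x y + tm x' y := by
  simp [tm, TensorProduct.add_tmul]

lemma tm_smul_left (c : ℂ) (x : E) (y : F) : tm (c • x) y = c • tm x y := by
  rw [tm, ← TensorProduct.smul_tmul', map_smul, tm]

lemma tm_add_right (x : E) (y y' : F) : tm x (y + y') = tm x y + tm x y' := by
  simp [tm, TensorProduct.tmul_add]

lemma tm_sub_left (x x' : E) (y : F) : tm (x - x') y = tm x y - tm x' y := by
  simp [tm, TensorProduct.sub_tmul]

lemma tm_sub_right (x : E) (y y' : F) : tm x (y - y') = tm x y - tm x y' := by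
  simp [tm, TensorProduct.tmul_sub]

lemma tm_smul_right (c : ℂ) (x : E) (y : F) : tm x (c • y) = c • tm x y := by
  simp [tm]

@[simp] lemma tm_zero_left (y : F) : tm (0 : E) y = 0 := by simp [tm]

@[simp] lemma tm_zero_right (x : E) : tm x (0 : F) = 0 := by simp [tm]

/-- Elementary tensors are total. -/
lemma clm_ext_tm {S T : HilbertTensor E F →L[ℂ] G} (h : ∀ x y, S (tm x y) = T (tm x y)) :
    S = T := by
  refine opTensor_ext fun t => ?_
  induction t with
  | zero => simp
  | add x y hx hy => simp [hx, hy]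
  | tmul x y => exact h x y

lemma eq_of_inner_tm {u v : HilbertTensor E F}
    (h : ∀ x y, inner ℂ (tm x y) u = inner ℂ (tm x y) v) : u = v := by
  have : innerSL ℂ u = innerSL ℂ v := clm_ext_tm fun x y => by
    have := congrArg (starRingEnd ℂ) (h x y)
    simpa [innerSL_apply_apply, inner_conj_symm] using this
  refine ext_inner_right ℂ fun w => ?_
  simpa [innerSL_apply_apply] using congrArg (fun f => f w) this

@[simp] lemma opTensor_tm (S : E →L[ℂ] E') (T : F →L[ℂ] F') (x : E) (y : F) :
    opTensor S T (tm x y) = tm (S x) (T y) := by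
  rw [tm, opTensor_incl]; simp [tm]

lemma opTensor_comp (S : E' →L[ℂ] E'') (S' : E →L[ℂ] E') (T : F' →L[ℂ] F'') (T' : F →L[ℂ] F') :
    opTensor S T ∘L opTensor S' T' = opTensor (S ∘L S') (T ∘L T') :=
  clm_ext_tm fun x y => by simp

lemma opTensor_mul (S S' : E →L[ℂ] E) (T T' : F →L[ℂ] F) :
    opTensor S T * opTensor S' T' = opTensor (S * S') (T * T') :=
  opTensor_comp _ _ _ _

lemma opTensor_add_left (S S' : E →L[ℂ] E') (T : F →L[ℂ] F') :
    opTensor (S + S') T = opTensor S T + opTensor S' T :=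
  clm_ext_tm fun x y => by simp [tm_add_left]

lemma opTensor_add_right (S : E →L[ℂ] E') (T T' : F →L[ℂ] F') :
    opTensor S (T + T') = opTensor S T + opTensor S T' :=
  clm_ext_tm fun x y => by simp [tm_add_right]

lemma opTensor_smul_left (c : ℂ) (S : E →L[ℂ] E') (T : F →L[ℂ] F') :
    opTensor (c • S) T = c • opTensor S T :=
  clm_ext_tm fun x y => by simp [tm_smul_left]

lemma opTensor_smul_right (c : ℂ) (S : E →L[ℂ] E') (T : F →L[ℂ] F') :
    opTensor S (c • T) = c • opTensor S T :=
  clm_ext_tm fun x y => by simp [tm_smul_right]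

@[simp] lemma opTensor_zero_left (T : F →L[ℂ] F') : opTensor (0 : E →L[ℂ] E') T = 0 :=
  clm_ext_tm fun x y => by simp

@[simp] lemma opTensor_zero_right (S : E →L[ℂ] E') : opTensor S (0 : F →L[ℂ] F') = 0 :=
  clm_ext_tm fun x y => by simp

lemma opTensor_sub_left (S S' : E →L[ℂ] E') (T : F →L[ℂ] F') :
    opTensor (S - S') T = opTensor S T - opTensor S' T :=
  clm_ext_tm fun x y => by simp [tm_sub_left]

lemma opTensor_sub_right (S : E →L[ℂ] E') (T T' : F →L[ℂ] F') :
    opTensor S (T - T') = opTensor S T - opTensor S T' :=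
  clm_ext_tm fun x y => by simp [tm_sub_right]

lemma opTensor_sum_left {ι : Type*} (s : Finset ι) (S : ι → (E →L[ℂ] E')) (T : F →L[ℂ] F') :
    opTensor (∑ i ∈ s, S i) T = ∑ i ∈ s, opTensor (S i) T := by
  classical
  induction s using Finset.induction_on with
  | empty => simp
  | insert a s ha ih => simp [Finset.sum_insert ha, opTensor_add_left, ih]

lemma opTensor_sum_right {ι : Type*} (s : Finset ι) (S : E →L[ℂ] E') (T : ι → (F →L[ℂ] F')) :
    opTensor S (∑ i ∈ s, T i) = ∑ i ∈ s, opTensor S (T i) := by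
  classical
  induction s using Finset.induction_on with
  | empty => simp
  | insert a s ha ih => simp [Finset.sum_insert ha, opTensor_add_right, ih]

lemma norm_opTensor_le (S : E →L[ℂ] E') (T : F →L[ℂ] F') : ‖opTensor S T‖ ≤ ‖S‖ * ‖T‖ := by
  refine ContinuousLinearMap.opNorm_le_bound _ (by positivity) fun v => ?_
  refine denseRange_incl.induction_on (p := fun v => ‖opTensor S T v‖ ≤ ‖S‖ * ‖T‖ * ‖v‖) v ?_ ?_
  · exact isClosed_le (by fun_prop) (by fun_prop)
  · intro t
    rw [opTensor_incl, LinearIsometry.norm_map, LinearIsometry.norm_map]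
    exact (ContinuousLinearMap.le_opNorm _ _).trans
      (mul_le_mul_of_nonneg_right (TensorProduct.norm_mapL_le S T) (norm_nonneg _))

lemma continuous_opTensor_left (T : F →L[ℂ] F') :
    Continuous fun S : E →L[ℂ] E' => opTensor S T :=
  (LinearMap.mkContinuous (σ := RingHom.id ℂ)
    { toFun := fun S : E →L[ℂ] E' => opTensor S T
      map_add' := fun S S' => opTensor_add_left S S' T
      map_smul' := fun c S => opTensor_smul_left c S T } ‖T‖
    fun _ => (norm_opTensor_le _ _).trans_eq (mul_comm _ _)).continuous

lemma continuous_opTensor_right (S : E →L[ℂ] E') :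
    Continuous fun T : F →L[ℂ] F' => opTensor S T :=
  (LinearMap.mkContinuous (σ := RingHom.id ℂ)
    { toFun := fun T : F →L[ℂ] F' => opTensor S T
      map_add' := fun T T' => opTensor_add_right S T T'
      map_smul' := fun c T => opTensor_smul_right c S T } ‖S‖
    fun _ => norm_opTensor_le _ _).continuous

lemma star_opTensor [CompleteSpace E] [CompleteSpace F] (S : E →L[ℂ] E) (T : F →L[ℂ] F) :
    star (opTensor S T) = opTensor (star S) (star T) := by
  refine clm_ext_tm fun x y => eq_of_inner_tm fun x' y' => ?_
  rw [ContinuousLinearMap.star_eq_adjoint, ContinuousLinearMap.adjoint_inner_right]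
  simp [inner_tm, ContinuousLinearMap.star_eq_adjoint, ContinuousLinearMap.adjoint_inner_right]

/-! ### Creation operators -/

@[simp] lemma creation_apply (ξ : F) (x : E) : creation ξ x = tm x ξ := rfl

/-- The map `y ↦ ξ ⊗ y`. -/
def creationL (ξ : E) : F →L[ℂ] HilbertTensor E F :=
  (incl E F).toContinuousLinearMap ∘L (TensorProduct.mkL ℂ E F ξ)

@[simp] lemma creationL_apply (ξ : E) (y : F) : creationL ξ y = tm ξ y := rfl

lemma norm_creation_le (ξ : F) : ‖(creation ξ : E →L[ℂ] HilbertTensor E F)‖ ≤ ‖ξ‖ :=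
  ContinuousLinearMap.opNorm_le_bound _ (norm_nonneg _) fun x => by
    rw [creation_apply, norm_tm, mul_comm]

lemma norm_creationL_le (ξ : E) : ‖(creationL ξ : F →L[ℂ] HilbertTensor E F)‖ ≤ ‖ξ‖ :=
  ContinuousLinearMap.opNorm_le_bound _ (norm_nonneg _) fun x => by
    rw [creationL_apply, norm_tm]

@[simp] lemma adjoint_creation_tm [CompleteSpace E] (ξ : F) (x : E) (y : F) :
    (creation ξ : E →L[ℂ] HilbertTensor E F).adjoint (tm x y) = (inner ℂ ξ y : ℂ) • x := by
  refine ext_inner_left ℂ fun w => ?_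
  rw [ContinuousLinearMap.adjoint_inner_right]
  simp [inner_tm, inner_smul_right, mul_comm]

@[simp] lemma adjoint_creationL_tm [CompleteSpace F] (ξ : E) (x : E) (y : F) :
    (creationL ξ : F →L[ℂ] HilbertTensor E F).adjoint (tm x y) = (inner ℂ ξ x : ℂ) • y := by
  refine ext_inner_left ℂ fun w => ?_
  rw [ContinuousLinearMap.adjoint_inner_right]
  simp [inner_tm, inner_smul_right]

lemma opTensor_comp_creation (S : E →L[ℂ] E') (T : F →L[ℂ] F') (ξ : F) :
    opTensor S T ∘L creation ξ = creation (T ξ) ∘L S := by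
  ext x; simp

lemma adjoint_creation_comp_opTensor [CompleteSpace E] [CompleteSpace F] (S : E →L[ℂ] E)
    (T : F →L[ℂ] F) (ξ : F) :
    (creation ξ : E →L[ℂ] HilbertTensor E F).adjoint ∘L opTensor S T =
      S ∘L (creation (star T ξ)).adjoint :=
  clm_ext_tm fun x y => by
    simp [ContinuousLinearMap.star_eq_adjoint, ContinuousLinearMap.adjoint_inner_left]

lemma adjoint_creationL_comp_opTensor [CompleteSpace E] [CompleteSpace F] (S : E →L[ℂ] E)
    (T : F →L[ℂ] F) (ξ : E) :
    (creationL ξ : F →L[ℂ] HilbertTensor E F).adjoint ∘L opTensor S T =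
      T ∘L (creationL (star S ξ)).adjoint :=
  clm_ext_tm fun x y => by
    simp [ContinuousLinearMap.star_eq_adjoint, ContinuousLinearMap.adjoint_inner_left]

/-- Operators on `E ⊗ F` are determined by their compositions with the creation operators of a
total family of vectors of `F`. -/
lemma clm_ext_creation {ι : Type*} {e : ι → F}
    (he : (Submodule.span ℂ (Set.range e)).topologicalClosure = ⊤)
    {S T : HilbertTensor E F →L[ℂ] G} (h : ∀ i, S ∘L creation (e i) = T ∘L creation (e i)) :
    S = T := by
  refine clm_ext_tm fun x y => ?_
  have hy : y ∈ (Submodule.span ℂ (Set.range e)).topologicalClosure := he ▸ Submodule.mem_top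
  have hle : (Submodule.span ℂ (Set.range e)).topologicalClosure ≤
      LinearMap.eqLocus (S ∘L creationL x : F →L[ℂ] G).toLinearMap
        (T ∘L creationL x : F →L[ℂ] G).toLinearMap := by
    refine Submodule.topologicalClosure_minimal _ (Submodule.span_le.2 ?_) ?_
    · rintro _ ⟨i, rfl⟩
      simpa using congrArg (fun f => f x) (h i)
    · exact isClosed_eq (S ∘L creationL x).continuous (T ∘L creationL x).continuous
  simpa using hle hy

/-! ### Flip, associativity and leg numbering -/

@[simp] lemma flip_tm (x : E) (y : F) : flip E F (tm x y) = tm y x :=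
  UniformSpace.Completion.map_coe
    ((TensorProduct.commIsometry ℂ E F).toLinearIsometry.toContinuousLinearMap).uniformContinuous _

@[simp] lemma assoc_tm (x : E) (y : F) (z : G) :
    assoc E F G (tm (tm x y) z) = tm x (tm y z) :=
  LinearEquiv.extendOfIsometry_eq (TensorProduct.assoc ℂ E F G)
    (inclLeft E F G).toLinearMap (inclRight E F G).toLinearMap
    denseRange_inclLeft denseRange_inclRight _ ((x ⊗ₜ y) ⊗ₜ z)

@[simp] lemma assoc_symm_tm (x : E) (y : F) (z : G) :
    (assoc E F G).symm (tm x (tm y z)) = tm (tm x y) z := by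
  rw [← assoc_tm, LinearIsometryEquiv.symm_apply_apply]

lemma leg23_tm (X : HilbertTensor F G →L[ℂ] HilbertTensor F G) (x : E) (y : F) (z : G) :
    leg23 X (tm (tm x y) z) = (assoc E F G).symm (tm x (X (tm y z))) := by
  simp [leg23]

/-- A matrix coefficient of `X₂₃` on the third leg is `1 ⊗` the matrix coefficient of `X`. -/
lemma coeff_leg23 [CompleteSpace E] [CompleteSpace F]
    (X : HilbertTensor F G →L[ℂ] HilbertTensor F G) (ξ η : G) :
    (creation ξ : HilbertTensor E F →L[ℂ] _).adjoint ∘L leg23 X ∘L creation η =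
      opTensor 1 ((creation ξ : F →L[ℂ] _).adjoint ∘L X ∘L creation η) := by
  have key : ∀ (x : E) (v : HilbertTensor F G),
      (creation ξ : HilbertTensor E F →L[ℂ] _).adjoint ((assoc E F G).symm (tm x v)) =
        tm x ((creation ξ : F →L[ℂ] _).adjoint v) := by
    intro x v
    have : (creation ξ : HilbertTensor E F →L[ℂ] _).adjoint ∘L
        (assoc E F G).symm.toLinearIsometry.toContinuousLinearMap ∘L creationL x =
        creationL x ∘L (creation ξ : F →L[ℂ] _).adjoint :=
      clm_ext_tm fun y z => by simp
    simpa using congrArg (fun f => f v) this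
  refine clm_ext_tm fun x y => ?_
  simp [leg23_tm, key]

/-- A matrix coefficient of `X₁₃` on the third leg is the matrix coefficient of `X` tensored
with `1`. -/
lemma coeff_leg13 [CompleteSpace E] [CompleteSpace F]
    (X : HilbertTensor E G →L[ℂ] HilbertTensor E G) (ξ η : G) :
    (creation ξ : HilbertTensor E F →L[ℂ] _).adjoint ∘L leg13 X ∘L creation η =
      opTensor ((creation ξ : E →L[ℂ] _).adjoint ∘L X ∘L creation η) 1 := by
  have h1 : (creation ξ : HilbertTensor E F →L[ℂ] _).adjoint ∘L
      opTensor (flip F E) (ContinuousLinearMap.id ℂ G) =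
      flip F E ∘L (creation ξ : HilbertTensor F E →L[ℂ] _).adjoint :=
    clm_ext_tm fun x y => by simp
  have h2 : leg13 X ∘L (creation η : HilbertTensor E F →L[ℂ] _) =
      opTensor (flip F E) (ContinuousLinearMap.id ℂ G) ∘L
        leg23 X ∘L creation η ∘L flip E F := by
    ext v; simp [leg13]
  have h3 : (creation ξ : HilbertTensor E F →L[ℂ] _).adjoint ∘L leg13 X ∘L creation η =
      flip F E ∘L ((creation ξ : HilbertTensor F E →L[ℂ] _).adjoint ∘L leg23 X ∘L creation η)
        ∘L flip E F := by
    rw [h2]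
    ext v
    simpa using congrArg (fun f => f (leg23 X (creation η (flip E F v)))) h1
  rw [h3, coeff_leg23]
  exact clm_ext_tm fun x y => by simp

end TensorCalculus

/-! ### Sums of projections -/

section ProjSum

variable {E ι : Type*} [NormedAddCommGroup E] [InnerProductSpace ℂ E] [CompleteSpace E]
  (q : ι → (E →L[ℂ] E))

lemma star_projSum : star (projSum q) = projSum q := isSelfAdjoint_starProjection _

lemma projSum_mul_self (i : ι) : projSum q * q i = q i := by
  ext v
  exact Submodule.starProjection_eq_self_iff.2 (Submodule.le_topologicalClosure _
    (Submodule.mem_iSup_of_mem i ⟨v, rfl⟩))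

lemma projSum_mul_eq_zero {T : E →L[ℂ] E} (h : ∀ i, star (q i) * T = 0) : projSum q * T = 0 := by
  ext v
  refine (Submodule.starProjection_apply_eq_zero_iff _).2 ?_
  rw [Submodule.orthogonal_closure, Submodule.mem_orthogonal]
  intro u hu
  have : (⨆ i, LinearMap.range (q i).toLinearMap) ≤ (ℂ ∙ (T v))ᗮ := by
    refine iSup_le fun i => ?_
    rintro _ ⟨w, rfl⟩
    rw [Submodule.mem_orthogonal_singleton_iff_inner_right]
    change inner ℂ _ (q i w) = 0
    rw [← ContinuousLinearMap.adjoint_inner_left, ← ContinuousLinearMap.star_eq_adjoint,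
      ← mul_apply_eq_comp, h i]
    simp
  exact Submodule.mem_orthogonal_singleton_iff_inner_left.1 (this hu)

end ProjSum

/-! ### Strict topology and approximate units -/

section Strict

variable {E F : Type*}
  [NormedAddCommGroup E] [InnerProductSpace ℂ E] [NormedAddCommGroup F] [InnerProductSpace ℂ F]

lemma tendsto_strictNhds {ι : Type*} {l : Filter ι} {f : ι → (E →L[ℂ] E)}
    {C : Submodule ℂ (E →L[ℂ] E)} {T : E →L[ℂ] E} :
    Tendsto f l (strictNhds C T) ↔
      ∀ c ∈ C, Tendsto (fun i => f i * c) l (𝓝 (T * c)) ∧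
        Tendsto (fun i => c * f i) l (𝓝 (c * T)) := by
  simp only [strictNhds, tendsto_iInf, tendsto_inf, tendsto_comap_iff, Function.comp_def]

lemma tendsto_comap_strictNhds {V : Type*} (ι : V → (E →L[ℂ] E))
    (C : Submodule ℂ (E →L[ℂ] E)) (T : E →L[ℂ] E) :
    Tendsto ι (comap ι (strictNhds C T)) (strictNhds C T) := tendsto_comap

/-- A bounded net of left multiplications converging pointwise to the identity on a set does so
on its closure. -/
lemma tendsto_mul_left_of_mem_closure {R J : Type*} [NonUnitalNormedRing R] {l : Filter J}
    {u : J → R} (hu : ∀ j, ‖u j‖ ≤ 1) {s : Set R}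
    (hs : ∀ c ∈ s, Tendsto (fun j => u j * c) l (𝓝 c)) {c : R} (hc : c ∈ closure s) :
    Tendsto (fun j => u j * c) l (𝓝 c) := by
  rw [Metric.tendsto_nhds]
  intro ε hε
  obtain ⟨d, hd, hcd⟩ := Metric.mem_closure_iff.1 hc (ε / 3) (by positivity)
  filter_upwards [Metric.tendsto_nhds.1 (hs d hd) (ε / 3) (by positivity)] with j hj
  rw [dist_eq_norm] at *
  calc ‖u j * c - c‖ = ‖u j * (c - d) + (u j * d - d) + (d - c)‖ := by noncomm_ring
    _ ≤ ‖u j * (c - d)‖ + ‖u j * d - d‖ + ‖d - c‖ := norm_add₃_le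
    _ ≤ 1 * ‖c - d‖ + ‖u j * d - d‖ + ‖c - d‖ := by
      rw [norm_sub_rev d c]
      gcongr
      exact (norm_mul_le _ _).trans (mul_le_mul_of_nonneg_right (hu j) (norm_nonneg _))
    _ < ε := by linarith

lemma tendsto_mul_right_of_mem_closure {R J : Type*} [NonUnitalNormedRing R] {l : Filter J}
    {u : J → R} (hu : ∀ j, ‖u j‖ ≤ 1) {s : Set R}
    (hs : ∀ c ∈ s, Tendsto (fun j => c * u j) l (𝓝 c)) {c : R} (hc : c ∈ closure s) :
    Tendsto (fun j => c * u j) l (𝓝 c) := by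
  rw [Metric.tendsto_nhds]
  intro ε hε
  obtain ⟨d, hd, hcd⟩ := Metric.mem_closure_iff.1 hc (ε / 3) (by positivity)
  filter_upwards [Metric.tendsto_nhds.1 (hs d hd) (ε / 3) (by positivity)] with j hj
  rw [dist_eq_norm] at *
  calc ‖c * u j - c‖ = ‖(c - d) * u j + (d * u j - d) + (d - c)‖ := by noncomm_ring
    _ ≤ ‖(c - d) * u j‖ + ‖d * u j - d‖ + ‖d - c‖ := norm_add₃_le
    _ ≤ ‖c - d‖ * 1 + ‖d * u j - d‖ + ‖c - d‖ := by
      rw [norm_sub_rev d c]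
      gcongr
      exact (norm_mul_le _ _).trans (mul_le_mul_of_nonneg_left (hu j) (norm_nonneg _))
    _ < ε := by linarith

/-- A contractive approximate unit of `C`, indexed along a filter. -/
structure IsApproxUnit {J : Type*} (l : Filter J) (u : J → (E →L[ℂ] E))
    (C : Submodule ℂ (E →L[ℂ] E)) : Prop where
  norm_le : ∀ j, ‖u j‖ ≤ 1
  mem : ∀ j, u j ∈ C
  left : ∀ c ∈ C, Tendsto (fun j => u j * c) l (𝓝 c)
  right : ∀ c ∈ C, Tendsto (fun j => c * u j) l (𝓝 c)

/-- A norm dense subspace of `C` is strictly dense in `M(C)`, and the approximation can be done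
with bounded elements. In particular the filters that occur in the definition of strictly
continuous extensions are nontrivial. -/
lemma IsApproxUnit.frequently_comap {J V : Type*} {l : Filter J} [l.NeBot]
    {u : J → (E →L[ℂ] E)} {C : Submodule ℂ (E →L[ℂ] E)} (hu : IsApproxUnit l u C)
    (hC : ∀ c ∈ C, ∀ d ∈ C, c * d ∈ C) (ι : V → (E →L[ℂ] E))
    (hι : (C : Set (E →L[ℂ] E)) ⊆ closure (Set.range ι))
    {T : E →L[ℂ] E} (hT : T ∈ multipliers C) :
    ∃ᶠ t in comap ι (strictNhds C T), ‖ι t‖ ≤ ‖T‖ + 1 := by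
  have happ : ∀ q : J × ℕ, ∃ t : V, ‖ι t - u q.1 * T * u q.1‖ < 1 / ((q.2 : ℝ) + 1) := by
    intro q
    have hm : u q.1 * T * u q.1 ∈ C := by
      rw [mul_assoc]; exact hC _ (hu.mem _) _ (hT _ (hu.mem _)).1
    obtain ⟨_, ⟨t, rfl⟩, ht⟩ := Metric.mem_closure_iff.1 (hι hm) (1 / ((q.2 : ℝ) + 1))
      (by positivity)
    exact ⟨t, by rwa [← dist_eq_norm, dist_comm]⟩
  choose t ht using happ
  have h0 : Tendsto (fun q : J × ℕ => ι (t q) - u q.1 * T * u q.1) (l ×ˢ atTop) (𝓝 0) := by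
    refine squeeze_zero_norm (fun q => (ht q).le) ?_
    exact (tendsto_one_div_add_atTop_nhds_zero_nat (𝕜 := ℝ)).comp tendsto_snd
  have hbound : ∀ q : J × ℕ, ‖u q.1 * T * u q.1‖ ≤ ‖T‖ := fun q => by
    calc ‖u q.1 * T * u q.1‖ ≤ ‖u q.1‖ * ‖T‖ * ‖u q.1‖ := norm_mul₃_le
      _ ≤ 1 * ‖T‖ * 1 := by gcongr <;> exact hu.norm_le _
      _ = ‖T‖ := by ring
  have hlim : Tendsto (fun q : J × ℕ => ι (t q)) (l ×ˢ atTop) (strictNhds C T) := by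
    rw [tendsto_strictNhds]
    intro c hc
    have hT1 : Tendsto (fun j => u j * T * u j * c) l (𝓝 (T * c)) := by
      have h1 : Tendsto (fun j => u j * (T * c)) l (𝓝 (T * c)) := hu.left _ (hT c hc).1
      have h2 : Tendsto (fun j => u j * T * (u j * c - c)) l (𝓝 0) := by
        refine squeeze_zero_norm (a := fun j => ‖T‖ * ‖u j * c - c‖) (fun j => ?_) ?_
        · calc ‖u j * T * (u j * c - c)‖ ≤ ‖u j‖ * ‖T‖ * ‖u j * c - c‖ := norm_mul₃_le
            _ ≤ 1 * ‖T‖ * ‖u j * c - c‖ := by gcongr; exact hu.norm_le _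
            _ = _ := by ring
        · have := (tendsto_iff_norm_sub_tendsto_zero.1 (hu.left c hc)).const_mul ‖T‖
          simpa using this
      have h3 := h1.add h2
      rw [add_zero] at h3
      refine h3.congr fun j => ?_
      rw [mul_sub, ← mul_assoc, ← mul_assoc]; abel
    have hT2 : Tendsto (fun j => c * (u j * T * u j)) l (𝓝 (c * T)) := by
      have h1 : Tendsto (fun j => (c * T) * u j) l (𝓝 (c * T)) := hu.right _ (hT c hc).2
      have h2 : Tendsto (fun j => (c * u j - c) * T * u j) l (𝓝 0) := by
        refine squeeze_zero_norm (a := fun j => ‖c * u j - c‖ * ‖T‖) (fun j => ?_) ?_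
        · calc ‖(c * u j - c) * T * u j‖ ≤ ‖c * u j - c‖ * ‖T‖ * ‖u j‖ := norm_mul₃_le
            _ ≤ ‖c * u j - c‖ * ‖T‖ * 1 := by gcongr; exact hu.norm_le _
            _ = _ := by ring
        · have := (tendsto_iff_norm_sub_tendsto_zero.1 (hu.right c hc)).mul_const ‖T‖
          simpa using this
      have h3 := h1.add h2
      rw [add_zero] at h3
      refine h3.congr fun j => ?_
      simp only [sub_mul, mul_assoc]; abel
    constructor
    · have h3 := (h0.mul_const c).add (hT1.comp tendsto_fst)
      rw [zero_mul, zero_add] at h3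
      refine h3.congr fun q => ?_
      simp only [Function.comp_apply, sub_mul, sub_add_cancel]
    · have h3 := (h0.const_mul c).add (hT2.comp tendsto_fst)
      rw [mul_zero, zero_add] at h3
      refine h3.congr fun q => ?_
      simp only [Function.comp_apply, mul_sub, sub_add_cancel]
  refine (tendsto_comap_iff.2 hlim : Tendsto t _ (comap ι _)).frequently
    (Eventually.frequently (Eventually.of_forall fun q => ?_))
  have h1 : 1 / ((q.2 : ℝ) + 1) ≤ 1 := by
    rw [div_le_one (by positivity)]; linarith [(Nat.cast_nonneg q.2 : (0 : ℝ) ≤ q.2)]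
  calc ‖ι (t q)‖ = ‖(u q.1 * T * u q.1) + (ι (t q) - u q.1 * T * u q.1)‖ := by congr 1; abel
    _ ≤ ‖T‖ + 1 := (norm_add_le _ _).trans (add_le_add (hbound q) ((ht q).le.trans h1))

/-! ### The spatial tensor product -/

variable {V W : Type*} [AddCommGroup V] [Module ℂ V] [AddCommGroup W] [Module ℂ W]
  (α : V →ₗ[ℂ] (E →L[ℂ] E)) (β : W →ₗ[ℂ] (F →L[ℂ] F))

@[simp] lemma algTensor_tmul (v : V) (w : W) :
    algTensor α β (v ⊗ₜ w) = opTensor (α v) (β w) := rfl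

lemma opTensor_mem_minTensor (v : V) (w : W) : opTensor (α v) (β w) ∈ minTensor α β :=
  Submodule.le_topologicalClosure _ ⟨v ⊗ₜ w, rfl⟩

lemma isClosed_minTensor :
    IsClosed (minTensor α β : Set (HilbertTensor E F →L[ℂ] HilbertTensor E F)) :=
  Submodule.isClosed_topologicalClosure _

lemma minTensor_subset_closure_range :
    (minTensor α β : Set (HilbertTensor E F →L[ℂ] HilbertTensor E F)) ⊆
      closure (Set.range (algTensor α β)) := by
  intro c hc
  rwa [minTensor, Submodule.topologicalClosure_coe, LinearMap.coe_range] at hc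

variable {α β}

/-- A bounded linear map sends the spatial tensor product to a closed subspace as soon as it does
so for elementary tensors. -/
lemma map_mem_of_mem_minTensor {Z : Type*} [NormedAddCommGroup Z] [NormedSpace ℂ Z]
    (L : (HilbertTensor E F →L[ℂ] HilbertTensor E F) →L[ℂ] Z) {N : Submodule ℂ Z}
    (hN : IsClosed (N : Set Z)) (h : ∀ v w, L (opTensor (α v) (β w)) ∈ N)
    {c : HilbertTensor E F →L[ℂ] HilbertTensor E F} (hc : c ∈ minTensor α β) : L c ∈ N := by
  have : minTensor α β ≤ N.comap L.toLinearMap := by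
    refine Submodule.topologicalClosure_minimal _ ?_ (hN.preimage L.continuous)
    rintro _ ⟨t, rfl⟩
    induction t with
    | zero => simp
    | add x y hx hy => rw [map_add]; exact add_mem hx hy
    | tmul v w => exact h v w
  exact this hc

lemma tendsto_mul_left_minTensor {J : Type*} {l : Filter J} {e : J → (E →L[ℂ] E)}
    {f : J → (F →L[ℂ] F)} (he : ∀ j, ‖e j‖ ≤ 1) (hf : ∀ j, ‖f j‖ ≤ 1)
    (hα : ∀ v, Tendsto (fun j => e j * α v) l (𝓝 (α v)))
    (hβ : ∀ w, Tendsto (fun j => f j * β w) l (𝓝 (β w)))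
    {c : HilbertTensor E F →L[ℂ] HilbertTensor E F} (hc : c ∈ minTensor α β) :
    Tendsto (fun j => opTensor (e j) (f j) * c) l (𝓝 c) := by
  refine tendsto_mul_left_of_mem_closure (s := Set.range (algTensor α β)) (fun j => ?_) ?_
    (minTensor_subset_closure_range α β hc)
  · exact (norm_opTensor_le _ _).trans (mul_le_one₀ (he j) (norm_nonneg _) (hf j))
  · rintro _ ⟨t, rfl⟩
    induction t with
    | zero => simpa using tendsto_const_nhds
    | add x y hx hy => simpa [mul_add] using hx.add hy
    | tmul v w =>
      simp only [algTensor_tmul, opTensor_mul]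
      rw [tendsto_iff_norm_sub_tendsto_zero]
      have h1 := tendsto_iff_norm_sub_tendsto_zero.1 (hα v)
      have h2 := tendsto_iff_norm_sub_tendsto_zero.1 (hβ w)
      refine squeeze_zero (fun _ => norm_nonneg _) (fun j => ?_)
        (by simpa using (h1.mul_const ‖β w‖).add (h2.const_mul ‖α v‖))
      have : opTensor (e j * α v) (f j * β w) - opTensor (α v) (β w) =
          opTensor (e j * α v - α v) (f j * β w) + opTensor (α v) (f j * β w - β w) := by
        simp [opTensor_sub_left, opTensor_sub_right]
      rw [this]
      refine (norm_add_le _ _).trans (add_le_add ((norm_opTensor_le _ _).trans ?_)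
        (norm_opTensor_le _ _))
      gcongr
      exact (norm_mul_le _ _).trans (by
        simpa using mul_le_mul_of_nonneg_right (hf j) (norm_nonneg (β w)))

lemma tendsto_mul_right_minTensor {J : Type*} {l : Filter J} {e : J → (E →L[ℂ] E)}
    {f : J → (F →L[ℂ] F)} (he : ∀ j, ‖e j‖ ≤ 1) (hf : ∀ j, ‖f j‖ ≤ 1)
    (hα : ∀ v, Tendsto (fun j => α v * e j) l (𝓝 (α v)))
    (hβ : ∀ w, Tendsto (fun j => β w * f j) l (𝓝 (β w)))
    {c : HilbertTensor E F →L[ℂ] HilbertTensor E F} (hc : c ∈ minTensor α β) :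
    Tendsto (fun j => c * opTensor (e j) (f j)) l (𝓝 c) := by
  refine tendsto_mul_right_of_mem_closure (s := Set.range (algTensor α β)) (fun j => ?_) ?_
    (minTensor_subset_closure_range α β hc)
  · exact (norm_opTensor_le _ _).trans (mul_le_one₀ (he j) (norm_nonneg _) (hf j))
  · rintro _ ⟨t, rfl⟩
    induction t with
    | zero => simpa using tendsto_const_nhds
    | add x y hx hy => simpa [add_mul] using hx.add hy
    | tmul v w =>
      simp only [algTensor_tmul, opTensor_mul]
      rw [tendsto_iff_norm_sub_tendsto_zero]
      have h1 := tendsto_iff_norm_sub_tendsto_zero.1 (hα v)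
      have h2 := tendsto_iff_norm_sub_tendsto_zero.1 (hβ w)
      refine squeeze_zero (fun _ => norm_nonneg _) (fun j => ?_)
        (by simpa using (h1.mul_const ‖β w‖).add (h2.const_mul ‖α v‖))
      have : opTensor (α v * e j) (β w * f j) - opTensor (α v) (β w) =
          opTensor (α v * e j - α v) (β w * f j) + opTensor (α v) (β w * f j - β w) := by
        simp [opTensor_sub_left, opTensor_sub_right]
      rw [this]
      refine (norm_add_le _ _).trans (add_le_add ((norm_opTensor_le _ _).trans ?_)
        (norm_opTensor_le _ _))
      gcongr
      exact (norm_mul_le _ _).trans (by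
        simpa using mul_le_mul_of_nonneg_left (hf j) (norm_nonneg (β w)))

/-- If `α(V)` and `β(W)` are closed under products, so is their spatial tensor product. -/
lemma mul_mem_minTensor (hα : ∀ v v', ∃ v'', α v'' = α v * α v')
    (hβ : ∀ w w', ∃ w'', β w'' = β w * β w') :
    ∀ c ∈ minTensor α β, ∀ d ∈ minTensor α β, c * d ∈ minTensor α β := by
  intro c hc d hd
  refine map_mem_of_mem_minTensor ((ContinuousLinearMap.mul ℂ _).flip d)
    (isClosed_minTensor α β) (fun v w => ?_) hc
  refine map_mem_of_mem_minTensor ((ContinuousLinearMap.mul ℂ _) (opTensor (α v) (β w)))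
    (isClosed_minTensor α β) (fun v' w' => ?_) hd
  obtain ⟨v'', hv⟩ := hα v v'
  obtain ⟨w'', hw⟩ := hβ w w'
  simp only [ContinuousLinearMap.mul_apply', opTensor_mul, ← hv, ← hw]
  exact opTensor_mem_minTensor α β _ _

end Strict

/-! ### Compact operators -/

section Compact

variable {H : Type*} [NormedAddCommGroup H] [InnerProductSpace ℂ H]

/-- A contractive net that converges strongly to `1` converges to `1` uniformly on relatively
compact sets, hence is a left approximate unit for the compact operators. -/
lemma tendsto_mul_compact {J : Type*} {l : Filter J} {q : J → (H →L[ℂ] H)}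
    (hq : ∀ j, ‖q j‖ ≤ 1) (hlim : ∀ x, Tendsto (fun j => q j x) l (𝓝 x))
    {b : H →L[ℂ] H} (hb : IsCompactOperator b) : Tendsto (fun j => q j * b) l (𝓝 b) := by
  rw [Metric.tendsto_nhds]
  intro ε hε
  have hcomp := hb.isCompact_closure_image_closedBall 1
  obtain ⟨s, -, hs, hcov⟩ := (hcomp.totallyBounded).exists_subset (Metric.dist_mem_uniformity
    (show (0 : ℝ) < ε / 4 by positivity))
  have hev : ∀ᶠ j in l, ∀ y ∈ s, dist (q j y) y < ε / 4 :=
    (eventually_all_finite hs).2 fun y _ => Metric.tendsto_nhds.1 (hlim y) _ (by positivity)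
  filter_upwards [hev] with j hj
  rw [dist_eq_norm]
  refine lt_of_le_of_lt (b := 3 * ε / 4) ?_ (by linarith)
  refine ContinuousLinearMap.opNorm_le_of_unit_norm (by positivity) fun x hx => ?_
  have hx' : b x ∈ closure (b '' Metric.closedBall 0 1) :=
    subset_closure ⟨x, by simp [hx], rfl⟩
  obtain ⟨y, hy, hxy⟩ := Set.mem_iUnion₂.1 (hcov hx')
  have hxy : ‖b x - y‖ < ε / 4 := by simpa [dist_eq_norm] using hxy
  have hjy : ‖q j y - y‖ < ε / 4 := by simpa [dist_eq_norm] using hj y hy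
  calc ‖(q j * b - b) x‖ = ‖q j (b x - y) + (q j y - y) + (y - b x)‖ := by
        congr 1; simp only [map_sub, sub_apply,
          mul_apply_eq_comp]; abel
    _ ≤ ‖q j (b x - y)‖ + ‖q j y - y‖ + ‖y - b x‖ := norm_add₃_le
    _ ≤ 1 * ‖b x - y‖ + ‖q j y - y‖ + ‖b x - y‖ := by
        rw [norm_sub_rev y]
        gcongr
        exact (q j).le_of_opNorm_le (hq j) _
    _ ≤ 3 * ε / 4 := by linarith

/-- By the C*-identity `‖b (1 - q)‖² ≤ ‖(1 - q) b* b‖`, the right-handed statement follows from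
the left-handed one. -/
lemma tendsto_compact_mul [CompleteSpace H] {J : Type*} {l : Filter J} {q : J → (H →L[ℂ] H)}
    (hq : ∀ j, IsStarProjection (q j)) (hlim : ∀ x, Tendsto (fun j => q j x) l (𝓝 x))
    {b : H →L[ℂ] H} (hb : IsCompactOperator b) : Tendsto (fun j => b * q j) l (𝓝 b) := by
  have hbb : IsCompactOperator (star b * b : H →L[ℂ] H) := hb.clm_comp (star b)
  have h1 := tendsto_iff_norm_sub_tendsto_zero.1
    (tendsto_mul_compact (fun j => (hq j).norm_le) hlim hbb)
  rw [tendsto_iff_norm_sub_tendsto_zero]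
  have h2 : Tendsto (fun j => Real.sqrt ‖q j * (star b * b) - star b * b‖) l (𝓝 0) := by
    simpa using h1.sqrt
  refine squeeze_zero (fun _ => norm_nonneg _) (fun j => Real.le_sqrt_of_sq_le ?_) h2
  have hp : ‖(1 - q j : H →L[ℂ] H)‖ ≤ 1 := (hq j).one_sub.norm_le
  have hs : star (q j) = q j := (hq j).isSelfAdjoint
  calc ‖b * q j - b‖ ^ 2 = ‖star (b * q j - b) * (b * q j - b)‖ := by
        rw [CStarRing.norm_star_mul_self, sq]
    _ = ‖(q j * (star b * b) - star b * b) * (1 - q j)‖ * 1 := by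
        rw [mul_one, ← norm_neg]; congr 1
        simp only [star_sub, star_mul, hs]; noncomm_ring
    _ ≤ ‖q j * (star b * b) - star b * b‖ * 1 := by
        rw [mul_one, mul_one]
        exact (norm_mul_le _ _).trans (mul_le_of_le_one_right (norm_nonneg _) hp)
    _ = _ := mul_one _

end Compact

/-! ### The representation of the algebra -/

section Rep

variable {A K E : Type*} [NonUnitalCStarAlgebra A] [NormedAddCommGroup K] [InnerProductSpace ℂ K]
  [CompleteSpace K] [NormedAddCommGroup E] [InnerProductSpace ℂ E] (π : FaithfulRep A K)

@[simp] lemma FaithfulRep.lin_apply (a : A) : π.lin a = π.toHom a := rfl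

lemma FaithfulRep.norm_map (a : A) : ‖π.toHom a‖ = ‖a‖ :=
  NonUnitalStarAlgHom.norm_map π.toHom π.injective a

lemma FaithfulRep.continuous : Continuous π.toHom :=
  (NonUnitalStarAlgHom.isometry π.toHom π.injective).continuous

lemma FaithfulRep.isClosed_image : IsClosed (π.image : Set (K →L[ℂ] K)) := by
  have : (π.image : Set (K →L[ℂ] K)) = Set.range π.toHom := by
    ext; simp [FaithfulRep.image]
  rw [this]
  exact (NonUnitalStarAlgHom.isometry π.toHom π.injective).isClosedEmbedding.isClosed_range

lemma FaithfulRep.mem_image (a : A) : π.toHom a ∈ π.image := ⟨a, rfl⟩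

lemma FaithfulRep.tensor_mem (a b : A) : opTensor (π.toHom a) (π.toHom b) ∈ π.tensor2 :=
  opTensor_mem_minTensor π.lin π.lin a b

lemma FaithfulRep.isClosed_tensor2 :
    IsClosed (π.tensor2 : Set (HilbertTensor K K →L[ℂ] HilbertTensor K K)) :=
  isClosed_minTensor _ _

lemma FaithfulRep.exists_mul (a b : A) : ∃ c, π.lin c = π.lin a * π.lin b :=
  ⟨a * b, by simp⟩

lemma FaithfulRep.mul_mem_tensor2 : ∀ c ∈ π.tensor2, ∀ d ∈ π.tensor2, c * d ∈ π.tensor2 :=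
  mul_mem_minTensor π.exists_mul π.exists_mul

variable {π}

lemma FaithfulRep.clm_ext {S T : K →L[ℂ] E} (h : ∀ a, S ∘L π.toHom a = T ∘L π.toHom a) :
    S = T := by
  ext x
  have hx : x ∈ (Submodule.span ℂ {y : K | ∃ (a : A) (x : K), π.toHom a x = y}).topologicalClosure :=
    π.nondegenerate ▸ Submodule.mem_top
  have hle : (Submodule.span ℂ {y : K | ∃ (a : A) (x : K), π.toHom a x = y}).topologicalClosure ≤
      LinearMap.eqLocus S.toLinearMap T.toLinearMap := by
    refine Submodule.topologicalClosure_minimal _ (Submodule.span_le.2 ?_)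
      (isClosed_eq S.continuous T.continuous)
    rintro _ ⟨a, x, rfl⟩
    simpa using congrArg (fun f => f x) (h a)
  exact hle hx

/-- As `A` acts nondegenerately, operators on `K ⊗ K` are determined by their products with
`A ⊗ A`. -/
lemma FaithfulRep.clm_ext_tensor {S T : HilbertTensor K K →L[ℂ] E}
    (h : ∀ a b, S ∘L opTensor (π.toHom a) (π.toHom b) = T ∘L opTensor (π.toHom a) (π.toHom b)) :
    S = T := by
  refine clm_ext_tm fun x y => ?_
  have h2 : S ∘L creationL x = T ∘L creationL x := by
    refine FaithfulRep.clm_ext (π := π) fun b => ?_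
    ext y
    have h1 : ∀ b, S ∘L creation (π.toHom b y) = T ∘L creation (π.toHom b y) := fun b => by
      refine FaithfulRep.clm_ext (π := π) fun a => ?_
      ext x
      simpa using congrArg (fun f => f (tm x y)) (h a b)
    simpa using congrArg (fun f => f x) (h1 b)
  simpa using congrArg (fun f => f y) h2

end Rep

/-! ### The unit projections -/

namespace PartialCompactQuantumSemigroup

variable {I A K : Type*} [NonUnitalCStarAlgebra A] [NormedAddCommGroup K] [InnerProductSpace ℂ K]
  [CompleteSpace K] {π : FaithfulRep A K} (G : PartialCompactQuantumSemigroup I π)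

@[simp] lemma unit_mul_self (k l : I) : G.unit k l * G.unit k l = G.unit k l :=
  (G.isStarProjection_unit k l).isIdempotentElem

@[simp] lemma star_unit (k l : I) : star (G.unit k l) = G.unit k l :=
  (G.isStarProjection_unit k l).isSelfAdjoint

@[simp] lemma unitOp_mul_self (k l : I) : G.unitOp k l * G.unitOp k l = G.unitOp k l := by
  simp [unitOp, ← map_mul]

@[simp] lemma star_unitOp (k l : I) : star (G.unitOp k l) = G.unitOp k l := by
  simp [unitOp, ← map_star]

lemma unitOp_mul_of_ne {k l m n : I} (h : (k, l) ≠ (m, n)) : G.unitOp k l * G.unitOp m n = 0 := by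
  simp [unitOp, ← map_mul, G.orthogonal_unit k l m n h]

/-- The sum of finitely many of the projections `1(k,l)`. -/
def part (J : Finset (I × I)) : A := ∑ q ∈ J, G.unit q.1 q.2

lemma isStarProjection_part (J : Finset (I × I)) : IsStarProjection (G.part J) := by
  classical
  refine ⟨?_, ?_⟩
  · rw [IsIdempotentElem, part, Finset.sum_mul_sum]
    refine Finset.sum_congr rfl fun q hq => ?_
    rw [Finset.sum_eq_single_of_mem q hq]
    · simp
    · intro q' _ hne
      exact G.orthogonal_unit _ _ _ _ (by simpa using hne.symm)
  · simp [IsSelfAdjoint, part, star_sum]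

@[simp] lemma star_part (J : Finset (I × I)) : star (G.part J) = G.part J :=
  (G.isStarProjection_part J).isSelfAdjoint

lemma norm_part_le (J : Finset (I × I)) : ‖G.part J‖ ≤ 1 := by
  rw [← π.norm_map]
  exact ((G.isStarProjection_part J).map π.toHom).norm_le

lemma norm_map_part_le (J : Finset (I × I)) : ‖π.toHom (G.part J)‖ ≤ 1 :=
  (π.norm_map _).trans_le (G.norm_part_le J)

lemma map_part (J : Finset (I × I)) : π.toHom (G.part J) = ∑ q ∈ J, G.unitOp q.1 q.2 := by
  simp [part, unitOp]

lemma tendsto_part_op_mul (a : A) :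
    Tendsto (fun J => π.toHom (G.part J) * π.toHom a) atTop (𝓝 (π.toHom a)) := by
  have := ((tendsto_strictNhds.1 G.sum_unit) _ (π.mem_image a)).1
  simpa [part] using this

lemma tendsto_mul_part_op (a : A) :
    Tendsto (fun J => π.toHom a * π.toHom (G.part J)) atTop (𝓝 (π.toHom a)) := by
  have := ((tendsto_strictNhds.1 G.sum_unit) _ (π.mem_image a)).2
  simpa [part] using this

lemma tendsto_part_mul (a : A) : Tendsto (fun J => G.part J * a) atTop (𝓝 a) := by
  rw [(NonUnitalStarAlgHom.isometry π.toHom π.injective).isEmbedding.tendsto_nhds_iff]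
  simpa [Function.comp_def] using G.tendsto_part_op_mul a

/-- The projections `1(k,l)` add up to `1` in the strong operator topology. -/
lemma tendsto_part_apply (x : K) :
    Tendsto (fun J => π.toHom (G.part J) x) atTop (𝓝 x) := by
  have hx : x ∈ closure ((Submodule.span ℂ {y : K | ∃ (a : A) (x : K), π.toHom a x = y} :
      Submodule ℂ K) : Set K) := by
    rw [← Submodule.topologicalClosure_coe, π.nondegenerate]; trivial
  have hspan : ∀ y ∈ Submodule.span ℂ {y : K | ∃ (a : A) (x : K), π.toHom a x = y},
      Tendsto (fun J => π.toHom (G.part J) y) atTop (𝓝 y) := by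
    intro y hy
    induction hy using Submodule.span_induction with
    | mem y h =>
      obtain ⟨a, x, rfl⟩ := h
      have := (G.tendsto_part_op_mul a)
      exact ((ContinuousLinearMap.apply ℂ K x).continuous.tendsto _).comp this
    | zero => simp
    | add y z _ _ hy hz => simpa using hy.add hz
    | smul c y _ hy => simpa using hy.const_smul c
  rw [Metric.tendsto_nhds]
  intro ε hε
  obtain ⟨y, hy, hxy⟩ := Metric.mem_closure_iff.1 hx (ε / 3) (by positivity)
  filter_upwards [Metric.tendsto_nhds.1 (hspan y hy) (ε / 3) (by positivity)] with J hJ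
  rw [dist_eq_norm] at *
  calc ‖π.toHom (G.part J) x - x‖
      = ‖π.toHom (G.part J) (x - y) + (π.toHom (G.part J) y - y) + (y - x)‖ := by
        rw [map_sub]; congr 1; abel
    _ ≤ ‖π.toHom (G.part J) (x - y)‖ + ‖π.toHom (G.part J) y - y‖ + ‖y - x‖ := norm_add₃_le
    _ ≤ 1 * ‖x - y‖ + ‖π.toHom (G.part J) y - y‖ + ‖x - y‖ := by
        rw [norm_sub_rev y]
        gcongr
        exact (π.toHom (G.part J)).le_of_opNorm_le (G.norm_map_part_le J) _
    _ < ε := by linarith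

lemma isApproxUnit_tensor2 :
    IsApproxUnit atTop (fun J => opTensor (π.toHom (G.part J)) (π.toHom (G.part J)))
      π.tensor2 where
  norm_le J := (norm_opTensor_le _ _).trans
    (mul_le_one₀ (G.norm_map_part_le J) (norm_nonneg _) (G.norm_map_part_le J))
  mem _ := π.tensor_mem _ _
  left _ hc := tendsto_mul_left_minTensor G.norm_map_part_le G.norm_map_part_le
    G.tendsto_part_op_mul G.tendsto_part_op_mul hc
  right _ hc := tendsto_mul_right_minTensor G.norm_map_part_le G.norm_map_part_le
    G.tendsto_mul_part_op G.tendsto_mul_part_op hc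

/-- Norm bounds can be checked after cutting by finite sums of the projections `1(k,l)`. -/
lemma norm_le_of_forall_mul_le {y : K →L[ℂ] K} {ε : ℝ}
    (h : ∀ J, ‖π.toHom (G.part J) * y‖ ≤ ε) : ‖y‖ ≤ ε := by
  have hε : 0 ≤ ε := (norm_nonneg _).trans (h ∅)
  refine ContinuousLinearMap.opNorm_le_bound _ hε fun x => ?_
  refine le_of_tendsto (G.tendsto_part_apply (y x)).norm (Eventually.of_forall fun J => ?_)
  exact (π.toHom (G.part J) * y).le_of_opNorm_le (h J) x

/-! ### The comultiplication and the unit projections -/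

lemma norm_comul_le (a : A) : ‖G.comul a‖ ≤ ‖a‖ := NonUnitalStarAlgHom.norm_apply_le G.comul a

lemma continuous_comul : Continuous G.comul :=
  AddMonoidHomClass.continuous_of_bound G.comul 1 fun a => by simpa using G.norm_comul_le a

/-- If `T` equals the product of `R` with all partial sums of `Δ(1(k,l))` from the index `m₀` on,
then `T = R Δ(1(k,l))`. -/
lemma mul_comul_unit_eq {R T : HilbertTensor K K →L[ℂ] HilbertTensor K K} (k l m₀ : I)
    (h : ∀ J : Finset I, m₀ ∈ J →
      R * ∑ m ∈ J, opTensor (G.unitOp k m) (G.unitOp m l) = T) :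
    R * G.comul (G.unit k l) = T := by
  refine FaithfulRep.clm_ext_tensor (π := π) fun a b => ?_
  have h1 := ((tendsto_strictNhds.1 (G.comul_unit k l)) _ (π.tensor_mem a b)).1
  have h2 := h1.const_mul R
  refine tendsto_nhds_unique h2 ?_
  refine tendsto_const_nhds.congr' ?_
  filter_upwards [eventually_ge_atTop {m₀}] with J hJ
  rw [← mul_assoc]
  exact (congrArg (· * opTensor (π.toHom a) (π.toHom b)) (h J (by simpa using hJ))).symm

/-- Cutting the first leg of `Δ(1(k,l))` by `1(k,r)` gives `1(k,r) ⊗ 1(r,l)`. -/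
lemma leftCut_comul_unit (k r l : I) :
    opTensor (G.unitOp k r) 1 * G.comul (G.unit k l) = opTensor (G.unitOp k r) (G.unitOp r l) := by
  refine G.mul_comul_unit_eq k l r fun J hJ => ?_
  rw [Finset.mul_sum, Finset.sum_eq_single_of_mem r hJ]
  · simp [opTensor_mul]
  · intro m _ hm
    rw [opTensor_mul, G.unitOp_mul_of_ne (by simpa using hm.symm), opTensor_zero_left]

lemma leftCut_comul_unit_of_ne {k k' : I} (h : k ≠ k') (r l : I) :
    opTensor (G.unitOp k r) 1 * G.comul (G.unit k' l) = 0 := by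
  refine G.mul_comul_unit_eq k' l r fun J hJ => ?_
  rw [Finset.mul_sum, Finset.sum_eq_zero]
  intro m _
  rw [opTensor_mul, G.unitOp_mul_of_ne (by simp [h]), opTensor_zero_left]

/-- Cutting the second leg of `Δ(1(k,l))` by `1(r,l)` gives `1(k,r) ⊗ 1(r,l)`. -/
lemma rightCut_comul_unit (k r l : I) :
    opTensor 1 (G.unitOp r l) * G.comul (G.unit k l) = opTensor (G.unitOp k r) (G.unitOp r l) := by
  refine G.mul_comul_unit_eq k l r fun J hJ => ?_
  rw [Finset.mul_sum, Finset.sum_eq_single_of_mem r hJ]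
  · simp [opTensor_mul]
  · intro m _ hm
    rw [opTensor_mul, G.unitOp_mul_of_ne (by simpa using hm.symm), opTensor_zero_right]

lemma rightCut_comul_unit_of_ne {l l' : I} (h : l ≠ l') (r k : I) :
    opTensor 1 (G.unitOp r l) * G.comul (G.unit k l') = 0 := by
  refine G.mul_comul_unit_eq k l' r fun J hJ => ?_
  rw [Finset.mul_sum, Finset.sum_eq_zero]
  intro m _
  rw [opTensor_mul, G.unitOp_mul_of_ne (by simp [h]), opTensor_zero_right]

lemma tensor_comul_unit (k r l : I) :
    opTensor (G.unitOp k r) (G.unitOp r l) * G.comul (G.unit k l) =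
      opTensor (G.unitOp k r) (G.unitOp r l) := by
  have : opTensor (G.unitOp k r) (G.unitOp r l) =
      opTensor 1 (G.unitOp r l) * opTensor (G.unitOp k r) 1 := by simp [opTensor_mul]
  rw [this, mul_assoc, leftCut_comul_unit]
  simp [opTensor_mul]

/-! ### The projection `Δ(1)` -/

lemma comulOne_mul_tensor (k m l : I) :
    G.comulOne * opTensor (G.unitOp k m) (G.unitOp m l) =
      opTensor (G.unitOp k m) (G.unitOp m l) :=
  projSum_mul_self (fun i : I × I × I => opTensor (G.unitOp i.1 i.2.2) (G.unitOp i.2.2 i.2.1))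
    (k, l, m)

lemma star_comulOne : star G.comulOne = G.comulOne := star_projSum _

lemma tensor_mul_comulOne (k m l : I) :
    opTensor (G.unitOp k m) (G.unitOp m l) * G.comulOne =
      opTensor (G.unitOp k m) (G.unitOp m l) := by
  simpa [star_mul, star_opTensor, star_comulOne] using congrArg star (G.comulOne_mul_tensor k m l)

lemma comulOne_mul_tensor_of_ne (k l : I) {m m' : I} (h : m ≠ m') :
    G.comulOne * opTensor (G.unitOp k m) (G.unitOp m' l) = 0 := by
  refine projSum_mul_eq_zero _ fun i => ?_
  rw [star_opTensor, star_unitOp, star_unitOp, opTensor_mul]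
  by_cases hk : (i.1, i.2.2) = (k, m)
  · rw [G.unitOp_mul_of_ne (m := m') fun h' =>
      h ((congrArg Prod.snd hk).symm.trans (congrArg Prod.fst h')), opTensor_zero_right]
  · rw [G.unitOp_mul_of_ne hk, opTensor_zero_left]

lemma tensor_mul_comulOne_of_ne (k l : I) {m m' : I} (h : m ≠ m') :
    opTensor (G.unitOp k m) (G.unitOp m' l) * G.comulOne = 0 := by
  simpa [star_mul, star_opTensor, star_comulOne] using
    congrArg star (G.comulOne_mul_tensor_of_ne k l h)

lemma comulOne_mul_comul_unit (k l : I) :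
    G.comulOne * G.comul (G.unit k l) = G.comul (G.unit k l) := by
  refine FaithfulRep.clm_ext_tensor (π := π) fun a b => ?_
  have h1 := ((tendsto_strictNhds.1 (G.comul_unit k l)) _ (π.tensor_mem a b)).1
  have h2 := h1.const_mul G.comulOne
  refine tendsto_nhds_unique h2 (h1.congr fun J => ?_)
  rw [← mul_assoc, Finset.mul_sum]
  exact congrArg (· * _) (Finset.sum_congr rfl fun m _ => (G.comulOne_mul_tensor k m l).symm)

lemma comulOne_mul_comul (a : A) : G.comulOne * G.comul a = G.comul a := by
  have h1 := (G.continuous_comul.tendsto a).comp (G.tendsto_part_mul a)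
  refine tendsto_nhds_unique (h1.const_mul G.comulOne) (h1.congr fun J => ?_)
  simp only [Function.comp_apply, map_mul, ← mul_assoc, part, map_sum, Finset.mul_sum,
    comulOne_mul_comul_unit]

lemma comul_mul_comulOne (a : A) : G.comul a * G.comulOne = G.comul a := by
  simpa [star_mul, star_comulOne, ← map_star] using congrArg star (G.comulOne_mul_comul (star a))

/-! ### `(A ⊗ 1)Δ(A)` and `(1 ⊗ A)Δ(A)` lie in `A ⊗ A` -/

lemma leftCut_comul_unit_mul_mem (k r k' l : I) (b : A) :
    opTensor (G.unitOp k r) 1 * G.comul (G.unit k' l * b) ∈ π.tensor2 := by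
  rw [map_mul, ← mul_assoc]
  by_cases h : k = k'
  · subst h
    rw [leftCut_comul_unit]
    exact (G.comul_mem b _ (π.tensor_mem _ _)).2
  · rw [G.leftCut_comul_unit_of_ne h, zero_mul]; exact zero_mem _

lemma rightCut_comul_unit_mul_mem (r l k l' : I) (b : A) :
    opTensor 1 (G.unitOp r l) * G.comul (G.unit k l' * b) ∈ π.tensor2 := by
  rw [map_mul, ← mul_assoc]
  by_cases h : l = l'
  · subst h
    rw [rightCut_comul_unit]
    exact (G.comul_mem b _ (π.tensor_mem _ _)).2
  · rw [G.rightCut_comul_unit_of_ne h, zero_mul]; exact zero_mem _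

lemma mem_tensor2_of_part_mul {R : HilbertTensor K K →L[ℂ] HilbertTensor K K} (b : A)
    (h : ∀ k l, R * G.comul (G.unit k l * b) ∈ π.tensor2) : R * G.comul b ∈ π.tensor2 := by
  have h1 := ((G.continuous_comul.tendsto b).comp (G.tendsto_part_mul b)).const_mul R
  refine π.isClosed_tensor2.mem_of_tendsto h1 (Eventually.of_forall fun J => ?_)
  simp only [Function.comp_apply, part, Finset.sum_mul, map_sum, Finset.mul_sum]
  exact sum_mem fun q _ => h _ _

lemma tensor_one_mul_comul_mem (a b : A) :
    opTensor (π.toHom a) 1 * G.comul b ∈ π.tensor2 := by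
  have h1 := (((continuous_opTensor_left 1).tendsto _).comp
    (G.tendsto_mul_part_op a)).mul_const (G.comul b)
  refine π.isClosed_tensor2.mem_of_tendsto h1 (Eventually.of_forall fun J => ?_)
  have : opTensor (π.toHom a * π.toHom (G.part J)) 1 * G.comul b =
      ∑ q ∈ J, opTensor (π.toHom a) 1 * (opTensor (G.unitOp q.1 q.2) 1 * G.comul b) := by
    simp only [map_part, Finset.mul_sum, opTensor_sum_left, Finset.sum_mul, ← mul_assoc,
      opTensor_mul, mul_one]
  simp only [Function.comp_apply, this]
  refine sum_mem fun q _ => ?_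
  refine (map_mem_of_mem_minTensor (ContinuousLinearMap.mul ℂ _ (opTensor (π.toHom a) 1))
    π.isClosed_tensor2 (fun v w => ?_)
    (G.mem_tensor2_of_part_mul b fun k l => G.leftCut_comul_unit_mul_mem q.1 q.2 k l b) :)
  simp only [ContinuousLinearMap.mul_apply', opTensor_mul, one_mul, FaithfulRep.lin_apply,
    ← map_mul]
  exact π.tensor_mem _ _

lemma one_tensor_mul_comul_mem (a b : A) :
    opTensor 1 (π.toHom a) * G.comul b ∈ π.tensor2 := by
  have h1 := (((continuous_opTensor_right 1).tendsto _).comp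
    (G.tendsto_mul_part_op a)).mul_const (G.comul b)
  refine π.isClosed_tensor2.mem_of_tendsto h1 (Eventually.of_forall fun J => ?_)
  have : opTensor 1 (π.toHom a * π.toHom (G.part J)) * G.comul b =
      ∑ q ∈ J, opTensor 1 (π.toHom a) * (opTensor 1 (G.unitOp q.1 q.2) * G.comul b) := by
    simp only [map_part, Finset.mul_sum, opTensor_sum_right, Finset.sum_mul, ← mul_assoc,
      opTensor_mul, mul_one]
  simp only [Function.comp_apply, this]
  refine sum_mem fun q _ => ?_
  refine (map_mem_of_mem_minTensor (ContinuousLinearMap.mul ℂ _ (opTensor 1 (π.toHom a)))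
    π.isClosed_tensor2 (fun v w => ?_)
    (G.mem_tensor2_of_part_mul b fun k l => G.rightCut_comul_unit_mul_mem q.1 q.2 k l b) :)
  simp only [ContinuousLinearMap.mul_apply', opTensor_mul, one_mul, FaithfulRep.lin_apply,
    ← map_mul]
  exact π.tensor_mem _ _

end PartialCompactQuantumSemigroup

/-! ### Matrix corepresentations -/

variable {I : Type u} {A K : Type*} [NonUnitalCStarAlgebra A] [NormedAddCommGroup K]
  [InnerProductSpace ℂ K] [CompleteSpace K] {π : FaithfulRep A K}

/-- A unitary matrix corepresentation of `G` whose entries lie in `𝒜` and on which `S` acts as an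
antipode. The index set is the set of labels of a homogeneous orthonormal basis of a bigraded
Hilbert space, where `b` has bidegree `(src b, tgt b)`; rows and columns are finite. Only the
relation `x* x = ∑ ρ ⊗ ρ` of unitarity is recorded. -/
structure MatrixCorep (G : PartialCompactQuantumSemigroup I π) (𝒜 : NonUnitalSubalgebra ℂ A)
    (S : 𝒜 →ₗ[ℂ] 𝒜) where
  index : Type u
  src : index → I
  tgt : index → I
  finite_row : ∀ r, {b | src b = r}.Finite
  finite_col : ∀ r, {b | tgt b = r}.Finite
  coef : index → index → A
  unit_mul : ∀ b c, G.unit (src b) (src c) * coef b c = coef b c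
  mul_unit : ∀ b c, coef b c * G.unit (tgt b) (tgt c) = coef b c
  /-- the comultiplication, cut by `1(k,r)` on the first leg so that the sum is finite -/
  leftCut : ∀ r b c, opTensor (G.unitOp (src b) r) 1 * G.comul (coef b c) =
    ∑ d ∈ (finite_row r).toFinset, opTensor (π.toHom (coef b d)) (π.toHom (coef d c))
  star_mul_self : ∀ n b, ∑ d ∈ (finite_col n).toFinset, star (coef d b) * coef d b =
    G.unit n (tgt b)
  star_mul_of_ne : ∀ n b c, b ≠ c →
    ∑ d ∈ (finite_col n).toFinset, star (coef d b) * coef d c = 0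
  coef_mem : ∀ b c, coef b c ∈ 𝒜
  antipode : ∀ b c, (S ⟨coef b c, coef_mem b c⟩ : A) = star (coef c b)

namespace MatrixCorep

variable {G : PartialCompactQuantumSemigroup I π} {𝒜 : NonUnitalSubalgebra ℂ A}
  {S : 𝒜 →ₗ[ℂ] 𝒜}

/-- The labels with source `r`. -/
def row (M : MatrixCorep G 𝒜 S) (r : I) : Finset M.index := (M.finite_row r).toFinset

/-- The labels with target `r`. -/
def col (M : MatrixCorep G 𝒜 S) (r : I) : Finset M.index := (M.finite_col r).toFinset

@[simp] lemma mem_row (M : MatrixCorep G 𝒜 S) {r : I} {b : M.index} :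
    b ∈ M.row r ↔ M.src b = r := by simp [row]

@[simp] lemma mem_col (M : MatrixCorep G 𝒜 S) {r : I} {b : M.index} :
    b ∈ M.col r ↔ M.tgt b = r := by simp [col]

/-- The trivial corepresentation, with coefficients `1(k,l)`. -/
def trivial (hmem : ∀ k l, G.unit k l ∈ 𝒜)
    (hS : ∀ k l, (S ⟨G.unit k l, hmem k l⟩ : A) = G.unit l k) : MatrixCorep G 𝒜 S where
  index := I
  src := id
  tgt := id
  finite_row r := Set.finite_singleton r
  finite_col r := Set.finite_singleton r
  coef := G.unit
  unit_mul := G.unit_mul_self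
  mul_unit := G.unit_mul_self
  leftCut r b c := by
    rw [Finset.sum_eq_single r]
    · exact G.leftCut_comul_unit b r c
    · intro d hd hne; exact absurd (by simpa using hd) hne
    · intro h; simp at h
  star_mul_self n b := by
    rw [Finset.sum_eq_single n]
    · simp
    · intro d hd hne; exact absurd (by simpa using hd) hne
    · intro h; simp at h
  star_mul_of_ne n b c hbc := by
    refine Finset.sum_eq_zero fun d _ => ?_
    rw [G.star_unit]
    exact G.orthogonal_unit _ _ _ _ (by simp [hbc])
  coef_mem := hmem
  antipode b c := by rw [hS, G.star_unit]

/-- The labels of the tensor product: pairs of composable labels. -/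
abbrev TensorIndex (M N : MatrixCorep G 𝒜 S) : Type u :=
  {p : M.index × N.index // M.tgt p.1 = N.src p.2}

lemma finite_tensor_row (M N : MatrixCorep G 𝒜 S) (r : I) :
    {p : TensorIndex M N | M.src p.1.1 = r}.Finite := by
  refine Set.Finite.of_finite_image (f := Subtype.val) (((M.row r).finite_toSet.biUnion
    fun b _ => ((N.row (M.tgt b)).finite_toSet.image fun d => (b, d))).subset ?_)
    Subtype.val_injective.injOn
  rintro _ ⟨⟨⟨b, d⟩, h⟩, hp, rfl⟩
  simp only [Set.mem_iUnion]
  exact ⟨b, by simpa using hp, d, by simpa using h.symm, rfl⟩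

lemma finite_tensor_col (M N : MatrixCorep G 𝒜 S) (r : I) :
    {p : TensorIndex M N | N.tgt p.1.2 = r}.Finite := by
  refine Set.Finite.of_finite_image (f := Subtype.val) (((N.col r).finite_toSet.biUnion
    fun d _ => ((M.col (N.src d)).finite_toSet.image fun b => (b, d))).subset ?_)
    Subtype.val_injective.injOn
  rintro _ ⟨⟨⟨b, d⟩, h⟩, hp, rfl⟩
  simp only [Set.mem_iUnion]
  exact ⟨d, by simpa using hp, b, by simpa using h, rfl⟩

lemma sum_tensor_row {Z : Type*} [AddCommMonoid Z] (M N : MatrixCorep G 𝒜 S) (r : I)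
    (f : M.index → N.index → Z) :
    ∑ p ∈ (finite_tensor_row M N r).toFinset, f p.1.1 p.1.2 =
      ∑ b ∈ M.row r, ∑ d ∈ N.row (M.tgt b), f b d := by
  rw [Finset.sum_sigma']
  refine Finset.sum_bij' (fun p _ => ⟨p.1.1, p.1.2⟩)
    (fun q hq => ⟨(q.1, q.2), by
      have := (Finset.mem_sigma.1 hq).2; exact ((mem_row N).1 this).symm⟩) ?_ ?_ ?_ ?_ ?_
  · intro p hp
    simp only [Finset.mem_sigma, mem_row]
    exact ⟨by simpa using hp, p.2.symm⟩
  · intro q hq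
    simpa using (Finset.mem_sigma.1 hq).1
  · intros; rfl
  · intros; rfl
  · intros; rfl

lemma sum_tensor_col {Z : Type*} [AddCommMonoid Z] (M N : MatrixCorep G 𝒜 S) (r : I)
    (f : M.index → N.index → Z) :
    ∑ p ∈ (finite_tensor_col M N r).toFinset, f p.1.1 p.1.2 =
      ∑ d ∈ N.col r, ∑ b ∈ M.col (N.src d), f b d := by
  rw [Finset.sum_sigma']
  refine Finset.sum_bij' (fun p _ => ⟨p.1.2, p.1.1⟩)
    (fun q hq => ⟨(q.2, q.1), by
      have := (Finset.mem_sigma.1 hq).2; exact ((mem_col M).1 this)⟩) ?_ ?_ ?_ ?_ ?_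
  · intro p hp
    simp only [Finset.mem_sigma, mem_col]
    exact ⟨by simpa using hp, p.2⟩
  · intro q hq
    simpa using (Finset.mem_sigma.1 hq).1
  · intros; rfl
  · intros; rfl
  · intros; rfl

lemma sum_star_mul_mul (M N : MatrixCorep G 𝒜 S) (n : I) (b c : M.index) (b' c' : N.index) :
    ∑ d' ∈ N.col n, ∑ d ∈ M.col (N.src d'),
        star (M.coef d b * N.coef d' b') * (M.coef d c * N.coef d' c') =
      ∑ d' ∈ N.col n, star (N.coef d' b') *
        ((∑ d ∈ M.col (N.src d'), star (M.coef d b) * M.coef d c) * N.coef d' c') := by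
  refine Finset.sum_congr rfl fun d' _ => ?_
  simp only [Finset.sum_mul, Finset.mul_sum, star_mul, mul_assoc]

/-- The tensor product of two corepresentations. -/
def tensor (hS : ∀ a b, S (a * b) = S b * S a) (M N : MatrixCorep G 𝒜 S) :
    MatrixCorep G 𝒜 S where
  index := TensorIndex M N
  src p := M.src p.1.1
  tgt p := N.tgt p.1.2
  finite_row := finite_tensor_row M N
  finite_col := finite_tensor_col M N
  coef p q := M.coef p.1.1 q.1.1 * N.coef p.1.2 q.1.2
  unit_mul p q := by rw [← mul_assoc, M.unit_mul]
  mul_unit p q := by rw [mul_assoc, N.mul_unit]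
  leftCut r p q := by
    rw [sum_tensor_row M N r fun d d' => opTensor
      (π.toHom (M.coef p.1.1 d * N.coef p.1.2 d')) (π.toHom (M.coef d q.1.1 * N.coef d' q.1.2)),
      map_mul, ← mul_assoc, M.leftCut, Finset.sum_mul]
    refine Finset.sum_congr rfl fun d _ => ?_
    have h1 : opTensor (π.toHom (M.coef p.1.1 d)) (π.toHom (M.coef d q.1.1)) =
        opTensor (π.toHom (M.coef p.1.1 d)) (π.toHom (M.coef d q.1.1)) *
          opTensor (G.unitOp (N.src p.1.2) (M.tgt d)) 1 := by
      rw [opTensor_mul, mul_one, PartialCompactQuantumSemigroup.unitOp, ← map_mul, ← p.2,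
        M.mul_unit]
    rw [h1, mul_assoc, N.leftCut, Finset.mul_sum]
    exact Finset.sum_congr rfl fun d' _ => by rw [opTensor_mul, ← map_mul, ← map_mul]
  star_mul_self n p := by
    rw [sum_tensor_col M N n fun d d' =>
      star (M.coef d p.1.1 * N.coef d' p.1.2) * (M.coef d p.1.1 * N.coef d' p.1.2),
      sum_star_mul_mul, ← N.star_mul_self]
    refine Finset.sum_congr rfl fun d' _ => ?_
    rw [col, M.star_mul_self, p.2, N.unit_mul]
  star_mul_of_ne n p q hpq := by
    rw [sum_tensor_col M N n fun d d' =>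
      star (M.coef d p.1.1 * N.coef d' p.1.2) * (M.coef d q.1.1 * N.coef d' q.1.2),
      sum_star_mul_mul]
    by_cases h : p.1.1 = q.1.1
    · have h' : p.1.2 ≠ q.1.2 := fun h' => hpq (Subtype.ext (Prod.ext h h'))
      rw [← N.star_mul_of_ne n _ _ h']
      refine Finset.sum_congr rfl fun d' _ => ?_
      rw [h, col, M.star_mul_self, q.2, N.unit_mul]
    · refine Finset.sum_eq_zero fun d' _ => ?_
      rw [col, M.star_mul_of_ne _ _ _ h, zero_mul, mul_zero]
  coef_mem p q := mul_mem (M.coef_mem _ _) (N.coef_mem _ _)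
  antipode p q := by
    have := hS ⟨_, M.coef_mem p.1.1 q.1.1⟩ ⟨_, N.coef_mem p.1.2 q.1.2⟩
    calc _ = ((S ⟨_, N.coef_mem p.1.2 q.1.2⟩ * S ⟨_, M.coef_mem p.1.1 q.1.1⟩ : 𝒜) : A) :=
          congrArg Subtype.val this
      _ = _ := by
          rw [NonUnitalSubalgebra.coe_mul, N.antipode, M.antipode, star_mul]

/-! ### The span of the matrix coefficients and the antipode -/

variable (G 𝒜 S) in
/-- The coefficients of matrix corepresentations. -/
def coefs : Set A := {a | ∃ (M : MatrixCorep G 𝒜 S) (b c : M.index), M.coef b c = a}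

/-- Products of coefficients are coefficients of the tensor product if the labels are composable,
and vanish otherwise. -/
lemma mul_mem_coefs (hS : ∀ a b, S (a * b) = S b * S a) {x y : A} (hx : x ∈ coefs G 𝒜 S)
    (hy : y ∈ coefs G 𝒜 S) : x * y ∈ coefs G 𝒜 S ∨ x * y = 0 := by
  obtain ⟨M, b, c, rfl⟩ := hx
  obtain ⟨N, b', c', rfl⟩ := hy
  by_cases h : (M.tgt b, M.tgt c) = (N.src b', N.src c')
  · exact Or.inl ⟨tensor hS M N, ⟨(b, b'), congrArg Prod.fst h⟩, ⟨(c, c'), congrArg Prod.snd h⟩,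
      rfl⟩
  · right
    rw [← M.mul_unit, ← N.unit_mul, mul_assoc, ← mul_assoc (G.unit _ _),
      G.orthogonal_unit _ _ _ _ h, zero_mul, mul_zero]

lemma mul_mem_span_coefs (hS : ∀ a b, S (a * b) = S b * S a) {x y : A}
    (hx : x ∈ Submodule.span ℂ (coefs G 𝒜 S)) (hy : y ∈ Submodule.span ℂ (coefs G 𝒜 S)) :
    x * y ∈ Submodule.span ℂ (coefs G 𝒜 S) := by
  induction hx using Submodule.span_induction with
  | zero => simp
  | add x x' _ _ h h' => rw [add_mul]; exact add_mem h h'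
  | smul c x _ h => rw [smul_mul_assoc]; exact Submodule.smul_mem _ _ h
  | mem x hx =>
    induction hy using Submodule.span_induction with
    | zero => simp
    | add x x' _ _ h h' => rw [mul_add]; exact add_mem h h'
    | smul c x _ h => rw [mul_smul_comm]; exact Submodule.smul_mem _ _ h
    | mem y hy =>
      rcases mul_mem_coefs hS hx hy with h | h
      · exact Submodule.subset_span h
      · rw [h]; exact zero_mem _

/-- On matrix coefficients `S(S(a)*) = a*`; in particular `S` is injective and its range contains
all matrix coefficients. -/
lemma exists_star_antipode {a : A} (ha : a ∈ Submodule.span ℂ (coefs G 𝒜 S)) :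
    ∃ a' z : 𝒜, (a' : A) = a ∧ (S a' : A) = star (z : A) ∧ (S z : A) = star a := by
  induction ha using Submodule.span_induction with
  | mem x hx =>
    obtain ⟨M, b, c, rfl⟩ := hx
    exact ⟨⟨_, M.coef_mem b c⟩, ⟨_, M.coef_mem c b⟩, rfl, M.antipode b c, M.antipode c b⟩
  | zero => exact ⟨0, 0, by simp⟩
  | add x y _ _ hx hy =>
    obtain ⟨a, z, rfl, h1, h2⟩ := hx
    obtain ⟨b, w, rfl, h3, h4⟩ := hy
    exact ⟨a + b, z + w, rfl, by simp [h1, h3], by simp [h2, h4]⟩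
  | smul c x _ hx =>
    obtain ⟨a, z, rfl, h1, h2⟩ := hx
    exact ⟨c • a, star c • z, rfl, by simp [h1], by simp [h2]⟩

lemma antipode_injective (hspan : ∀ a ∈ 𝒜, a ∈ Submodule.span ℂ (coefs G 𝒜 S)) :
    Function.Injective S := by
  rw [← LinearMap.ker_eq_bot, LinearMap.ker_eq_bot']
  intro a ha
  obtain ⟨a', z, h1, h2, h3⟩ := exists_star_antipode (hspan a a.2)
  obtain rfl : a' = a := Subtype.ext h1
  have hz : z = 0 := by
    rw [ha] at h2
    exact Subtype.ext (star_eq_zero.1 h2.symm)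
  rw [hz, map_zero] at h3
  exact Subtype.ext (star_eq_zero.1 h3.symm)

/-- Matrix coefficients are values of `S`. -/
lemma exists_antipode_eq (hspan : ∀ a ∈ 𝒜, a ∈ Submodule.span ℂ (coefs G 𝒜 S))
    (M : MatrixCorep G 𝒜 S) (b c : M.index) : ∃ y : 𝒜, (S y : A) = M.coef b c := by
  obtain ⟨a', z, h1, h2, h3⟩ := exists_star_antipode (hspan _ (S ⟨_, M.coef_mem c b⟩).2)
  exact ⟨z, by rw [h3, M.antipode, star_star]⟩

/-! ### Convolution identities -/

lemma toHom_unit_mul (M : MatrixCorep G 𝒜 S) (b c : M.index) :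
    G.unitOp (M.src b) (M.src c) * π.toHom (M.coef b c) = π.toHom (M.coef b c) := by
  rw [PartialCompactQuantumSemigroup.unitOp, ← map_mul, M.unit_mul]

lemma toHom_mul_unit (M : MatrixCorep G 𝒜 S) (b c : M.index) :
    π.toHom (M.coef b c) * G.unitOp (M.tgt b) (M.tgt c) = π.toHom (M.coef b c) := by
  rw [PartialCompactQuantumSemigroup.unitOp, ← map_mul, M.mul_unit]

/-- The comultiplication, cut on the second leg. -/
lemma rightCut (M : MatrixCorep G 𝒜 S) (r : I) (b c : M.index) :
    opTensor 1 (G.unitOp r (M.src c)) * G.comul (M.coef b c) =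
      ∑ d ∈ M.row r, opTensor (π.toHom (M.coef b d)) (π.toHom (M.coef d c)) := by
  rw [row, ← M.leftCut, ← M.unit_mul, map_mul, ← mul_assoc, ← mul_assoc, G.rightCut_comul_unit,
    G.leftCut_comul_unit]

/-- `∑ d, (x(d,b)* ⊗ 1)Δ(x(d,c)) = 1(n, t b) ⊗ x(b,c)`, the sum being over column `n`. -/
lemma sum_star_tensor_one_mul_comul (M : MatrixCorep G 𝒜 S) (n : I) (b c : M.index) :
    ∑ d ∈ M.col n, opTensor (π.toHom (star (M.coef d b))) 1 * G.comul (M.coef d c) =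
      opTensor (G.unitOp n (M.tgt b)) (π.toHom (M.coef b c)) := by
  have h1 : ∀ d, opTensor (π.toHom (star (M.coef d b))) 1 * G.comul (M.coef d c) =
      ∑ e ∈ M.row (M.src b), opTensor (π.toHom (star (M.coef d b) * M.coef d e))
        (π.toHom (M.coef e c)) := by
    intro d
    have h2 : opTensor (π.toHom (star (M.coef d b))) (1 : K →L[ℂ] K) =
        opTensor (π.toHom (star (M.coef d b))) 1 *
          opTensor (G.unitOp (M.src d) (M.src b)) 1 := by
      rw [opTensor_mul, mul_one]
      have := congrArg star (M.toHom_unit_mul d b)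
      rw [star_mul, G.star_unitOp, ← map_star] at this
      rw [this]
    rw [h2, mul_assoc, M.leftCut, Finset.mul_sum]
    exact Finset.sum_congr rfl fun e _ => by rw [opTensor_mul, one_mul, map_mul]
  simp only [h1]
  rw [Finset.sum_comm, Finset.sum_eq_single_of_mem b (by simp)]
  · rw [← opTensor_sum_left, ← map_sum, col, M.star_mul_self]; rfl
  · intro e _ he
    rw [← opTensor_sum_left, ← map_sum, col, M.star_mul_of_ne _ _ _ he.symm, map_zero,
      opTensor_zero_left]

/-- There are elements `y(d) = S⁻¹(x(d,c))` with
`∑ d, (1 ⊗ y(d))Δ(x(b,d)) = x(b,c) ⊗ 1(t c, n)`, the sum being over column `n`. -/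
lemma exists_sum_one_tensor_mul_comul (hS : ∀ a b, S (a * b) = S b * S a)
    (hmem : ∀ k l, G.unit k l ∈ 𝒜)
    (hunit : ∀ k l, (S ⟨G.unit k l, hmem k l⟩ : A) = G.unit l k)
    (hspan : ∀ a ∈ 𝒜, a ∈ Submodule.span ℂ (coefs G 𝒜 S))
    (M : MatrixCorep G 𝒜 S) (n : I) (b c : M.index) :
    ∃ y : M.index → A, ∑ d ∈ M.col n, opTensor 1 (π.toHom (y d)) * G.comul (M.coef b d) =
      opTensor (π.toHom (M.coef b c)) (G.unitOp (M.tgt c) n) := by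
  choose y hy using fun d => exists_antipode_eq hspan M d c
  have hinj := antipode_injective hspan
  -- Each of the relations for `y(d)` is the preimage under `S` of one for `x(d,c)`.
  have hyu : ∀ d, (y d : A) * G.unit (M.src c) (M.src d) = y d := by
    intro d
    have : y d * ⟨_, hmem (M.src c) (M.src d)⟩ = y d := by
      apply hinj
      apply Subtype.ext
      rw [hS, NonUnitalSubalgebra.coe_mul, hunit, hy, M.unit_mul]
    exact congrArg Subtype.val this
  have hsum : ∀ e, (S (∑ d ∈ M.col n, y d * ⟨_, M.coef_mem e d⟩) : A) =
      ∑ d ∈ M.col n, star (M.coef d e) * M.coef d c := by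
    intro e
    rw [map_sum, AddSubmonoidClass.coe_finsetSum]
    refine Finset.sum_congr rfl fun d _ => ?_
    rw [hS, NonUnitalSubalgebra.coe_mul, M.antipode, hy]
  have hself : ∑ d ∈ M.col n, (y d : A) * M.coef c d = G.unit (M.tgt c) n := by
    have : ∑ d ∈ M.col n, y d * ⟨_, M.coef_mem c d⟩ = ⟨_, hmem (M.tgt c) n⟩ := by
      apply hinj
      apply Subtype.ext
      rw [hsum, hunit, col, M.star_mul_self]
    simpa using congrArg Subtype.val this
  have hne : ∀ e, e ≠ c → ∑ d ∈ M.col n, (y d : A) * M.coef e d = 0 := by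
    intro e he
    have : ∑ d ∈ M.col n, y d * ⟨_, M.coef_mem e d⟩ = 0 := by
      apply hinj
      apply Subtype.ext
      rw [hsum, col, M.star_mul_of_ne _ _ _ he, map_zero]; rfl
    simpa using congrArg Subtype.val this
  refine ⟨fun d => y d, ?_⟩
  have h1 : ∀ d, opTensor 1 (π.toHom (y d)) * G.comul (M.coef b d) =
      ∑ e ∈ M.row (M.src c), opTensor (π.toHom (M.coef b e))
        (π.toHom ((y d : A) * M.coef e d)) := by
    intro d
    have h2 : opTensor (1 : K →L[ℂ] K) (π.toHom (y d)) =
        opTensor 1 (π.toHom (y d)) * opTensor 1 (G.unitOp (M.src c) (M.src d)) := by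
      rw [opTensor_mul, mul_one, PartialCompactQuantumSemigroup.unitOp, ← map_mul, hyu]
    rw [h2, mul_assoc, M.rightCut, Finset.mul_sum]
    exact Finset.sum_congr rfl fun e _ => by rw [opTensor_mul, one_mul, map_mul]
  simp only [h1]
  rw [Finset.sum_comm, Finset.sum_eq_single_of_mem c (by simp)]
  · rw [← opTensor_sum_right, ← map_sum, hself]; rfl
  · intro e _ he
    rw [← opTensor_sum_right, ← map_sum, hne e he, map_zero, opTensor_zero_right]

end MatrixCorep

/-! ### Slice maps -/

section Slice

variable {A K : Type*} [NonUnitalCStarAlgebra A] [NormedAddCommGroup K] [InnerProductSpace ℂ K]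
  [CompleteSpace K] (π : FaithfulRep A K)

/-- The slice `(ω ⊗ id)(t)` of an element of the algebraic tensor product. -/
def leftSlice (ω : A →L[ℂ] ℂ) : A ⊗[ℂ] A →ₗ[ℂ] A :=
  (TensorProduct.lid ℂ A).toLinearMap ∘ₗ (ω : A →ₗ[ℂ] ℂ).rTensor A

/-- The slice `(id ⊗ ω)(t)` of an element of the algebraic tensor product. -/
def rightSlice (ω : A →L[ℂ] ℂ) : A ⊗[ℂ] A →ₗ[ℂ] A :=
  (TensorProduct.rid ℂ A).toLinearMap ∘ₗ (ω : A →ₗ[ℂ] ℂ).lTensor A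

@[simp] lemma leftSlice_tmul (ω : A →L[ℂ] ℂ) (a b : A) :
    leftSlice ω (a ⊗ₜ b) = ω a • b := by simp [leftSlice]

@[simp] lemma rightSlice_tmul (ω : A →L[ℂ] ℂ) (a b : A) :
    rightSlice ω (a ⊗ₜ b) = ω b • a := by simp [rightSlice]

/-- The vector functional `a ↦ ⟪ξ, π(a) η⟫`. -/
def vecFun (ξ η : K) : A →L[ℂ] ℂ :=
  LinearMap.mkContinuous
    { toFun := fun a => inner ℂ ξ (π.toHom a η)
      map_add' := fun a b => by simp
      map_smul' := fun c a => by simp } (‖ξ‖ * ‖η‖) fun a => by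
    refine (norm_inner_le_norm _ _).trans ?_
    rw [mul_assoc, mul_comm ‖η‖, ← π.norm_map]
    exact mul_le_mul_of_nonneg_left ((π.toHom a).le_opNorm η) (norm_nonneg _)

@[simp] lemma vecFun_apply (ξ η : K) (a : A) : vecFun π ξ η a = inner ℂ ξ (π.toHom a η) := rfl

lemma toHom_leftSlice_vecFun (ξ η : K) (t : A ⊗[ℂ] A) :
    π.toHom (leftSlice (vecFun π ξ η) t) =
      (creationL ξ : K →L[ℂ] HilbertTensor K K).adjoint ∘L algTensor π.lin π.lin t ∘L
        creationL η := by
  induction t with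
  | zero => ext; simp
  | add x y hx hy => ext v; simp [hx, hy]
  | tmul a b => ext v; simp

lemma toHom_rightSlice_vecFun (ξ η : K) (t : A ⊗[ℂ] A) :
    π.toHom (rightSlice (vecFun π ξ η) t) =
      (creation ξ : K →L[ℂ] HilbertTensor K K).adjoint ∘L algTensor π.lin π.lin t ∘L
        creation η := by
  induction t with
  | zero => ext; simp
  | add x y hx hy => ext v; simp [hx, hy]
  | tmul a b => ext v; simp

/-- Slicing the two legs by functionals in either order gives the same number. -/
lemma apply_rightSlice (ω φ : A →L[ℂ] ℂ) (t : A ⊗[ℂ] A) :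
    ω (rightSlice φ t) = φ (leftSlice ω t) := by
  induction t with
  | zero => simp
  | add x y hx hy => simp [hx, hy]
  | tmul a b => simp [mul_comm]

lemma norm_sandwich_creation_le (T : HilbertTensor K K →L[ℂ] HilbertTensor K K) (ξ η : K) :
    ‖(creation ξ : K →L[ℂ] HilbertTensor K K).adjoint ∘L T ∘L creation η‖ ≤ ‖ξ‖ * (‖T‖ * ‖η‖) := by
  refine (ContinuousLinearMap.opNorm_comp_le _ _).trans (mul_le_mul ?_ ?_ (norm_nonneg _)
    (norm_nonneg _))
  · rw [LinearIsometryEquiv.norm_map]; exact norm_creation_le ξ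
  · exact (ContinuousLinearMap.opNorm_comp_le _ _).trans
      (mul_le_mul_of_nonneg_left (norm_creation_le η) (norm_nonneg _))

lemma norm_sandwich_creationL_le (T : HilbertTensor K K →L[ℂ] HilbertTensor K K) (ξ η : K) :
    ‖(creationL ξ : K →L[ℂ] HilbertTensor K K).adjoint ∘L T ∘L creationL η‖ ≤
      ‖ξ‖ * (‖T‖ * ‖η‖) := by
  refine (ContinuousLinearMap.opNorm_comp_le _ _).trans (mul_le_mul ?_ ?_ (norm_nonneg _)
    (norm_nonneg _))
  · rw [LinearIsometryEquiv.norm_map]; exact norm_creationL_le ξ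
  · exact (ContinuousLinearMap.opNorm_comp_le _ _).trans
      (mul_le_mul_of_nonneg_left (norm_creationL_le η) (norm_nonneg _))

lemma norm_le_of_norm_inner_le {y : A} {C : ℝ} (hC : 0 ≤ C)
    (h : ∀ ξ η : K, ‖vecFun π ξ η y‖ ≤ C * (‖ξ‖ * ‖η‖)) : ‖y‖ ≤ C := by
  rw [← π.norm_map]
  refine ContinuousLinearMap.opNorm_le_bound _ hC fun η => ?_
  have := h (π.toHom y η) η
  rw [vecFun_apply, inner_self_eq_norm_sq_to_K] at this
  rcases (norm_nonneg (π.toHom y η)).eq_or_lt with h0 | h0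
  · rw [← h0]; positivity
  · have h1 : ‖π.toHom y η‖ * ‖π.toHom y η‖ ≤ (C * ‖η‖) * ‖π.toHom y η‖ := by
      calc _ ≤ C * (‖π.toHom y η‖ * ‖η‖) := by simpa [sq] using this
        _ = _ := by ring
    exact le_of_mul_le_mul_right h1 h0

/-- Slice maps are bounded for the spatial norm: it suffices to evaluate the slice at vector
functionals, and slicing by those first is obviously contractive. -/
lemma norm_leftSlice_le (ω : A →L[ℂ] ℂ) (t : A ⊗[ℂ] A) :
    ‖leftSlice ω t‖ ≤ ‖ω‖ * ‖algTensor π.lin π.lin t‖ := by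
  refine norm_le_of_norm_inner_le π (by positivity) fun ξ η => ?_
  rw [← apply_rightSlice]
  refine (ω.le_opNorm _).trans ?_
  rw [mul_assoc]
  refine mul_le_mul_of_nonneg_left ?_ (norm_nonneg _)
  rw [← π.norm_map, toHom_rightSlice_vecFun]
  exact (norm_sandwich_creation_le _ _ _).trans_eq (by ring)

lemma norm_rightSlice_le (ω : A →L[ℂ] ℂ) (t : A ⊗[ℂ] A) :
    ‖rightSlice ω t‖ ≤ ‖ω‖ * ‖algTensor π.lin π.lin t‖ := by
  refine norm_le_of_norm_inner_le π (by positivity) fun ξ η => ?_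
  rw [apply_rightSlice]
  refine (ω.le_opNorm _).trans ?_
  rw [mul_assoc]
  refine mul_le_mul_of_nonneg_left ?_ (norm_nonneg _)
  rw [← π.norm_map, toHom_leftSlice_vecFun]
  exact (norm_sandwich_creationL_le _ _ _).trans_eq (by ring)

/-- Left multiplication by `a ⊗ b` on the algebraic tensor product. -/
def mulTensor (a b : A) : A ⊗[ℂ] A →ₗ[ℂ] A ⊗[ℂ] A :=
  TensorProduct.map (LinearMap.mulLeft ℂ a) (LinearMap.mulLeft ℂ b)

lemma algTensor_mulTensor (a b : A) (t : A ⊗[ℂ] A) :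
    algTensor π.lin π.lin (mulTensor a b t) =
      opTensor (π.toHom a) (π.toHom b) * algTensor π.lin π.lin t := by
  induction t with
  | zero => simp
  | add x y hx hy => simp [hx, hy, mul_add]
  | tmul x y => simp [mulTensor, opTensor_mul]

lemma algTensor_lTensor_mulLeft (b : A) (t : A ⊗[ℂ] A) :
    algTensor π.lin π.lin ((LinearMap.mulLeft ℂ b).lTensor A t) =
      opTensor 1 (π.toHom b) * algTensor π.lin π.lin t := by
  induction t with
  | zero => simp
  | add x y hx hy => simp [hx, hy, mul_add]
  | tmul x y => simp [opTensor_mul]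

lemma algTensor_rTensor_mulLeft (b : A) (t : A ⊗[ℂ] A) :
    algTensor π.lin π.lin ((LinearMap.mulLeft ℂ b).rTensor A t) =
      opTensor (π.toHom b) 1 * algTensor π.lin π.lin t := by
  induction t with
  | zero => simp
  | add x y hx hy => simp [hx, hy, mul_add]
  | tmul x y => simp [opTensor_mul]

lemma mul_leftSlice (ω : A →L[ℂ] ℂ) (c : A) (t : A ⊗[ℂ] A) :
    c * leftSlice ω t = leftSlice ω ((LinearMap.mulLeft ℂ c).lTensor A t) := by
  induction t with
  | zero => simp
  | add x y hx hy => simp [hx, hy, mul_add]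
  | tmul x y => simp [mul_smul_comm]

lemma mul_rightSlice (ω : A →L[ℂ] ℂ) (c : A) (t : A ⊗[ℂ] A) :
    c * rightSlice ω t = rightSlice ω ((LinearMap.mulLeft ℂ c).rTensor A t) := by
  induction t with
  | zero => simp
  | add x y hx hy => simp [hx, hy, mul_add]
  | tmul x y => simp [mul_smul_comm]

lemma mul_leftSlice_comp (ω : A →L[ℂ] ℂ) (e c : A) (t : A ⊗[ℂ] A) :
    c * leftSlice (ω ∘L ContinuousLinearMap.mul ℂ A e) t = leftSlice ω (mulTensor e c t) := by
  induction t with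
  | zero => simp
  | add x y hx hy => simp [hx, hy, mul_add]
  | tmul x y => simp [mulTensor, mul_smul_comm]

lemma mul_rightSlice_comp (ω : A →L[ℂ] ℂ) (e c : A) (t : A ⊗[ℂ] A) :
    c * rightSlice (ω ∘L ContinuousLinearMap.mul ℂ A e) t = rightSlice ω (mulTensor c e t) := by
  induction t with
  | zero => simp
  | add x y hx hy => simp [hx, hy, mul_add]
  | tmul x y => simp [mulTensor, mul_smul_comm]

end Slice

namespace PartialCompactQuantumSemigroup

variable {I A K : Type*} [NonUnitalCStarAlgebra A] [NormedAddCommGroup K] [InnerProductSpace ℂ K]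
  [CompleteSpace K] {π : FaithfulRep A K} (G : PartialCompactQuantumSemigroup I π)

/-- Every bounded functional `ω` is a norm limit of the functionals `x ↦ ω(e x)`, `e` running
through the finite sums of the projections `1(k,l)`. -/
lemma exists_norm_sub_comp_part_le (ω : A →L[ℂ] ℂ) {ε : ℝ} (hε : 0 < ε) :
    ∃ J, ‖ω - ω ∘L ContinuousLinearMap.mul ℂ A (G.part J)‖ ≤ ε := by
  -- If `‖a‖ ≤ 1` nearly attains the norm of `ω` and `a = e a`, then for `x = (1 - e) x` of norm
  -- at most `1` one has `‖a + s x‖² ≤ 1 + s²`, so `|ω(a)| + s |ω(x)| ≤ ‖ω‖ (1 + s² / 2)`.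
  set M := ‖ω‖ with hM
  have hM0 : 0 ≤ M := norm_nonneg _
  set s := ε / (M + 1) with hs
  have hs0 : 0 < s := by positivity
  have hδ : M - s * ε / 2 < ‖ω‖ := by rw [← hM]; have := mul_pos hs0 hε; linarith
  obtain ⟨a, ha, hωa⟩ := ω.exists_lt_apply_of_lt_opNorm hδ
  obtain ⟨J, hJ⟩ := (((ω.continuous.tendsto a).comp
    (G.tendsto_part_mul a)).norm.eventually_const_lt hωa).exists
  simp only [Function.comp_apply] at hJ
  set e := G.part J with he
  have hee : e * e = e := (G.isStarProjection_part J).isIdempotentElem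
  have hes : star e = e := G.star_part J
  have he1 : ‖e‖ ≤ 1 := G.norm_part_le J
  refine ⟨J, ContinuousLinearMap.opNorm_le_of_unit_norm hε.le fun x hx => ?_⟩
  change ‖ω x - ω (e * x)‖ ≤ ε
  rw [← map_sub]
  have hx1 : ‖x - e * x‖ ≤ 1 := by
    rw [← π.norm_map]
    have h1 : π.toHom (x - e * x) = (1 - π.toHom e) * π.toHom x := by
      rw [map_sub, map_mul, sub_mul, one_mul]
    rw [h1]
    refine (norm_mul_le _ _).trans ?_
    rw [π.norm_map, hx, mul_one]
    exact ((G.isStarProjection_part J).map π.toHom).one_sub.norm_le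
  obtain ⟨u, hu, hu'⟩ := RCLike.exists_norm_eq_mul_self (ω (e * a))
  obtain ⟨v, hv, hv'⟩ := RCLike.exists_norm_eq_mul_self (ω (x - e * x))
  set p := u • (e * a) with hp
  set q := ((s : ℂ) * v) • (x - e * x) with hq
  have hpn : ‖p‖ ≤ 1 := by
    rw [hp, norm_smul, hu, one_mul]
    exact (norm_mul_le _ _).trans (mul_le_one₀ he1 (norm_nonneg _) ha.le)
  have hqn : ‖q‖ ≤ s := by
    rw [hq, norm_smul, norm_mul, hv, mul_one, Complex.norm_real, Real.norm_of_nonneg hs0.le]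
    exact mul_le_of_le_one_right hs0.le hx1
  have horth : star p * q = 0 := by
    rw [hp, hq, star_smul, smul_mul_assoc, mul_smul_comm, star_mul, hes, mul_assoc, mul_sub,
      ← mul_assoc e e, hee, sub_self, mul_zero, smul_zero, smul_zero]
  have horth' : star q * p = 0 := by simpa using congrArg star horth
  have hpq : ‖p + q‖ * ‖p + q‖ ≤ 1 + s ^ 2 := by
    rw [← CStarRing.norm_star_mul_self, star_add, add_mul, mul_add, mul_add, horth, horth',
      add_zero, zero_add]
    refine (norm_add_le _ _).trans ?_
    rw [CStarRing.norm_star_mul_self, CStarRing.norm_star_mul_self]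
    nlinarith [norm_nonneg p, norm_nonneg q]
  have hpq' : ‖p + q‖ ≤ 1 + s ^ 2 / 2 := by
    refine abs_le_of_sq_le_sq' ?_ (by positivity) |>.2
    nlinarith [sq_nonneg (s ^ 2)]
  have hval : ω (p + q) = ((‖ω (e * a)‖ + s * ‖ω (x - e * x)‖ : ℝ) : ℂ) := by
    rw [map_add, hp, hq, map_smul, map_smul, smul_eq_mul, smul_eq_mul, mul_assoc]
    push_cast
    exact congrArg₂ _ hu'.symm (congrArg _ hv'.symm)
  have hle : ‖ω (e * a)‖ + s * ‖ω (x - e * x)‖ ≤ M * (1 + s ^ 2 / 2) := by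
    have h1 := ω.le_opNorm (p + q)
    rw [hval, Complex.norm_real, Real.norm_of_nonneg (by positivity)] at h1
    exact h1.trans (mul_le_mul_of_nonneg_left hpq' hM0)
  have hMs : M * s ≤ ε := by
    rw [hs, mul_div_assoc', div_le_iff₀ (by positivity)]
    nlinarith
  have h2 : s * ‖ω (x - e * x)‖ ≤ s * ε := by nlinarith
  exact le_of_mul_le_mul_left h2 hs0

/-- A strict limit of slices `(ω ⊗ id)(t)`, `t → Δ(a)`, lies in `A` and not only in `M(A)`. -/
lemma IsLeftSlice.mem_image {ω : A →L[ℂ] ℂ} {a : A} {y : K →L[ℂ] K}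
    (h : G.IsLeftSlice ω (G.comul a) y) : y ∈ π.image := by
  suffices y ∈ closure (π.image : Set (K →L[ℂ] K)) by rwa [π.isClosed_image.closure_eq] at this
  rw [Metric.mem_closure_iff]
  intro ε hε
  set T := G.comul a with hT
  set δ := ε / (2 * (‖T‖ + 1 + 2 * ‖ω‖ + 1)) with hδ
  have hδ0 : 0 < δ := by positivity
  obtain ⟨J, hJ⟩ := G.exists_norm_sub_comp_part_le ω hδ0
  set e := G.part J with he
  -- The functional `ω(e ·)` has its slice of `T` in `A`, because `(e ⊗ 1)Δ(a)` lies in `A ⊗ A`.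
  have hR : opTensor (π.toHom e) 1 * T ∈ π.tensor2 := G.tensor_one_mul_comul_mem e a
  obtain ⟨_, ⟨t₀, rfl⟩, ht₀⟩ := Metric.mem_closure_iff.1
    (minTensor_subset_closure_range π.lin π.lin hR) δ hδ0
  refine ⟨π.toHom (leftSlice ω t₀), π.mem_image _, ?_⟩
  rw [dist_eq_norm]
  refine lt_of_le_of_lt (b := δ * (‖T‖ + 1) + ‖ω‖ * (2 * δ) + δ) ?_ ?_
  · refine G.norm_le_of_forall_mul_le fun J' => ?_
    set c := G.part J' with hc
    have hcn : ‖π.toHom c‖ ≤ 1 := G.norm_map_part_le J'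
    have hfreq := G.isApproxUnit_tensor2.frequently_comap π.mul_mem_tensor2
      (algTensor π.lin π.lin) (minTensor_subset_closure_range π.lin π.lin) (G.comul_mem a)
    have hy := ((tendsto_strictNhds.1 h.2) _ (π.mem_image c)).2
    have hy' := Metric.tendsto_nhds.1 hy δ hδ0
    have ht := ((tendsto_strictNhds.1 (tendsto_comap_strictNhds (algTensor π.lin π.lin)
      π.tensor2 T)) _ (π.tensor_mem e c)).2
    have ht' := Metric.tendsto_nhds.1 ht δ hδ0
    obtain ⟨t, htn, hty, htT⟩ := (hfreq.and_eventually (hy'.and ht')).exists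
    rw [dist_eq_norm] at hty htT ht₀
    change ‖π.toHom c * π.toHom (leftSlice ω t) - π.toHom c * y‖ < δ at hty
    have hdec : c * leftSlice ω t - c * leftSlice ω t₀ =
        c * leftSlice (ω - ω ∘L ContinuousLinearMap.mul ℂ A e) t +
          leftSlice ω (mulTensor e c t - (LinearMap.mulLeft ℂ c).lTensor A t₀) := by
      have h1 : leftSlice (ω - ω ∘L ContinuousLinearMap.mul ℂ A e) t =
          leftSlice ω t - leftSlice (ω ∘L ContinuousLinearMap.mul ℂ A e) t := by
        simp [leftSlice, LinearMap.rTensor_sub]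
      rw [h1, map_sub, ← mul_leftSlice, ← mul_leftSlice_comp, mul_sub]
      abel
    have hn1 : ‖c * leftSlice (ω - ω ∘L ContinuousLinearMap.mul ℂ A e) t‖ ≤ δ * (‖T‖ + 1) := by
      refine (norm_mul_le _ _).trans ?_
      rw [π.norm_map] at hcn
      refine (mul_le_of_le_one_left (norm_nonneg _) hcn).trans ?_
      exact (norm_leftSlice_le π _ _).trans (mul_le_mul hJ htn (norm_nonneg _) hδ0.le)
    have hn2 : ‖leftSlice ω (mulTensor e c t - (LinearMap.mulLeft ℂ c).lTensor A t₀)‖ ≤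
        ‖ω‖ * (2 * δ) := by
      refine (norm_leftSlice_le π _ _).trans (mul_le_mul_of_nonneg_left ?_ (norm_nonneg _))
      rw [map_sub, algTensor_mulTensor, algTensor_lTensor_mulLeft]
      have h2 : opTensor (π.toHom e) (π.toHom c) * algTensor π.lin π.lin t -
          opTensor 1 (π.toHom c) * algTensor π.lin π.lin t₀ =
          (opTensor (π.toHom e) (π.toHom c) * algTensor π.lin π.lin t -
            opTensor (π.toHom e) (π.toHom c) * T) +
          opTensor 1 (π.toHom c) *
            (opTensor (π.toHom e) 1 * T - algTensor π.lin π.lin t₀) := by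
        rw [mul_sub, ← mul_assoc (opTensor 1 (π.toHom c)), opTensor_mul, one_mul, mul_one]
        abel
      rw [h2]
      refine (norm_add_le _ _).trans ?_
      have h3 : ‖opTensor (1 : K →L[ℂ] K) (π.toHom c)‖ ≤ 1 :=
        (norm_opTensor_le _ _).trans (mul_le_one₀ ContinuousLinearMap.norm_id_le
          (norm_nonneg _) hcn)
      have h4 := (norm_mul_le (opTensor (1 : K →L[ℂ] K) (π.toHom c))
        (opTensor (π.toHom e) 1 * T - algTensor π.lin π.lin t₀)).trans
        (mul_le_of_le_one_left (norm_nonneg _) h3)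
      linarith
    have hfin : π.toHom c * (y - π.toHom (leftSlice ω t₀)) =
        -(π.toHom c * π.toHom (leftSlice ω t) - π.toHom c * y) +
          π.toHom (c * leftSlice ω t - c * leftSlice ω t₀) := by
      rw [map_sub, map_mul, map_mul, mul_sub]; abel
    rw [hfin, hdec]
    refine (norm_add_le _ _).trans ?_
    rw [norm_neg, π.norm_map]
    have := norm_add_le (c * leftSlice (ω - ω ∘L ContinuousLinearMap.mul ℂ A e) t)
      (leftSlice ω (mulTensor e c t - (LinearMap.mulLeft ℂ c).lTensor A t₀))
    linarith
  · have h5 : δ * (2 * (‖T‖ + 1 + 2 * ‖ω‖ + 1)) = ε := by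
      rw [hδ]; field_simp
    nlinarith

/-- A strict limit of slices `(id ⊗ ω)(t)`, `t → Δ(a)`, lies in `A` and not only in `M(A)`. -/
lemma IsRightSlice.mem_image {ω : A →L[ℂ] ℂ} {a : A} {y : K →L[ℂ] K}
    (h : G.IsRightSlice ω (G.comul a) y) : y ∈ π.image := by
  suffices y ∈ closure (π.image : Set (K →L[ℂ] K)) by rwa [π.isClosed_image.closure_eq] at this
  rw [Metric.mem_closure_iff]
  intro ε hε
  set T := G.comul a with hT
  set δ := ε / (2 * (‖T‖ + 1 + 2 * ‖ω‖ + 1)) with hδ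
  have hδ0 : 0 < δ := by positivity
  obtain ⟨J, hJ⟩ := G.exists_norm_sub_comp_part_le ω hδ0
  set e := G.part J with he
  -- The functional `ω(e ·)` has its slice of `T` in `A`, because `(1 ⊗ e)Δ(a)` lies in `A ⊗ A`.
  have hR : opTensor 1 (π.toHom e) * T ∈ π.tensor2 := G.one_tensor_mul_comul_mem e a
  obtain ⟨_, ⟨t₀, rfl⟩, ht₀⟩ := Metric.mem_closure_iff.1
    (minTensor_subset_closure_range π.lin π.lin hR) δ hδ0
  refine ⟨π.toHom (rightSlice ω t₀), π.mem_image _, ?_⟩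
  rw [dist_eq_norm]
  refine lt_of_le_of_lt (b := δ * (‖T‖ + 1) + ‖ω‖ * (2 * δ) + δ) ?_ ?_
  · refine G.norm_le_of_forall_mul_le fun J' => ?_
    set c := G.part J' with hc
    have hcn : ‖π.toHom c‖ ≤ 1 := G.norm_map_part_le J'
    have hfreq := G.isApproxUnit_tensor2.frequently_comap π.mul_mem_tensor2
      (algTensor π.lin π.lin) (minTensor_subset_closure_range π.lin π.lin) (G.comul_mem a)
    have hy := ((tendsto_strictNhds.1 h.2) _ (π.mem_image c)).2
    have hy' := Metric.tendsto_nhds.1 hy δ hδ0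
    have ht := ((tendsto_strictNhds.1 (tendsto_comap_strictNhds (algTensor π.lin π.lin)
      π.tensor2 T)) _ (π.tensor_mem c e)).2
    have ht' := Metric.tendsto_nhds.1 ht δ hδ0
    obtain ⟨t, htn, hty, htT⟩ := (hfreq.and_eventually (hy'.and ht')).exists
    rw [dist_eq_norm] at hty htT ht₀
    change ‖π.toHom c * π.toHom (rightSlice ω t) - π.toHom c * y‖ < δ at hty
    have hdec : c * rightSlice ω t - c * rightSlice ω t₀ =
        c * rightSlice (ω - ω ∘L ContinuousLinearMap.mul ℂ A e) t +
          rightSlice ω (mulTensor c e t - (LinearMap.mulLeft ℂ c).rTensor A t₀) := by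
      have h1 : rightSlice (ω - ω ∘L ContinuousLinearMap.mul ℂ A e) t =
          rightSlice ω t - rightSlice (ω ∘L ContinuousLinearMap.mul ℂ A e) t := by
        simp [rightSlice, LinearMap.lTensor_sub]
      rw [h1, map_sub, ← mul_rightSlice, ← mul_rightSlice_comp, mul_sub]
      abel
    have hn1 : ‖c * rightSlice (ω - ω ∘L ContinuousLinearMap.mul ℂ A e) t‖ ≤ δ * (‖T‖ + 1) := by
      refine (norm_mul_le _ _).trans ?_
      rw [π.norm_map] at hcn
      refine (mul_le_of_le_one_left (norm_nonneg _) hcn).trans ?_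
      exact (norm_rightSlice_le π _ _).trans (mul_le_mul hJ htn (norm_nonneg _) hδ0.le)
    have hn2 : ‖rightSlice ω (mulTensor c e t - (LinearMap.mulLeft ℂ c).rTensor A t₀)‖ ≤
        ‖ω‖ * (2 * δ) := by
      refine (norm_rightSlice_le π _ _).trans (mul_le_mul_of_nonneg_left ?_ (norm_nonneg _))
      rw [map_sub, algTensor_mulTensor, algTensor_rTensor_mulLeft]
      have h2 : opTensor (π.toHom c) (π.toHom e) * algTensor π.lin π.lin t -
          opTensor (π.toHom c) 1 * algTensor π.lin π.lin t₀ =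
          (opTensor (π.toHom c) (π.toHom e) * algTensor π.lin π.lin t -
            opTensor (π.toHom c) (π.toHom e) * T) +
          opTensor (π.toHom c) 1 *
            (opTensor 1 (π.toHom e) * T - algTensor π.lin π.lin t₀) := by
        rw [mul_sub, ← mul_assoc (opTensor (π.toHom c) 1), opTensor_mul, one_mul, mul_one]
        abel
      rw [h2]
      refine (norm_add_le _ _).trans ?_
      have h3 : ‖opTensor (π.toHom c) (1 : K →L[ℂ] K)‖ ≤ 1 :=
        (norm_opTensor_le _ _).trans (mul_le_one₀ hcn (norm_nonneg _)
          ContinuousLinearMap.norm_id_le)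
      have h4 := (norm_mul_le (opTensor (π.toHom c) (1 : K →L[ℂ] K))
        (opTensor 1 (π.toHom e) * T - algTensor π.lin π.lin t₀)).trans
        (mul_le_of_le_one_left (norm_nonneg _) h3)
      linarith
    have hfin : π.toHom c * (y - π.toHom (rightSlice ω t₀)) =
        -(π.toHom c * π.toHom (rightSlice ω t) - π.toHom c * y) +
          π.toHom (c * rightSlice ω t - c * rightSlice ω t₀) := by
      rw [map_sub, map_mul, map_mul, mul_sub]; abel
    rw [hfin, hdec]
    refine (norm_add_le _ _).trans ?_
    rw [norm_neg, π.norm_map]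
    have := norm_add_le (c * rightSlice (ω - ω ∘L ContinuousLinearMap.mul ℂ A e) t)
      (rightSlice ω (mulTensor c e t - (LinearMap.mulLeft ℂ c).rTensor A t₀))
    linarith
  · have h5 : δ * (2 * (‖T‖ + 1 + 2 * ‖ω‖ + 1)) = ε := by
      rw [hδ]; field_simp
    nlinarith

end PartialCompactQuantumSemigroup

/-! ### Slices by vector functionals -/

section Sandwich

variable {E F : Type*} [NormedAddCommGroup E] [InnerProductSpace ℂ E]
  [NormedAddCommGroup F] [InnerProductSpace ℂ F]

/-- The bounded linear map `R ↦ P R Q`. -/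
def sandwich (P : F →L[ℂ] E) (Q : E →L[ℂ] F) : (F →L[ℂ] F) →L[ℂ] (E →L[ℂ] E) :=
  (ContinuousLinearMap.compL ℂ E F E P) ∘L ((ContinuousLinearMap.compL ℂ E F F).flip Q)

@[simp] lemma sandwich_apply (P : F →L[ℂ] E) (Q : E →L[ℂ] F) (R : F →L[ℂ] F) :
    sandwich P Q R = P ∘L R ∘L Q := rfl

end Sandwich

namespace PartialCompactQuantumSemigroup

variable {I A K : Type*} [NonUnitalCStarAlgebra A] [NormedAddCommGroup K] [InnerProductSpace ℂ K]
  [CompleteSpace K] {π : FaithfulRep A K} (G : PartialCompactQuantumSemigroup I π)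

/-- Slices by vector functionals exist on all of `M(A ⊗ A)` and are given by compressions. -/
lemma isLeftSlice_vecFun {T : HilbertTensor K K →L[ℂ] HilbertTensor K K}
    (hT : T ∈ multipliers π.tensor2) {a a' : A} {ξ η : K} (hξ : π.toHom a ξ = ξ)
    (hη : π.toHom a' η = η) :
    G.IsLeftSlice (vecFun π ξ η) T
      ((creationL ξ : K →L[ℂ] HilbertTensor K K).adjoint ∘L T ∘L creationL η) := by
  set L := sandwich (creationL ξ : K →L[ℂ] HilbertTensor K K).adjoint (creationL η) with hL
  have hr : ∀ (R : HilbertTensor K K →L[ℂ] HilbertTensor K K) (c : A),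
      L R * π.toHom c = L (R * opTensor (π.toHom a') (π.toHom c)) := fun R c => by
    ext v; simp [hL, hη]
  have hl : ∀ (R : HilbertTensor K K →L[ℂ] HilbertTensor K K) (c : A),
      π.toHom c * L R = L (opTensor (π.toHom (star a)) (π.toHom c) * R) := fun R c => by
    have := adjoint_creationL_comp_opTensor (π.toHom (star a)) (π.toHom c) ξ
    rw [← map_star, star_star, hξ] at this
    ext v
    simpa [hL] using (congrArg (fun f => f (R (tm η v))) this).symm
  have hmem : ∀ R ∈ π.tensor2, L R ∈ π.image := fun R hR =>
    map_mem_of_mem_minTensor L π.isClosed_image (fun v w => by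
      have h1 := toHom_leftSlice_vecFun π ξ η (v ⊗ₜ w)
      rw [algTensor_tmul] at h1
      rw [hL, sandwich_apply, ← h1]
      exact π.mem_image _) hR
  refine ⟨?_, ?_⟩
  · rintro _ ⟨c, rfl⟩
    exact ⟨hr T c ▸ hmem _ (hT _ (π.tensor_mem _ _)).1,
      hl T c ▸ hmem _ (hT _ (π.tensor_mem _ _)).2⟩
  · have h1 : ∀ t, π.toHom (TensorProduct.lid ℂ A
        ((vecFun π ξ η : A →ₗ[ℂ] ℂ).rTensor A t)) = L (algTensor π.lin π.lin t) :=
      toHom_leftSlice_vecFun π ξ η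
    simp only [h1]
    rw [tendsto_strictNhds]
    rintro _ ⟨c, rfl⟩
    have h2 := tendsto_strictNhds.1
      (tendsto_comap_strictNhds (algTensor π.lin π.lin) π.tensor2 T)
    constructor
    · change Tendsto (fun t => L (algTensor π.lin π.lin t) * π.toHom c) _
        (𝓝 (L T * π.toHom c))
      simp only [hr]
      exact (L.continuous.tendsto _).comp (h2 _ (π.tensor_mem _ _)).1
    · change Tendsto (fun t => π.toHom c * L (algTensor π.lin π.lin t)) _
        (𝓝 (π.toHom c * L T))
      simp only [hl]
      exact (L.continuous.tendsto _).comp (h2 _ (π.tensor_mem _ _)).2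

lemma isRightSlice_vecFun {T : HilbertTensor K K →L[ℂ] HilbertTensor K K}
    (hT : T ∈ multipliers π.tensor2) {a a' : A} {ξ η : K} (hξ : π.toHom a ξ = ξ)
    (hη : π.toHom a' η = η) :
    G.IsRightSlice (vecFun π ξ η) T
      ((creation ξ : K →L[ℂ] HilbertTensor K K).adjoint ∘L T ∘L creation η) := by
  set L := sandwich (creation ξ : K →L[ℂ] HilbertTensor K K).adjoint (creation η) with hL
  have hr : ∀ (R : HilbertTensor K K →L[ℂ] HilbertTensor K K) (c : A),
      L R * π.toHom c = L (R * opTensor (π.toHom c) (π.toHom a')) := fun R c => by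
    ext v; simp [hL, hη]
  have hl : ∀ (R : HilbertTensor K K →L[ℂ] HilbertTensor K K) (c : A),
      π.toHom c * L R = L (opTensor (π.toHom c) (π.toHom (star a)) * R) := fun R c => by
    have := adjoint_creation_comp_opTensor (π.toHom c) (π.toHom (star a)) ξ
    rw [← map_star, star_star, hξ] at this
    ext v
    simpa [hL] using (congrArg (fun f => f (R (tm v η))) this).symm
  have hmem : ∀ R ∈ π.tensor2, L R ∈ π.image := fun R hR =>
    map_mem_of_mem_minTensor L π.isClosed_image (fun v w => by
      have h1 := toHom_rightSlice_vecFun π ξ η (v ⊗ₜ w)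
      rw [algTensor_tmul] at h1
      rw [hL, sandwich_apply, ← h1]
      exact π.mem_image _) hR
  refine ⟨?_, ?_⟩
  · rintro _ ⟨c, rfl⟩
    exact ⟨hr T c ▸ hmem _ (hT _ (π.tensor_mem _ _)).1,
      hl T c ▸ hmem _ (hT _ (π.tensor_mem _ _)).2⟩
  · have h1 : ∀ t, π.toHom (TensorProduct.rid ℂ A
        ((vecFun π ξ η : A →ₗ[ℂ] ℂ).lTensor A t)) = L (algTensor π.lin π.lin t) :=
      toHom_rightSlice_vecFun π ξ η
    simp only [h1]
    rw [tendsto_strictNhds]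
    rintro _ ⟨c, rfl⟩
    have h2 := tendsto_strictNhds.1
      (tendsto_comap_strictNhds (algTensor π.lin π.lin) π.tensor2 T)
    constructor
    · change Tendsto (fun t => L (algTensor π.lin π.lin t) * π.toHom c) _
        (𝓝 (L T * π.toHom c))
      simp only [hr]
      exact (L.continuous.tendsto _).comp (h2 _ (π.tensor_mem _ _)).1
    · change Tendsto (fun t => π.toHom c * L (algTensor π.lin π.lin t)) _
        (𝓝 (π.toHom c * L T))
      simp only [hl]
      exact (L.continuous.tendsto _).comp (h2 _ (π.tensor_mem _ _)).2

end PartialCompactQuantumSemigroup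

/-! ### Matrix coefficients are slices of the comultiplication of the corner -/

/-- If the linear map `v ↦ ∑ v_b x_b` kills the orthogonal complement of a set `s` of vectors and
maps `s` to `N`, then all `x_b` lie in `N`. -/
lemma mem_of_forall_orthogonal {B A : Type*} [Fintype B] [AddCommGroup A] [Module ℂ A]
    (x : B → A) (s : Set (B → ℂ)) (N : Submodule ℂ A) (h1 : ∀ w ∈ s, ∑ b, w b • x b ∈ N)
    (h2 : ∀ v : B → ℂ, (∀ w ∈ s, ∑ b, v b * w b = 0) → ∑ b, star (v b) • x b = 0) (b : B) :
    x b ∈ N := by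
  classical
  let T : EuclideanSpace ℂ B →ₗ[ℂ] A :=
    { toFun := fun v => ∑ b, v b • x b
      map_add' := fun v w => by simp [add_smul, Finset.sum_add_distrib]
      map_smul' := fun c v => by simp [mul_smul, Finset.smul_sum] }
  let W : Submodule ℂ (EuclideanSpace ℂ B) := Submodule.span ℂ ((WithLp.toLp 2) '' s)
  have hW : ∀ w ∈ W, T w ∈ N := by
    intro w hw
    have : W ≤ N.comap T := Submodule.span_le.2 (by
      rintro _ ⟨w, hw, rfl⟩
      exact h1 w hw)
    exact this hw
  have hW' : ∀ w ∈ Wᗮ, T w = 0 := by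
    intro w hw
    have := h2 (fun b => star (w b)) fun u hu => by
      have h3 := (Submodule.mem_orthogonal' _ _).1 hw (WithLp.toLp 2 u)
        (Submodule.subset_span ⟨u, hu, rfl⟩)
      simpa [PiLp.inner_apply, mul_comm] using h3
    simpa [T] using this
  obtain ⟨w, hw, w', hw', hsum⟩ :=
    Submodule.exists_add_mem_mem_orthogonal (K := W) (EuclideanSpace.single b (1 : ℂ))
  have h4 : T (EuclideanSpace.single b (1 : ℂ)) = x b := by
    simp [T, Finset.sum_ite_eq']
  rw [← h4, hsum, map_add, hW' w' hw', add_zero]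
  exact hW w hw

namespace MatrixCorep

variable {I : Type u} {A K : Type*} [NonUnitalCStarAlgebra A] [NormedAddCommGroup K]
  [InnerProductSpace ℂ K] [CompleteSpace K] {π : FaithfulRep A K}
  {G : PartialCompactQuantumSemigroup I π} {𝒜 : NonUnitalSubalgebra ℂ A} {S : 𝒜 →ₗ[ℂ] 𝒜}

lemma diag_mul_unitOp (k : I) : G.diag * G.unitOp k k = G.unitOp k k :=
  projSum_mul_self (fun k => G.unitOp k k) k

lemma unitOp_mul_diag (k : I) : G.unitOp k k * G.diag = G.unitOp k k := by
  have h : star G.diag = G.diag := star_projSum _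
  simpa [h] using congrArg star (diag_mul_unitOp (G := G) k)

lemma coef_self_mem_corner (M : MatrixCorep G 𝒜 S) (b : M.index) :
    M.coef b b ∈ G.corner := by
  refine ⟨M.coef b b, ?_⟩
  have h1 := M.toHom_unit_mul b b
  have h2 := M.toHom_mul_unit b b
  have h3 : G.diag * π.toHom (M.coef b b) = π.toHom (M.coef b b) := by
    rw [← h1, ← mul_assoc, diag_mul_unitOp]
  rw [h3, ← h2, mul_assoc, unitOp_mul_diag]

/-- An element `y = 1(p,q) y` of `A` vanishes if its matrix elements with respect to vectors of
the components `1(p,q) K` and `1(m,n) K` do. -/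
lemma eq_zero_of_inner_unitOp {p q : I} {y : A} (hy : G.unitOp p q * π.toHom y = π.toHom y)
    (h : ∀ (m n : I) (ξ η : K), G.unitOp p q ξ = ξ → G.unitOp m n η = η →
      vecFun π ξ η y = 0) : y = 0 := by
  have h1 : ∀ m n, π.toHom y * G.unitOp m n = 0 := by
    intro m n
    rw [← hy]
    ext η
    refine ext_inner_left ℂ fun ξ => ?_
    have := h m n (G.unitOp p q ξ) (G.unitOp m n η)
      (by rw [← mul_apply_eq_comp, G.unitOp_mul_self])
      (by rw [← mul_apply_eq_comp, G.unitOp_mul_self])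
    rw [vecFun_apply] at this
    nth_rw 1 [← G.star_unitOp p q] at this
    rw [ContinuousLinearMap.star_eq_adjoint, ContinuousLinearMap.adjoint_inner_left] at this
    simpa using this
  have h2 := G.tendsto_mul_part_op y
  simp only [G.map_part, Finset.mul_sum, h1, Finset.sum_const_zero] at h2
  exact π.injective (by rw [map_zero]; exact tendsto_nhds_unique h2 tendsto_const_nhds)

variable (G) in
/-- The span of the slices `(ω ⊗ id)Δ(a)` for `a` in the corner. -/
def leftSlices : Submodule ℂ (K →L[ℂ] K) :=
  Submodule.span ℂ {y | ∃ ω : A →L[ℂ] ℂ, ∃ a ∈ G.corner, G.IsLeftSlice ω (G.comul a) y}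

variable (G) in
/-- The span of the slices `(id ⊗ ω)Δ(a)` for `a` in the corner. -/
def rightSlices : Submodule ℂ (K →L[ℂ] K) :=
  Submodule.span ℂ {y | ∃ ω : A →L[ℂ] ℂ, ∃ a ∈ G.corner, G.IsRightSlice ω (G.comul a) y}

lemma sum_smul_coef_unit (M : MatrixCorep G 𝒜 S) (k : I) (c : M.index) (v : M.row k → ℂ) :
    G.unitOp (M.src c) k * π.toHom (∑ b, v b • M.coef c b) =
      π.toHom (∑ b, v b • M.coef c b) := by
  rw [map_sum, Finset.mul_sum]
  refine Finset.sum_congr rfl fun b _ => ?_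
  have := M.toHom_unit_mul c b
  rw [(mem_row M).1 b.2] at this
  rw [map_smul, mul_smul_comm, this]

/-- The coefficient `x(b,c)` is obtained by slicing `Δ(x(c,c))`: on the first leg occur the
coefficients `x(c,b)`, and a linear relation between these implies, by the antipode, the adjoint
relation between the `x(b,c)`. -/
lemma coef_mem_leftSlices (hspan : ∀ a ∈ 𝒜, a ∈ Submodule.span ℂ (coefs G 𝒜 S))
    (M : MatrixCorep G 𝒜 S) (b c : M.index) : π.toHom (M.coef b c) ∈ leftSlices G := by
  refine mem_of_forall_orthogonal (B := M.row (M.src b)) (fun d => M.coef d c)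
    {w | ∃ (m n : I) (ξ η : K), G.unitOp (M.src c) (M.src b) ξ = ξ ∧ G.unitOp m n η = η ∧
      w = fun d => vecFun π ξ η (M.coef c d.1)} ((leftSlices G).comap π.lin) ?_ ?_
    ⟨b, by simp⟩
  · rintro _ ⟨m, n, ξ, η, hξ, hη, rfl⟩
    refine Submodule.subset_span ⟨vecFun π ξ η, M.coef c c, M.coef_self_mem_corner c, ?_⟩
    convert G.isLeftSlice_vecFun (G.comul_mem (M.coef c c)) hξ hη using 1
    have h1 : (creationL ξ : K →L[ℂ] HilbertTensor K K).adjoint ∘L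
        opTensor (G.unitOp (M.src c) (M.src b)) 1 =
        (creationL ξ : K →L[ℂ] HilbertTensor K K).adjoint := by
      rw [adjoint_creationL_comp_opTensor, G.star_unitOp, hξ]; rfl
    rw [← h1, ContinuousLinearMap.comp_assoc, ← ContinuousLinearMap.comp_assoc (opTensor _ _)]
    have h2 := M.leftCut (M.src b) c c
    rw [ContinuousLinearMap.mul_def] at h2
    rw [h2]
    ext v
    simp only [FaithfulRep.lin_apply, map_sum, map_smul, sum_apply,
      ContinuousLinearMap.comp_apply, creationL_apply, opTensor_tm, adjoint_creationL_tm,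
      smul_apply, vecFun_apply]
    exact Finset.sum_coe_sort (M.row (M.src b)) fun d =>
      (inner ℂ ξ (π.toHom (M.coef c d) η) : ℂ) • π.toHom (M.coef d c) v
  · intro v hv
    have h1 : ∑ d, v d • M.coef c d = 0 := by
      refine eq_zero_of_inner_unitOp (G := G) (M.sum_smul_coef_unit (M.src b) c v)
        fun m n ξ η hξ hη => ?_
      simpa using hv _ ⟨m, n, ξ, η, hξ, hη, rfl⟩
    have h2 : ∑ d : M.row (M.src b), star (v d) • (⟨_, M.coef_mem d c⟩ : 𝒜) = 0 := by
      apply antipode_injective hspan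
      apply Subtype.ext
      have h3 := congrArg star h1
      simp only [star_sum, star_smul, star_zero] at h3
      simp only [map_sum, map_smul, map_zero, AddSubmonoidClass.coe_finsetSum,
        NonUnitalSubalgebra.coe_smul, M.antipode, h3]
      rfl
    simpa using congrArg Subtype.val h2

/-- The coefficient `x(b,c)` is obtained by slicing `Δ(x(b,b))` on the second leg. -/
lemma coef_mem_rightSlices (M : MatrixCorep G 𝒜 S) (b c : M.index) :
    π.toHom (M.coef b c) ∈ rightSlices G := by
  refine mem_of_forall_orthogonal (B := M.row (M.src c)) (fun d => M.coef b d)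
    {w | ∃ (m n : I) (ξ η : K), G.unitOp (M.src c) (M.src b) ξ = ξ ∧ G.unitOp m n η = η ∧
      w = fun d => vecFun π ξ η (M.coef d.1 b)} ((rightSlices G).comap π.lin) ?_ ?_
    ⟨c, by simp⟩
  · rintro _ ⟨m, n, ξ, η, hξ, hη, rfl⟩
    refine Submodule.subset_span ⟨vecFun π ξ η, M.coef b b, M.coef_self_mem_corner b, ?_⟩
    convert G.isRightSlice_vecFun (G.comul_mem (M.coef b b)) hξ hη using 1
    have h1 : (creation ξ : K →L[ℂ] HilbertTensor K K).adjoint ∘L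
        opTensor 1 (G.unitOp (M.src c) (M.src b)) =
        (creation ξ : K →L[ℂ] HilbertTensor K K).adjoint := by
      rw [adjoint_creation_comp_opTensor, G.star_unitOp, hξ]; rfl
    rw [← h1, ContinuousLinearMap.comp_assoc, ← ContinuousLinearMap.comp_assoc (opTensor _ _)]
    have h2 := M.rightCut (M.src c) b b
    rw [ContinuousLinearMap.mul_def] at h2
    rw [h2]
    ext v
    simp only [FaithfulRep.lin_apply, map_sum, map_smul, sum_apply,
      ContinuousLinearMap.comp_apply, creation_apply, opTensor_tm, adjoint_creation_tm,
      smul_apply, vecFun_apply]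
    exact Finset.sum_coe_sort (M.row (M.src c)) fun d =>
      (inner ℂ ξ (π.toHom (M.coef d b) η) : ℂ) • π.toHom (M.coef b d) v
  · intro v hv
    have h1 : ∑ d : M.row (M.src c), v d • M.coef d b = 0 := by
      refine eq_zero_of_inner_unitOp (G := G) (p := M.src c) (q := M.src b) ?_
        fun m n ξ η hξ hη => ?_
      · rw [map_sum, Finset.mul_sum]
        refine Finset.sum_congr rfl fun d _ => ?_
        have := M.toHom_unit_mul d b
        rw [(mem_row M).1 d.2] at this
        rw [map_smul, mul_smul_comm, this]
      · simpa using hv _ ⟨m, n, ξ, η, hξ, hη, rfl⟩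
    have h2 : ∑ d : M.row (M.src c), v d • (⟨_, M.coef_mem d b⟩ : 𝒜) = 0 :=
      Subtype.ext (by simpa using h1)
    have h3 := congrArg (fun a : 𝒜 => star (S a : A)) h2
    simp only [map_sum, map_smul, map_zero, AddSubmonoidClass.coe_finsetSum,
      NonUnitalSubalgebra.coe_smul, M.antipode, star_sum, star_smul, star_star] at h3
    exact h3.trans (star_zero _)

end MatrixCorep

/-! ### The density conditions -/

namespace MatrixCorep

variable {I : Type u} {A K : Type*} [NonUnitalCStarAlgebra A] [NormedAddCommGroup K]
  [InnerProductSpace ℂ K] [CompleteSpace K] {π : FaithfulRep A K}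
  {G : PartialCompactQuantumSemigroup I π} {𝒜 : NonUnitalSubalgebra ℂ A} {S : 𝒜 →ₗ[ℂ] 𝒜}

/-- A closed subspace containing the images of all matrix coefficients under a bounded linear map
contains the images of all elements. -/
lemma map_mem_of_coefs {Z : Type*} [AddCommGroup Z] [Module ℂ Z] [TopologicalSpace Z]
    (hspan : ∀ a ∈ 𝒜, a ∈ Submodule.span ℂ (coefs G 𝒜 S)) (hdense : Dense (𝒜 : Set A))
    (L : A →ₗ[ℂ] Z) (hL : Continuous L) {N : Submodule ℂ Z} (hN : IsClosed (N : Set Z))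
    (h : ∀ (M : MatrixCorep G 𝒜 S) (b c : M.index), L (M.coef b c) ∈ N) (a : A) : L a ∈ N := by
  have h1 : Submodule.span ℂ (coefs G 𝒜 S) ≤ N.comap L := Submodule.span_le.2 (by
    rintro _ ⟨M, b, c, rfl⟩
    exact h M b c)
  exact hdense.induction (P := fun a => L a ∈ N) (fun a ha => h1 (hspan a ha))
    (hN.preimage hL) a

/-- The span of `(A ⊗ 1)Δ(A)`. -/
def leftProducts (G : PartialCompactQuantumSemigroup I π) :
    Submodule ℂ (HilbertTensor K K →L[ℂ] HilbertTensor K K) :=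
  Submodule.span ℂ {opTensor (π.toHom a) 1 * G.comul b | (a : A) (b : A)}

/-- The span of `(1 ⊗ A)Δ(A)`. -/
def rightProducts (G : PartialCompactQuantumSemigroup I π) :
    Submodule ℂ (HilbertTensor K K →L[ℂ] HilbertTensor K K) :=
  Submodule.span ℂ {opTensor 1 (π.toHom a) * G.comul b | (a : A) (b : A)}

/-- Both products are contained in `(A ⊗ A)Δ(1)`; together with the reverse inclusion for
elementary tensors this gives the equality with the closed span. -/
lemma eq_closure_of_products (N : Submodule ℂ (HilbertTensor K K →L[ℂ] HilbertTensor K K))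
    (h1 : ∀ z ∈ N, z ∈ π.tensor2 ∧ z * G.comulOne = z)
    (h2 : ∀ a a', opTensor (π.toHom a) (π.toHom a') * G.comulOne ∈ N.topologicalClosure) :
    {t * G.comulOne | t ∈ π.tensor2} =
      closure (N : Set (HilbertTensor K K →L[ℂ] HilbertTensor K K)) := by
  apply Set.Subset.antisymm
  · rintro _ ⟨t, ht, rfl⟩
    exact map_mem_of_mem_minTensor ((ContinuousLinearMap.mul ℂ _).flip G.comulOne)
      (Submodule.isClosed_topologicalClosure N) h2 ht
  · intro z hz
    have hc : IsClosed {z | z ∈ π.tensor2 ∧ z * G.comulOne = z} :=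
      π.isClosed_tensor2.inter (isClosed_eq (by fun_prop) (by fun_prop))
    obtain ⟨h3, h4⟩ := closure_minimal (t := {z | z ∈ π.tensor2 ∧ z * G.comulOne = z}) h1 hc hz
    exact ⟨z, h3, h4⟩

lemma leftProducts_le : ∀ z ∈ leftProducts G, z ∈ π.tensor2 ∧ z * G.comulOne = z := by
  intro z hz
  induction hz using Submodule.span_induction with
  | mem z h =>
    obtain ⟨a, b, rfl⟩ := h
    exact ⟨G.tensor_one_mul_comul_mem a b, by rw [mul_assoc, G.comul_mul_comulOne]⟩
  | zero => exact ⟨zero_mem _, zero_mul _⟩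
  | add x y _ _ hx hy => exact ⟨add_mem hx.1 hy.1, by rw [add_mul, hx.2, hy.2]⟩
  | smul c x _ hx => exact ⟨Submodule.smul_mem _ _ hx.1, by rw [smul_mul_assoc, hx.2]⟩

lemma rightProducts_le : ∀ z ∈ rightProducts G, z ∈ π.tensor2 ∧ z * G.comulOne = z := by
  intro z hz
  induction hz using Submodule.span_induction with
  | mem z h =>
    obtain ⟨a, b, rfl⟩ := h
    exact ⟨G.one_tensor_mul_comul_mem a b, by rw [mul_assoc, G.comul_mul_comulOne]⟩
  | zero => exact ⟨zero_mem _, zero_mul _⟩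
  | add x y _ _ hx hy => exact ⟨add_mem hx.1 hy.1, by rw [add_mul, hx.2, hy.2]⟩
  | smul c x _ hx => exact ⟨Submodule.smul_mem _ _ hx.1, by rw [smul_mul_assoc, hx.2]⟩

lemma tensor_one_mul_mem_leftProducts (a : A)
    {z : HilbertTensor K K →L[ℂ] HilbertTensor K K} (hz : z ∈ leftProducts G) :
    opTensor (π.toHom a) 1 * z ∈ leftProducts G := by
  induction hz using Submodule.span_induction with
  | mem z h =>
    obtain ⟨a', b, rfl⟩ := h
    refine Submodule.subset_span ⟨a * a', b, ?_⟩
    rw [← mul_assoc, opTensor_mul, map_mul, one_mul]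
  | zero => rw [mul_zero]; exact zero_mem _
  | add x y _ _ hx hy => rw [mul_add]; exact add_mem hx hy
  | smul c x _ hx => rw [mul_smul_comm]; exact Submodule.smul_mem _ _ hx

lemma one_tensor_mul_mem_rightProducts (a : A)
    {z : HilbertTensor K K →L[ℂ] HilbertTensor K K} (hz : z ∈ rightProducts G) :
    opTensor 1 (π.toHom a) * z ∈ rightProducts G := by
  induction hz using Submodule.span_induction with
  | mem z h =>
    obtain ⟨a', b, rfl⟩ := h
    refine Submodule.subset_span ⟨a * a', b, ?_⟩
    rw [← mul_assoc, opTensor_mul, map_mul, one_mul]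
  | zero => rw [mul_zero]; exact zero_mem _
  | add x y _ _ hx hy => rw [mul_add]; exact add_mem hx hy
  | smul c x _ hx => rw [mul_smul_comm]; exact Submodule.smul_mem _ _ hx

lemma tensor_coef_mem_leftProducts (M : MatrixCorep G 𝒜 S) (p q : I) (b c : M.index) :
    opTensor (G.unitOp p q) (π.toHom (M.coef b c)) * G.comulOne ∈ leftProducts G := by
  have h1 : opTensor (G.unitOp p q) (π.toHom (M.coef b c)) =
      opTensor 1 (π.toHom (M.coef b c)) * opTensor (G.unitOp p q)
        (G.unitOp (M.tgt b) (M.tgt c)) := by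
    rw [opTensor_mul, one_mul, M.toHom_mul_unit]
  by_cases h : q = M.tgt b
  · rw [h1, mul_assoc, h, G.tensor_mul_comulOne, opTensor_mul, one_mul, M.toHom_mul_unit,
      ← M.sum_star_tensor_one_mul_comul]
    exact sum_mem fun d _ => Submodule.subset_span ⟨_, _, rfl⟩
  · rw [h1, mul_assoc, G.tensor_mul_comulOne_of_ne _ _ h, mul_zero]
    exact zero_mem _

lemma coef_tensor_mem_rightProducts (hS : ∀ a b, S (a * b) = S b * S a)
    (hmem : ∀ k l, G.unit k l ∈ 𝒜)
    (hunit : ∀ k l, (S ⟨G.unit k l, hmem k l⟩ : A) = G.unit l k)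
    (hspan : ∀ a ∈ 𝒜, a ∈ Submodule.span ℂ (coefs G 𝒜 S))
    (M : MatrixCorep G 𝒜 S) (p q : I) (b c : M.index) :
    opTensor (π.toHom (M.coef b c)) (G.unitOp p q) * G.comulOne ∈ rightProducts G := by
  have h1 : opTensor (π.toHom (M.coef b c)) (G.unitOp p q) =
      opTensor (π.toHom (M.coef b c)) 1 * opTensor (G.unitOp (M.tgt b) (M.tgt c))
        (G.unitOp p q) := by
    rw [opTensor_mul, one_mul, M.toHom_mul_unit]
  by_cases h : M.tgt c = p
  · obtain ⟨y, hy⟩ := M.exists_sum_one_tensor_mul_comul hS hmem hunit hspan q b c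
    rw [h1, mul_assoc, ← h, G.tensor_mul_comulOne, opTensor_mul, one_mul, M.toHom_mul_unit, ← hy]
    exact sum_mem fun d _ => Submodule.subset_span ⟨_, _, rfl⟩
  · rw [h1, mul_assoc, G.tensor_mul_comulOne_of_ne _ _ h, mul_zero]
    exact zero_mem _

lemma tensor_mul_comulOne_mem_left (hspan : ∀ a ∈ 𝒜, a ∈ Submodule.span ℂ (coefs G 𝒜 S))
    (hdense : Dense (𝒜 : Set A)) (a a' : A) :
    opTensor (π.toHom a) (π.toHom a') * G.comulOne ∈ (leftProducts G).topologicalClosure := by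
  have hclosed := Submodule.isClosed_topologicalClosure (leftProducts G)
  refine map_mem_of_coefs hspan hdense
    { toFun := fun a' => opTensor (π.toHom a) (π.toHom a') * G.comulOne
      map_add' := fun x y => by simp [opTensor_add_right, add_mul]
      map_smul' := fun c x => by simp [opTensor_smul_right] }
    (((continuous_opTensor_right _).comp π.continuous).mul continuous_const) hclosed
    (fun M b c => ?_) a'
  refine hclosed.mem_of_tendsto ((((continuous_opTensor_left _).tendsto _).comp
    (G.tendsto_mul_part_op a)).mul_const G.comulOne) (Eventually.of_forall fun J => ?_)
  refine Submodule.le_topologicalClosure _ ?_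
  have : opTensor (π.toHom a * π.toHom (G.part J)) (π.toHom (M.coef b c)) * G.comulOne =
      ∑ q ∈ J, opTensor (π.toHom a) 1 *
        (opTensor (G.unitOp q.1 q.2) (π.toHom (M.coef b c)) * G.comulOne) := by
    simp only [G.map_part, Finset.mul_sum, opTensor_sum_left, Finset.sum_mul, ← mul_assoc,
      opTensor_mul, one_mul]
  simp only [Function.comp_apply, this]
  exact sum_mem fun q _ => tensor_one_mul_mem_leftProducts a
    (M.tensor_coef_mem_leftProducts q.1 q.2 b c)

lemma tensor_mul_comulOne_mem_right (hS : ∀ a b, S (a * b) = S b * S a)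
    (hmem : ∀ k l, G.unit k l ∈ 𝒜)
    (hunit : ∀ k l, (S ⟨G.unit k l, hmem k l⟩ : A) = G.unit l k)
    (hspan : ∀ a ∈ 𝒜, a ∈ Submodule.span ℂ (coefs G 𝒜 S))
    (hdense : Dense (𝒜 : Set A)) (a a' : A) :
    opTensor (π.toHom a) (π.toHom a') * G.comulOne ∈ (rightProducts G).topologicalClosure := by
  have hclosed := Submodule.isClosed_topologicalClosure (rightProducts G)
  refine map_mem_of_coefs hspan hdense
    { toFun := fun a => opTensor (π.toHom a) (π.toHom a') * G.comulOne
      map_add' := fun x y => by simp [opTensor_add_left, add_mul]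
      map_smul' := fun c x => by simp [opTensor_smul_left] }
    (((continuous_opTensor_left _).comp π.continuous).mul continuous_const) hclosed
    (fun M b c => ?_) a
  refine hclosed.mem_of_tendsto ((((continuous_opTensor_right _).tendsto _).comp
    (G.tendsto_mul_part_op a')).mul_const G.comulOne) (Eventually.of_forall fun J => ?_)
  refine Submodule.le_topologicalClosure _ ?_
  have : opTensor (π.toHom (M.coef b c)) (π.toHom a' * π.toHom (G.part J)) * G.comulOne =
      ∑ q ∈ J, opTensor 1 (π.toHom a') *
        (opTensor (π.toHom (M.coef b c)) (G.unitOp q.1 q.2) * G.comulOne) := by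
    simp only [G.map_part, Finset.mul_sum, opTensor_sum_right, Finset.sum_mul, ← mul_assoc,
      opTensor_mul, one_mul]
  simp only [Function.comp_apply, this]
  exact sum_mem fun q _ => one_tensor_mul_mem_rightProducts a'
    (M.coef_tensor_mem_rightProducts hS hmem hunit hspan q.1 q.2 b c)

/-- If the coefficients of matrix corepresentations span a dense subalgebra with antipode, the
density conditions hold. -/
theorem density (hS : ∀ a b, S (a * b) = S b * S a)
    (hmem : ∀ k l, G.unit k l ∈ 𝒜)
    (hunit : ∀ k l, (S ⟨G.unit k l, hmem k l⟩ : A) = G.unit l k)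
    (hspan : ∀ a ∈ 𝒜, a ∈ Submodule.span ℂ (coefs G 𝒜 S))
    (hdense : Dense (𝒜 : Set A)) : G.DensityOne ∧ G.DensityTwo := by
  refine ⟨⟨?_, ?_⟩, ?_, ?_⟩
  · exact eq_closure_of_products (leftProducts G) leftProducts_le
      (tensor_mul_comulOne_mem_left hspan hdense)
  · exact eq_closure_of_products (rightProducts G) rightProducts_le
      (tensor_mul_comulOne_mem_right hS hmem hunit hspan hdense)
  · apply Set.Subset.antisymm
    · rintro _ ⟨a, rfl⟩
      exact map_mem_of_coefs hspan hdense π.lin π.continuous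
        (Submodule.isClosed_topologicalClosure (leftSlices G))
        (fun M b c => Submodule.le_topologicalClosure _ (M.coef_mem_leftSlices hspan b c)) a
    · refine closure_minimal (Submodule.span_le.2 ?_) π.isClosed_image
      rintro y ⟨ω, a, -, h⟩
      exact h.mem_image
  · apply Set.Subset.antisymm
    · rintro _ ⟨a, rfl⟩
      exact map_mem_of_coefs hspan hdense π.lin π.continuous
        (Submodule.isClosed_topologicalClosure (rightSlices G))
        (fun M b c => Submodule.le_topologicalClosure _ (M.coef_mem_rightSlices b c)) a
    · refine closure_minimal (Submodule.span_le.2 ?_) π.isClosed_image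
      rintro y ⟨ω, a, -, h⟩
      exact h.mem_image

end MatrixCorep

/-! ### Homogeneous orthonormal bases -/

section Basis

variable {I : Type u} {H : Type*} [NormedAddCommGroup H] [InnerProductSpace ℂ H]

lemma finite_of_orthonormal_of_mem {B : Type*} {e : B → H} (he : Orthonormal ℂ e)
    (V : Submodule ℂ H) [FiniteDimensional ℂ V] (s : Set B) (hs : ∀ b ∈ s, e b ∈ V) :
    s.Finite := by
  have h1 : LinearIndependent ℂ fun b : s => (⟨e b, hs b b.2⟩ : V) :=
    LinearIndependent.of_comp V.subtype
      (he.linearIndependent.comp (Subtype.val : s → B) Subtype.val_injective)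
  exact Set.finite_coe_iff.1 h1.finite

variable [CompleteSpace H]

/-- An orthonormal family of homogeneous vectors that spans every component of a bigraded Hilbert
space with finite dimensional rows and columns. -/
structure HomogeneousBasis (p : Bigrading I H) where
  index : Type u
  src : index → I
  tgt : index → I
  vec : index → H
  orthonormal : Orthonormal ℂ vec
  proj_vec : ∀ b, p.proj (src b) (tgt b) (vec b) = vec b
  mem_span : ∀ k l ξ, p.proj k l ξ = ξ →
    ξ ∈ Submodule.span ℂ (vec '' {b | src b = k ∧ tgt b = l})
  finite_row : ∀ r, {b | src b = r}.Finite
  finite_col : ∀ r, {b | tgt b = r}.Finite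

lemma Bigrading.range_proj_le_row (p : Bigrading I H) (k l : I) :
    LinearMap.range (p.proj k l).toLinearMap ≤ LinearMap.range (p.row k).toLinearMap := by
  rintro _ ⟨x, rfl⟩
  exact ⟨p.proj k l x, congrArg (fun f => f x) (projSum_mul_self (fun l => p.proj k l) l)⟩

lemma Bigrading.range_proj_le_col (p : Bigrading I H) (k l : I) :
    LinearMap.range (p.proj k l).toLinearMap ≤ LinearMap.range (p.col l).toLinearMap := by
  rintro _ ⟨x, rfl⟩
  exact ⟨p.proj k l x, congrArg (fun f => f x) (projSum_mul_self (fun k => p.proj k l) k)⟩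

lemma Bigrading.inner_eq_zero (p : Bigrading I H) {k l m n : I} (h : (k, l) ≠ (m, n)) {x y : H}
    (hx : p.proj k l x = x) (hy : p.proj m n y = y) : inner ℂ x y = (0 : ℂ) := by
  rw [← hx, ← hy, ← ContinuousLinearMap.adjoint_inner_right, ← ContinuousLinearMap.star_eq_adjoint,
    (p.isStarProjection_proj k l).isSelfAdjoint.star_eq, ← mul_apply_eq_comp,
    p.orthogonal_proj k l m n h]
  simp

/-- Orthonormal bases of the components `H(k,l)`, which are finite dimensional, are put
together. -/
lemma Bigrading.nonempty_homogeneousBasis (p : Bigrading I H)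
    (hrow : ∀ k, FiniteDimensional ℂ (LinearMap.range (p.row k).toLinearMap))
    (hcol : ∀ m, FiniteDimensional ℂ (LinearMap.range (p.col m).toLinearMap)) :
    Nonempty (HomogeneousBasis p) := by
  have hfin : ∀ q : I × I, FiniteDimensional ℂ (LinearMap.range (p.proj q.1 q.2).toLinearMap) :=
    fun q => by
      have := hrow q.1
      exact Submodule.finiteDimensional_of_le (p.range_proj_le_row q.1 q.2)
  let V : I × I → Submodule ℂ H := fun q => LinearMap.range (p.proj q.1 q.2).toLinearMap
  let e : ∀ q : I × I, OrthonormalBasis (Fin (Module.finrank ℂ (V q))) ℂ (V q) :=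
    fun q => stdOrthonormalBasis ℂ (V q)
  have hproj : ∀ (q : I × I) (x : V q), p.proj q.1 q.2 (x : H) = x := by
    rintro q ⟨_, y, rfl⟩
    exact congrArg (fun f => f y) (p.isStarProjection_proj q.1 q.2).isIdempotentElem
  let vec : (Σ q : I × I, Fin (Module.finrank ℂ (V q))) → H := fun b => e b.1 b.2
  have hon : Orthonormal ℂ vec := by
    classical
    rw [orthonormal_iff_ite]
    rintro ⟨q, i⟩ ⟨q', i'⟩
    by_cases h : q = q'
    · subst h
      have := orthonormal_iff_ite.1 (e q).orthonormal i i'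
      simp only [vec]
      rw [← Submodule.coe_inner, this]
      simp
    · rw [if_neg (by simp [h])]
      exact p.inner_eq_zero h (hproj q _) (hproj q' _)
  refine ⟨⟨_, fun b => b.1.1, fun b => b.1.2, vec, hon, fun b => hproj b.1 _, ?_, ?_, ?_⟩⟩
  · intro k l ξ hξ
    have h1 : (⟨ξ, ξ, hξ⟩ : V (k, l)) ∈ Submodule.span ℂ (Set.range (e (k, l))) := by
      rw [← (e (k, l)).coe_toBasis, Module.Basis.span_eq]; trivial
    have h2 := Submodule.mem_map_of_mem (f := (V (k, l)).subtype) h1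
    rw [Submodule.map_span] at h2
    refine Submodule.span_mono ?_ h2
    rintro _ ⟨_, ⟨i, rfl⟩, rfl⟩
    exact ⟨⟨(k, l), i⟩, ⟨rfl, rfl⟩, rfl⟩
  · intro r
    have := hrow r
    refine finite_of_orthonormal_of_mem hon (LinearMap.range (p.row r).toLinearMap) _ ?_
    rintro ⟨⟨k, l⟩, i⟩ rfl
    exact p.range_proj_le_row k l (e (k, l) i).2
  · intro r
    have := hcol r
    refine finite_of_orthonormal_of_mem hon (LinearMap.range (p.col r).toLinearMap) _ ?_
    rintro ⟨⟨k, l⟩, i⟩ rfl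
    exact p.range_proj_le_col k l (e (k, l) i).2

namespace HomogeneousBasis

variable {p : Bigrading I H} (e : HomogeneousBasis p)

lemma inner_self_vec (b : e.index) : inner ℂ (e.vec b) (e.vec b) = (1 : ℂ) := by
  rw [inner_self_eq_norm_sq_to_K, e.orthonormal.1]; simp

lemma inner_vec_of_ne {b c : e.index} (h : b ≠ c) : inner ℂ (e.vec b) (e.vec c) = (0 : ℂ) :=
  e.orthonormal.2 h

/-- The vectors of a homogeneous basis are total. -/
lemma topologicalClosure_span :
    (Submodule.span ℂ (Set.range e.vec)).topologicalClosure = ⊤ := by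
  refine eq_top_iff.2 fun x _ => ?_
  refine (Submodule.isClosed_topologicalClosure _).mem_of_tendsto (p.sum_proj x)
    (Eventually.of_forall fun J => Submodule.le_topologicalClosure _ (sum_mem fun q _ => ?_))
  refine Submodule.span_mono (Set.image_subset_range _ _) (e.mem_span q.1 q.2 _ ?_)
  exact congrArg (fun f => f x) (p.isStarProjection_proj q.1 q.2).isIdempotentElem

end HomogeneousBasis

end Basis

/-! ### The approximate unit of `A ⊗ B₀(H)` -/

section CompactUnit

variable {I A K H : Type*} [NonUnitalCStarAlgebra A]
  [NormedAddCommGroup K] [InnerProductSpace ℂ K] [CompleteSpace K]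
  [NormedAddCommGroup H] [InnerProductSpace ℂ H]

lemma isCompactOperator_of_finiteDimensional_range {T : H →L[ℂ] H}
    [FiniteDimensional ℂ (LinearMap.range T.toLinearMap)] : IsCompactOperator T := by
  have h1 : IsCompactOperator (LinearMap.range T.toLinearMap).subtypeL := by
    have : ProperSpace (LinearMap.range T.toLinearMap) := FiniteDimensional.proper ℂ _
    exact isCompactOperator_of_locallyCompactSpace_rng _
  exact h1.comp_clm (T.codRestrict _ fun x => ⟨x, rfl⟩)

lemma compactIncl_exists_mul (a b : compactOperator (RingHom.id ℂ) H H) :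
    ∃ c, compactIncl H c = compactIncl H a * compactIncl H b :=
  ⟨⟨a.1 * b.1, b.2.clm_comp a.1⟩, rfl⟩

variable [CompleteSpace H]

/-- The sum of finitely many of the projections `p(k,l)`. -/
def Bigrading.part (p : Bigrading I H) (J : Finset (I × I)) : H →L[ℂ] H :=
  ∑ q ∈ J, p.proj q.1 q.2

lemma Bigrading.isStarProjection_part (p : Bigrading I H) (J : Finset (I × I)) :
    IsStarProjection (p.part J) := by
  classical
  refine ⟨?_, ?_⟩
  · rw [IsIdempotentElem, Bigrading.part, Finset.sum_mul_sum]
    refine Finset.sum_congr rfl fun q hq => ?_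
    rw [Finset.sum_eq_single_of_mem q hq]
    · exact (p.isStarProjection_proj _ _).isIdempotentElem
    · intro q' _ hne
      exact p.orthogonal_proj _ _ _ _ (by simpa using hne.symm)
  · rw [IsSelfAdjoint, Bigrading.part, star_sum]
    exact Finset.sum_congr rfl fun q _ => (p.isStarProjection_proj _ _).isSelfAdjoint

lemma Bigrading.tendsto_part_apply (p : Bigrading I H) (x : H) :
    Tendsto (fun J => p.part J x) atTop (𝓝 x) := by
  have := p.sum_proj x
  refine Tendsto.congr (fun J => ?_) this
  simp [Bigrading.part]

lemma isApproxUnit_compact {π : FaithfulRep A K} (G : PartialCompactQuantumSemigroup I π)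
    (p : Bigrading I H) (hp : ∀ k l, IsCompactOperator (p.proj k l)) :
    IsApproxUnit atTop (fun J => opTensor (π.toHom (G.part J)) (p.part J))
      (minTensor π.lin (compactIncl H)) where
  norm_le J := (norm_opTensor_le _ _).trans
    (mul_le_one₀ (G.norm_map_part_le J) (norm_nonneg _) (p.isStarProjection_part J).norm_le)
  mem J := by
    have h1 : p.part J ∈ compactOperator (RingHom.id ℂ) H H := sum_mem fun q _ => hp _ _
    exact opTensor_mem_minTensor π.lin (compactIncl H) (G.part J) ⟨_, h1⟩
  left _ hc := tendsto_mul_left_minTensor G.norm_map_part_le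
    (fun J => (p.isStarProjection_part J).norm_le) G.tendsto_part_op_mul
    (fun w => tendsto_mul_compact (fun J => (p.isStarProjection_part J).norm_le)
      p.tendsto_part_apply w.2) hc
  right _ hc := tendsto_mul_right_minTensor G.norm_map_part_le
    (fun J => (p.isStarProjection_part J).norm_le) G.tendsto_mul_part_op
    (fun w => tendsto_compact_mul p.isStarProjection_part p.tendsto_part_apply w.2) hc

end CompactUnit

/-! ### The matrix corepresentation of a representation -/

section CompactSlice

variable {A K H : Type*} [NonUnitalCStarAlgebra A]
  [NormedAddCommGroup K] [InnerProductSpace ℂ K] [CompleteSpace K]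
  [NormedAddCommGroup H] [InnerProductSpace ℂ H] (π : FaithfulRep A K)

variable (A) in
/-- The slice `(id ⊗ ω)(t)`, `ω(b) = ⟪ξ, b η⟫`, of an element of `A ⊗ B₀(H)`. -/
def compactSlice (ξ η : H) : A ⊗[ℂ] compactOperator (RingHom.id ℂ) H H →ₗ[ℂ] A :=
  TensorProduct.lift ((LinearMap.lsmul ℂ A).flip.compl₂
    ((innerSL ℂ ξ).toLinearMap ∘ₗ (ContinuousLinearMap.apply ℂ H η).toLinearMap ∘ₗ compactIncl H))

@[simp] lemma compactSlice_tmul (ξ η : H) (a : A) (b : compactOperator (RingHom.id ℂ) H H) :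
    compactSlice A ξ η (a ⊗ₜ b) = (inner ℂ ξ (compactIncl H b η) : ℂ) • a := rfl

/-- A slice map by a vector functional commutes with homomorphisms of the first leg. -/
lemma map_compactSlice {E : Type*} [NormedAddCommGroup E] [InnerProductSpace ℂ E]
    [CompleteSpace E] (α : A →ₗ[ℂ] (E →L[ℂ] E)) (ξ η : H)
    (t : A ⊗[ℂ] compactOperator (RingHom.id ℂ) H H) :
    α (compactSlice A ξ η t) =
      (creation ξ : E →L[ℂ] HilbertTensor E H).adjoint ∘L algTensor α (compactIncl H) t ∘L
        creation η := by
  induction t with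
  | zero => ext; simp
  | add x y hx hy => ext v; simp [hx, hy]
  | tmul a b => ext v; simp

lemma sandwich_creation_mem {V E : Type*} [AddCommGroup V] [Module ℂ V] [NormedAddCommGroup E]
    [InnerProductSpace ℂ E] [CompleteSpace E] {α : V →ₗ[ℂ] (E →L[ℂ] E)}
    (hα : IsClosed (LinearMap.range α : Set (E →L[ℂ] E))) (ξ η : H)
    {R : HilbertTensor E H →L[ℂ] HilbertTensor E H} (hR : R ∈ minTensor α (compactIncl H)) :
    (creation ξ : E →L[ℂ] HilbertTensor E H).adjoint ∘L R ∘L creation η ∈ LinearMap.range α := by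
  refine map_mem_of_mem_minTensor
    (sandwich (creation ξ : E →L[ℂ] HilbertTensor E H).adjoint (creation η)) hα (fun v w => ?_) hR
  refine ⟨(inner ℂ ξ (compactIncl H w η) : ℂ) • v, ?_⟩
  ext x; simp

end CompactSlice

section Ext

variable {E F G : Type*} [NormedAddCommGroup E] [InnerProductSpace ℂ E] [CompleteSpace E]
  [NormedAddCommGroup F] [InnerProductSpace ℂ F]
  [NormedAddCommGroup G] [InnerProductSpace ℂ G] [CompleteSpace G]

/-- Operators into `E ⊗ F` are determined by their components along a total family of vectors
of `F`. -/
lemma clm_ext_adjoint_creation {ι : Type*} {e : ι → F}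
    (he : (Submodule.span ℂ (Set.range e)).topologicalClosure = ⊤)
    {S T : G →L[ℂ] HilbertTensor E F}
    (h : ∀ i, (creation (e i) : E →L[ℂ] HilbertTensor E F).adjoint ∘L S =
      (creation (e i)).adjoint ∘L T) : S = T := by
  apply ContinuousLinearMap.adjoint.injective
  refine clm_ext_creation he fun i => ?_
  have := congrArg ContinuousLinearMap.adjoint (h i)
  simpa [ContinuousLinearMap.adjoint_comp] using this

end Ext

lemma Representation.coeff_star {K H : Type*} [NormedAddCommGroup K] [InnerProductSpace ℂ K]
    [CompleteSpace K] [NormedAddCommGroup H] [InnerProductSpace ℂ H]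
    {T : HilbertTensor K H →L[ℂ] HilbertTensor K H} (ξ η : H) :
    coeff (star T) ξ η = star (coeff T η ξ) := by
  rw [coeff, coeff, ContinuousLinearMap.star_eq_adjoint, ContinuousLinearMap.star_eq_adjoint,
    ContinuousLinearMap.adjoint_comp, ContinuousLinearMap.adjoint_comp,
    ContinuousLinearMap.adjoint_adjoint, ContinuousLinearMap.comp_assoc]

namespace Representation

variable {I : Type u} {A K H : Type*} [NonUnitalCStarAlgebra A]
  [NormedAddCommGroup K] [InnerProductSpace ℂ K] [CompleteSpace K]
  [NormedAddCommGroup H] [InnerProductSpace ℂ H] [CompleteSpace H]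
  {π : FaithfulRep A K} {G : PartialCompactQuantumSemigroup I π} {p : Bigrading I H}
  (X : Representation G p)

lemma adjoint_creation_comp_proj {E : Type*} [NormedAddCommGroup E] [InnerProductSpace ℂ E]
    [CompleteSpace E] {k l : I} {ξ : H} (hξ : p.proj k l ξ = ξ) (T : E →L[ℂ] E) :
    (creation ξ : E →L[ℂ] HilbertTensor E H).adjoint ∘L opTensor T (p.proj k l) =
      T ∘L (creation ξ).adjoint := by
  rw [adjoint_creation_comp_opTensor, (p.isStarProjection_proj k l).isSelfAdjoint.star_eq, hξ]

/-- Between vectors of bidegrees `(k,l)` and `(m,n)` the block has the same coefficients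
as `X`. -/
lemma coeff_block {k l m n : I} {ξ η : H} (hξ : p.proj k l ξ = ξ) (hη : p.proj m n η = η) :
    coeff (X.block k l m n) ξ η = coeff X.op ξ η := by
  rw [coeff, block, X.co2, coeff]
  have h1 := adjoint_creation_comp_proj hξ (1 : K →L[ℂ] K)
  have h2 := opTensor_comp_creation (1 : K →L[ℂ] K) (p.proj m n) η
  rw [hη] at h2
  rw [ContinuousLinearMap.mul_def, ContinuousLinearMap.mul_def, ContinuousLinearMap.comp_assoc,
    ContinuousLinearMap.comp_assoc, h2, ← ContinuousLinearMap.comp_assoc, h1]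
  rfl

/-- The coefficient lies in `1(k,m) A 1(l,n)`. -/
lemma coeff_eq_unitOp_mul {k l m n : I} {ξ η : H} (hξ : p.proj k l ξ = ξ)
    (hη : p.proj m n η = η) :
    coeff X.op ξ η = G.unitOp k m * coeff X.op ξ η * G.unitOp l n := by
  conv_lhs => rw [← X.coeff_block hξ hη]
  ext v
  have h := adjoint_creation_comp_opTensor (G.unitOp k m) (1 : H →L[ℂ] H) ξ
  simpa [coeff, block] using
    congrArg (fun f => f (X.op (opTensor (G.unitOp l n) 1 (tm v η)))) h

lemma unitOp_mul_coeff {k l m n : I} {ξ η : H} (hξ : p.proj k l ξ = ξ)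
    (hη : p.proj m n η = η) : G.unitOp k m * coeff X.op ξ η = coeff X.op ξ η := by
  rw [X.coeff_eq_unitOp_mul hξ hη, ← mul_assoc, ← mul_assoc, G.unitOp_mul_self]

lemma coeff_mul_unitOp {k l m n : I} {ξ η : H} (hξ : p.proj k l ξ = ξ)
    (hη : p.proj m n η = η) : coeff X.op ξ η * G.unitOp l n = coeff X.op ξ η := by
  rw [X.coeff_eq_unitOp_mul hξ hη, mul_assoc, G.unitOp_mul_self]

lemma tensor_proj_mem (hp : ∀ k l, IsCompactOperator (p.proj k l)) (a : A) (k l : I) :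
    opTensor (π.toHom a) (p.proj k l) ∈ minTensor π.lin (compactIncl H) :=
  opTensor_mem_minTensor π.lin (compactIncl H) a ⟨_, hp k l⟩

/-- The coefficients of `X` between homogeneous vectors lie in `A`, and not only in `M(A)`. -/
lemma exists_toHom_eq_coeff (hp : ∀ k l, IsCompactOperator (p.proj k l)) {k l m n : I} {ξ η : H}
    (hξ : p.proj k l ξ = ξ) (hη : p.proj m n η = η) : ∃ a, π.toHom a = coeff X.op ξ η := by
  have h1 := (X.mem _ (tensor_proj_mem hp (G.unit k m) k l)).2
  have h2 := sandwich_creation_mem π.isClosed_image ξ η h1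
  rw [ContinuousLinearMap.mul_def, ← ContinuousLinearMap.comp_assoc,
    ← ContinuousLinearMap.comp_assoc, adjoint_creation_comp_proj hξ] at h2
  obtain ⟨a, ha⟩ := h2
  exact ⟨a, ha.trans (X.unitOp_mul_coeff hξ hη)⟩

variable (e : HomogeneousBasis p)

/-- Cutting by `1(k,r)` leaves only the components of `X` in the `r`-th row. -/
lemma leftCut_leg13 (b : e.index) (r : I) :
    opTensor (G.unitOp (e.src b) r) (1 : K →L[ℂ] K) ∘L
        (creation (e.vec b) : HilbertTensor K K →L[ℂ] _).adjoint ∘L leg13 X.op =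
      ∑ d ∈ (e.finite_row r).toFinset, opTensor (coeff X.op (e.vec b) (e.vec d)) 1 ∘L
        (creation (e.vec d)).adjoint := by
  refine clm_ext_creation e.topologicalClosure_span fun c => ?_
  have h1 := coeff_leg13 (F := K) X.op (e.vec b) (e.vec c)
  rw [ContinuousLinearMap.comp_assoc, ContinuousLinearMap.comp_assoc, h1, opTensor_comp]
  have h2 : ∀ d, (opTensor (coeff X.op (e.vec b) (e.vec d)) (1 : K →L[ℂ] K) ∘L
      (creation (e.vec d) : HilbertTensor K K →L[ℂ] _).adjoint) ∘L creation (e.vec c) =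
      (inner ℂ (e.vec d) (e.vec c) : ℂ) • opTensor (coeff X.op (e.vec b) (e.vec d)) 1 := by
    intro d; ext v; simp
  have h3 : (∑ d ∈ (e.finite_row r).toFinset,
      opTensor (coeff X.op (e.vec b) (e.vec d)) (1 : K →L[ℂ] K) ∘L
        (creation (e.vec d) : HilbertTensor K K →L[ℂ] _).adjoint) ∘L creation (e.vec c) =
      ∑ d ∈ (e.finite_row r).toFinset,
        (inner ℂ (e.vec d) (e.vec c) : ℂ) • opTensor (coeff X.op (e.vec b) (e.vec d)) 1 := by
    rw [ContinuousLinearMap.finsetSum_comp]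
    exact Finset.sum_congr rfl fun d _ => h2 d
  rw [h3]
  by_cases hc : e.src c = r
  · rw [Finset.sum_eq_single_of_mem c (by simpa using hc)]
    · rw [e.inner_self_vec, one_smul, ← hc]
      exact congrArg₂ opTensor (X.unitOp_mul_coeff (e.proj_vec b) (e.proj_vec c)) (one_mul 1)
    · intro d _ hd
      rw [e.inner_vec_of_ne hd, zero_smul]
  · rw [Finset.sum_eq_zero]
    · have : G.unitOp (e.src b) r * coeff X.op (e.vec b) (e.vec c) = 0 := by
        rw [← X.unitOp_mul_coeff (e.proj_vec b) (e.proj_vec c), ← mul_assoc,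
          G.unitOp_mul_of_ne (by simpa using Ne.symm hc), zero_mul]
      exact (congrArg (fun S => opTensor S _) this).trans (opTensor_zero_left _)
    · intro d hd
      rw [e.inner_vec_of_ne, zero_smul]
      rintro rfl
      exact hc (by simpa using hd)

/-- The comultiplication of a coefficient of `X`, obtained from `(Δ ⊗ id)(X) = X₁₃X₂₃` by
approximating `X` strictly by elements of the algebraic tensor product. -/
lemma comul_coeff (hp : ∀ k l, IsCompactOperator (p.proj k l)) {k l m n : I} {ξ η : H}
    (hξ : p.proj k l ξ = ξ) (hη : p.proj m n η = η) {a : A} (ha : π.toHom a = coeff X.op ξ η) :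
    G.comul a = ((creation ξ : HilbertTensor K K →L[ℂ] _).adjoint ∘L
      (leg13 X.op * leg23 X.op) ∘L creation η) * G.comul (G.unit l n) := by
  set W := (creation ξ : HilbertTensor K K →L[ℂ] _).adjoint ∘L
      (leg13 X.op * leg23 X.op) ∘L creation η with hW
  set 𝓕 := comap (algTensor π.lin (compactIncl H))
    (strictNhds (minTensor π.lin (compactIncl H)) X.op) with hF
  have hfreq := (isApproxUnit_compact G p hp).frequently_comap
    (mul_mem_minTensor π.exists_mul compactIncl_exists_mul)
    (algTensor π.lin (compactIncl H)) (minTensor_subset_closure_range _ _) X.mem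
  have hne : 𝓕.NeBot := by
    rw [hF]; exact ⟨fun h => by rw [h] at hfreq; simp at hfreq⟩
  have hX := tendsto_strictNhds.1 (tendsto_comap_strictNhds (algTensor π.lin (compactIncl H))
    (minTensor π.lin (compactIncl H)) X.op)
  -- the slices of `t → X`, cut by `1(l,n)` on the right, converge in norm to `a`
  have hlim1 : Tendsto (fun t => compactSlice A ξ η t * G.unit l n) 𝓕 (𝓝 a) := by
    rw [(NonUnitalStarAlgHom.isometry π.toHom π.injective).isEmbedding.tendsto_nhds_iff]
    have hcut : ∀ R : HilbertTensor K H →L[ℂ] HilbertTensor K H,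
        ((creation ξ : K →L[ℂ] HilbertTensor K H).adjoint ∘L R ∘L creation η) * G.unitOp l n =
        sandwich (creation ξ : K →L[ℂ] HilbertTensor K H).adjoint (creation η)
          (R * opTensor (G.unitOp l n) (p.proj m n)) := by
      intro R; ext v; simp [hη]
    have h1 : π.toHom a = sandwich (creation ξ : K →L[ℂ] HilbertTensor K H).adjoint (creation η)
        (X.op * opTensor (G.unitOp l n) (p.proj m n)) := by
      rw [← hcut, ha]; exact (X.coeff_mul_unitOp hξ hη).symm
    rw [h1]
    refine (((sandwich _ _).continuous.tendsto _).comp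
      (hX _ (tensor_proj_mem hp (G.unit l n) m n)).1).congr fun t => ?_
    simp only [Function.comp_apply, map_mul]
    rw [← FaithfulRep.lin_apply π (compactSlice A ξ η t), map_compactSlice π.lin]
    exact (hcut _).symm
  have hlim2 : Tendsto (fun t => G.comul (compactSlice A ξ η t) * G.comul (G.unit l n)) 𝓕
      (𝓝 (G.comul a)) := by
    refine ((G.continuous_comul.tendsto a).comp hlim1).congr fun t => ?_
    simp
  -- after applying `Δ`, they converge strictly to the slice of `X₁₃X₂₃`
  have hlim3 : ∀ d ∈ π.tensor2, Tendsto (fun t => d * G.comul (compactSlice A ξ η t)) 𝓕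
      (𝓝 (d * W)) := by
    intro d hd
    have hcut : ∀ R : HilbertTensor (HilbertTensor K K) H →L[ℂ] _,
        d * ((creation ξ : HilbertTensor K K →L[ℂ] _).adjoint ∘L R ∘L creation η) =
        sandwich (creation ξ : HilbertTensor K K →L[ℂ] _).adjoint (creation η)
          (opTensor d (p.proj k l) * R) := by
      intro R
      ext v
      simpa using (congrArg (fun f => f (R (tm v η))) (adjoint_creation_comp_proj hξ d)).symm
    have hmem : opTensor d (p.proj k l) ∈ minTensor π.tensor2.subtype (compactIncl H) :=
      opTensor_mem_minTensor π.tensor2.subtype (compactIncl H) ⟨d, hd⟩ ⟨_, hp k l⟩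
    have h2 := (tendsto_strictNhds.1 X.co1.2 _ hmem).2
    rw [hW, hcut]
    refine (((sandwich _ _).continuous.tendsto _).comp h2).congr fun t => ?_
    simp only [Function.comp_apply]
    rw [← hcut]
    exact congrArg (d * ·) (map_compactSlice G.comulLin ξ η t).symm
  have hfin : ∀ d ∈ π.tensor2, d * G.comul a = d * (W * G.comul (G.unit l n)) := by
    intro d hd
    refine tendsto_nhds_unique (hlim2.const_mul d) ?_
    refine (mul_assoc d W _ ▸ (hlim3 d hd).mul_const (G.comul (G.unit l n))).congr fun t => ?_
    rw [mul_assoc]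
  -- left multiplication by `A ⊗ A` separates operators: pass to adjoints
  apply star_injective
  refine FaithfulRep.clm_ext_tensor (π := π) fun x y => ?_
  have := congrArg star (hfin _ (π.tensor_mem (star x) (star y)))
  simp only [star_mul, star_opTensor, ← map_star, star_star] at this
  rw [star_mul, ← map_star, ← map_star]
  exact this

/-- The comultiplication of the entries of `X`, cut by `1(k,r)` on the first leg. -/
lemma leftCut_comul_coeff (hp : ∀ k l, IsCompactOperator (p.proj k l))
    (coef : e.index → e.index → A)
    (hcoef : ∀ b c, π.toHom (coef b c) = coeff X.op (e.vec b) (e.vec c)) (r : I)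
    (b c : e.index) :
    opTensor (G.unitOp (e.src b) r) 1 * G.comul (coef b c) =
      ∑ d ∈ (e.finite_row r).toFinset,
        opTensor (π.toHom (coef b d)) (π.toHom (coef d c)) := by
  rw [X.comul_coeff hp (e.proj_vec b) (e.proj_vec c) (hcoef b c), ← mul_assoc]
  have h1 : opTensor (G.unitOp (e.src b) r) (1 : K →L[ℂ] K) *
      ((creation (e.vec b) : HilbertTensor K K →L[ℂ] _).adjoint ∘L
        (leg13 X.op * leg23 X.op) ∘L creation (e.vec c)) =
      ∑ d ∈ (e.finite_row r).toFinset,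
        opTensor (π.toHom (coef b d)) (π.toHom (coef d c)) := by
    have h2 := congrArg (fun f => f ∘L leg23 X.op ∘L
      (creation (e.vec c) : HilbertTensor K K →L[ℂ] _)) (X.leftCut_leg13 e b r)
    simp only [ContinuousLinearMap.comp_assoc, ContinuousLinearMap.finsetSum_comp] at h2
    refine Eq.trans ?_ (h2.trans (Finset.sum_congr rfl fun d _ => ?_))
    · rfl
    · rw [coeff_leg23, opTensor_comp, hcoef, hcoef]
      exact congrArg₂ opTensor (mul_one _) (one_mul _)
  rw [h1, Finset.sum_mul]
  refine Finset.sum_congr rfl fun d _ => ?_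
  have h3 : opTensor (π.toHom (coef b d)) (π.toHom (coef d c)) =
      opTensor (π.toHom (coef b d)) (π.toHom (coef d c)) *
        opTensor (G.unitOp (e.tgt b) (e.tgt d)) (G.unitOp (e.tgt d) (e.tgt c)) := by
    rw [opTensor_mul, hcoef, hcoef, X.coeff_mul_unitOp (e.proj_vec b) (e.proj_vec d),
      X.coeff_mul_unitOp (e.proj_vec d) (e.proj_vec c)]
  rw [h3, mul_assoc, G.tensor_comul_unit]

/-- The components of `X (1(n, t c) ⊗ e_c)`. -/
lemma op_comp_creation (n : I) (c : e.index) :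
    X.op ∘L (creation (e.vec c) : K →L[ℂ] _) ∘L G.unitOp n (e.tgt c) =
      ∑ d ∈ (e.finite_col n).toFinset, creation (e.vec d) ∘L coeff X.op (e.vec d) (e.vec c) := by
  refine clm_ext_adjoint_creation e.topologicalClosure_span fun b => ?_
  have h1 : (creation (e.vec b) : K →L[ℂ] _).adjoint ∘L X.op ∘L
      (creation (e.vec c) : K →L[ℂ] _) ∘L G.unitOp n (e.tgt c) =
      coeff X.op (e.vec b) (e.vec c) * G.unitOp n (e.tgt c) := rfl
  have h2 : ∀ d, (creation (e.vec b) : K →L[ℂ] _).adjoint ∘L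
      (creation (e.vec d) ∘L coeff X.op (e.vec d) (e.vec c)) =
      (inner ℂ (e.vec b) (e.vec d) : ℂ) • coeff X.op (e.vec d) (e.vec c) := by
    intro d; ext v; simp
  rw [h1, ContinuousLinearMap.comp_finsetSum]
  simp only [h2]
  by_cases hb : e.tgt b = n
  · rw [Finset.sum_eq_single_of_mem b (by simpa using hb)]
    · rw [e.inner_self_vec, one_smul, ← hb]
      exact X.coeff_mul_unitOp (e.proj_vec b) (e.proj_vec c)
    · intro d _ hd
      rw [e.inner_vec_of_ne hd.symm, zero_smul]
  · rw [Finset.sum_eq_zero]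
    · rw [← X.coeff_mul_unitOp (e.proj_vec b) (e.proj_vec c), mul_assoc,
        G.unitOp_mul_of_ne (by simp [hb]), mul_zero]
    · intro d hd
      rw [e.inner_vec_of_ne, zero_smul]
      rintro rfl
      exact hb (by simpa using hd)

lemma target_mul_unitOp (n l : I) : G.target l * G.unitOp n l = G.unitOp n l :=
  projSum_mul_self (fun k => G.unitOp k l) n

lemma target_mul_unitOp_of_ne {l l' : I} (h : l ≠ l') (n : I) :
    G.target l * G.unitOp n l' = 0 :=
  projSum_mul_eq_zero _ fun k => by rw [G.star_unitOp, G.unitOp_mul_of_ne (by simp [h])]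

/-- `X*X = ∑ ρ ⊗ ρ` acts as the identity on `1(n,l) K ⊗ H(k,l)`. -/
lemma star_op_mul_op_mul (hX : X.IsUnitary) (hp : ∀ k l, IsCompactOperator (p.proj k l))
    (n k l : I) :
    star X.op * X.op * opTensor (G.unitOp n l) (p.proj k l) =
      opTensor (G.unitOp n l) (p.proj k l) := by
  refine tendsto_nhds_unique
    ((tendsto_strictNhds.1 hX.1) _ (tensor_proj_mem hp (G.unit n l) k l)).1 ?_
  refine tendsto_const_nhds.congr' ?_
  filter_upwards [eventually_ge_atTop {l}] with J hJ
  have hl : l ∈ J := by simpa using hJ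
  change opTensor (G.unitOp n l) (p.proj k l) =
    (∑ m ∈ J, opTensor (G.target m) (p.col m)) * opTensor (G.unitOp n l) (p.proj k l)
  rw [Finset.sum_mul, Finset.sum_eq_single_of_mem l hl]
  · rw [opTensor_mul, target_mul_unitOp]
    exact congrArg _ (projSum_mul_self (fun k => p.proj k l) k).symm
  · intro m _ hm
    rw [opTensor_mul, target_mul_unitOp_of_ne hm, opTensor_zero_left]

/-- Orthogonality of the columns of `X`. -/
lemma sum_star_coeff_mul_coeff (hX : X.IsUnitary) (hp : ∀ k l, IsCompactOperator (p.proj k l))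
    (n : I) (b c : e.index) :
    ∑ d ∈ (e.finite_col n).toFinset,
        star (coeff X.op (e.vec d) (e.vec b)) * coeff X.op (e.vec d) (e.vec c) =
      (inner ℂ (e.vec b) (e.vec c) : ℂ) • G.unitOp n (e.tgt c) := by
  have h1 := X.star_op_mul_op_mul hX hp n (e.src c) (e.tgt c)
  have h2 := congrArg (fun R => (creation (e.vec b) : K →L[ℂ] _).adjoint ∘L R ∘L
    creation (e.vec c)) h1
  have h3 : opTensor (G.unitOp n (e.tgt c)) (p.proj (e.src c) (e.tgt c)) ∘L
      creation (e.vec c) = creation (e.vec c) ∘L G.unitOp n (e.tgt c) := by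
    rw [opTensor_comp_creation, e.proj_vec]
  have h4 : (creation (e.vec b) : K →L[ℂ] _).adjoint ∘L creation (e.vec c) ∘L
      G.unitOp n (e.tgt c) = (inner ℂ (e.vec b) (e.vec c) : ℂ) • G.unitOp n (e.tgt c) := by
    ext v; simp
  simp only [ContinuousLinearMap.mul_def, ContinuousLinearMap.comp_assoc, h3, h4] at h2
  rw [← h2, op_comp_creation, ContinuousLinearMap.comp_finsetSum,
    ContinuousLinearMap.comp_finsetSum]
  refine Finset.sum_congr rfl fun d _ => ?_
  rw [← coeff_star]
  rfl

/-- The entries of `X` with respect to a homogeneous orthonormal basis form a matrix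
corepresentation. -/
lemma exists_matrixCorep (hX : X.IsUnitary) (hp : ∀ k l, IsCompactOperator (p.proj k l))
    (S : X.coefficientAlgebra →ₗ[ℂ] X.coefficientAlgebra) (hS : X.IsAntipode S) (b c : e.index)
    {a : A} (ha : π.toHom a = coeff X.op (e.vec b) (e.vec c)) :
    a ∈ MatrixCorep.coefs G X.coefficientAlgebra S := by
  choose coef hcoef using fun b c : e.index =>
    X.exists_toHom_eq_coeff hp (e.proj_vec b) (e.proj_vec c)
  have hmem : ∀ b c, coef b c ∈ X.coefficientAlgebra := fun b c =>
    NonUnitalAlgebra.subset_adjoin ℂ (Or.inr ⟨_, _, _, _, e.vec b, e.vec c, e.proj_vec b,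
      e.proj_vec c, by rw [hcoef, X.coeff_block (e.proj_vec b) (e.proj_vec c)]⟩)
  let M : MatrixCorep G X.coefficientAlgebra S :=
    { index := e.index
      src := e.src
      tgt := e.tgt
      finite_row := e.finite_row
      finite_col := e.finite_col
      coef := coef
      unit_mul := fun b c => π.injective <| by
        rw [map_mul, hcoef]; exact X.unitOp_mul_coeff (e.proj_vec b) (e.proj_vec c)
      mul_unit := fun b c => π.injective <| by
        rw [map_mul, hcoef]; exact X.coeff_mul_unitOp (e.proj_vec b) (e.proj_vec c)
      leftCut := X.leftCut_comul_coeff e hp coef hcoef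
      star_mul_self := fun n b => π.injective <| by
        simp only [map_sum, map_mul, map_star, hcoef, X.sum_star_coeff_mul_coeff e hX hp,
          e.inner_self_vec, one_smul]
        rfl
      star_mul_of_ne := fun n b c hbc => π.injective <| by
        simp only [map_sum, map_mul, map_star, hcoef, X.sum_star_coeff_mul_coeff e hX hp,
          e.inner_vec_of_ne hbc, zero_smul, map_zero]
      coef_mem := hmem
      antipode := fun b c => π.injective <| by
        rw [hS.2.2 _ _ _ _ (e.vec b) (e.vec c) ⟨_, hmem b c⟩ (e.proj_vec b) (e.proj_vec c)
          (by rw [X.coeff_block (e.proj_vec b) (e.proj_vec c)]; exact hcoef b c), coeff_star,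
          X.coeff_block (e.proj_vec c) (e.proj_vec b), map_star, hcoef] }
  exact ⟨M, b, c, π.injective (by rw [ha]; exact hcoef b c)⟩

/-- The algebra generated by the units and the coefficients of `X` is spanned by the coefficients
of matrix corepresentations. -/
lemma mem_span_coefs (e : HomogeneousBasis p) (hX : X.IsUnitary)
    (hp : ∀ k l, IsCompactOperator (p.proj k l))
    (S : X.coefficientAlgebra →ₗ[ℂ] X.coefficientAlgebra) (hS : X.IsAntipode S)
    (hmem : ∀ k l, G.unit k l ∈ X.coefficientAlgebra) {a : A} (ha : a ∈ X.coefficientAlgebra) :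
    a ∈ Submodule.span ℂ (MatrixCorep.coefs G X.coefficientAlgebra S) := by
  induction ha using NonUnitalAlgebra.adjoin_induction with
  | mem x hx =>
    rcases hx with ⟨k, l, rfl⟩ | ⟨k, l, m, n, ξ, η, hξ, hη, hx⟩
    · exact Submodule.subset_span
        ⟨MatrixCorep.trivial hmem fun k l => hS.2.1 k l _ rfl, k, l, rfl⟩
    · rw [X.coeff_block hξ hη] at hx
      set N := (Submodule.span ℂ (MatrixCorep.coefs G X.coefficientAlgebra S)).map π.lin with hN
      -- the coefficient is conjugate linear in `ξ` and linear in `η`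
      suffices h : coeff X.op ξ η ∈ N by
        obtain ⟨y, hy, hyx⟩ := h
        rwa [← π.injective (hyx.trans hx.symm)]
      have h1 := e.mem_span k l ξ hξ
      have h2 := e.mem_span m n η hη
      clear hx hξ hη
      induction h1 using Submodule.span_induction with
      | mem ξ hb =>
        obtain ⟨b, -, rfl⟩ := hb
        induction h2 using Submodule.span_induction with
        | mem η hc =>
          obtain ⟨c, -, rfl⟩ := hc
          obtain ⟨a, ha⟩ := X.exists_toHom_eq_coeff hp (e.proj_vec b) (e.proj_vec c)
          exact ⟨a, Submodule.subset_span (X.exists_matrixCorep e hX hp S hS b c ha), ha⟩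
        | zero =>
          convert zero_mem N
          ext v; simp [coeff]
        | add η η' _ _ h h' =>
          convert add_mem h h'
          ext v; simp [coeff, tm_add_right]
        | smul z η _ h =>
          convert Submodule.smul_mem _ z h
          ext v; simp [coeff, tm_smul_right]
      | zero =>
        convert zero_mem N
        refine ContinuousLinearMap.ext fun v => ext_inner_left ℂ fun w => ?_
        simp [coeff, ContinuousLinearMap.adjoint_inner_right]
      | add ξ ξ' _ _ h h' =>
        convert add_mem h h'
        refine ContinuousLinearMap.ext fun v => ext_inner_left ℂ fun w => ?_
        simp [coeff, ContinuousLinearMap.adjoint_inner_right, tm_add_right, inner_add_left,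
          inner_add_right]
      | smul z ξ _ h =>
        convert Submodule.smul_mem _ (starRingEnd ℂ z) h
        refine ContinuousLinearMap.ext fun v => ext_inner_left ℂ fun w => ?_
        simp [coeff, ContinuousLinearMap.adjoint_inner_right, tm_smul_right, inner_smul_left,
          inner_smul_right]
  | add x y _ _ hx hy => exact add_mem hx hy
  | zero => exact zero_mem _
  | mul x y _ _ hx hy => exact MatrixCorep.mul_mem_span_coefs hS.1 hx hy
  | smul c x _ hx => exact Submodule.smul_mem _ c hx

end Representation

end PartialCQG

end

theorem mainTheorem2 {I A K H : Type*} [NonUnitalCStarAlgebra A]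
    [NormedAddCommGroup K] [InnerProductSpace ℂ K] [CompleteSpace K]
    [NormedAddCommGroup H] [InnerProductSpace ℂ H] [CompleteSpace H]
    (π : PartialCQG.FaithfulRep A K)
    (G : PartialCQG.PartialCompactQuantumSemigroup I π)
    (p : PartialCQG.Bigrading I H)
    (X : PartialCQG.Representation G p)
    (hX : X.IsPartialCompactMatrixPseudogroup) :
    G.IsPartialCompactQuantumGroup := by
  obtain ⟨e⟩ := p.nonempty_homogeneousBasis hX.rcfd.1 hX.rcfd.2
  have hp : ∀ k l, IsCompactOperator (p.proj k l) := fun k l => by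
    have := hX.rcfd.1 k
    have := Submodule.finiteDimensional_of_le (p.range_proj_le_row k l)
    exact PartialCQG.isCompactOperator_of_finiteDimensional_range
  obtain ⟨S, hS⟩ := hX.antipode
  have hmem : ∀ k l, G.unit k l ∈ X.coefficientAlgebra := fun k l =>
    NonUnitalAlgebra.subset_adjoin ℂ (Or.inl ⟨k, l, rfl⟩)
  obtain ⟨h1, h2⟩ := PartialCQG.MatrixCorep.density hS.1 hmem (fun k l => hS.2.1 k l _ rfl)
    (fun a ha => X.mem_span_coefs e hX.unitary hp S hS hmem ha) hX.dense
  exact ⟨hX.units_ne_zero, h1, h2⟩
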